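/- **Setting.** Let $S=(0,T)$ with $0<T<\infty$, $\alpha\ge 1$, $0\le\omega_0\le\omega_1<1$, $\bar y>0$, and let $\overline Y\subset\mathbb R^{2\times2}\cong\mathbb R^4$ be the closed Euclidean ball of radius $\bar y$ about $0$. Let $\Omega\subset\mathbb R^2$ be a bounded Lipschitz domain whose boundary is split, up to a set of length zero, into pairwise disjoint relatively open parts $\Gamma_0\neq\emptyset$, $\Gamma_1$, $\Gamma_2$. Let $\lambda,\mu\in L^\infty(\Omega)$ with $\mu\ge c$ and $\lambda+\mu\ge c$ a.e. for some $c>0$, let volume forces $f(t)$ and tractions $\tau(t)$, $t\in S$, be given, and let $\nabla^\mu u(x)=\int_\Omega\rho(x-y)\nabla u(y)\,dy$ be the mollified gradient, with a fixed smooth, compactly supported kernel $\rho\ge0$, $\int\rho=1$. Let $g\in\mathcal G\cap C^{0,1}(S;L^\infty(\Omega;C^{1,1}(\overline Y)))$, where $\mathcal G$ is the set of $g\in L^\infty(S;L^\infty(\Omega;C^{1,1}(\overline Y)))$ such that for every $y\in\overline Y$ one has $0\le g(\cdot,\cdot,y)\le T^{-1}(\omega_1-\omega_0)(1-\omega_1)^\alpha$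 a.e. in $S\times\Omega$. A *damage state* is a measurable $v$ on $\Omega$ with $0\le v\le\omega_1$ a.e. (for example $v=d(t,\cdot)$ for a damage function $d$). Let $V=\{u\in H^1(\Omega)^2: u=0\text{ on }\Gamma_0\}$ (the $H^1$-closure of the smooth fields vanishing on $\Gamma_0$). A displacement for $v$ at time $t$ is a weak solution $u=u[t,v]\in V$ of the equation of motion $$\int_\Omega(1-v)\big(\lambda\,\mathrm{tr}\,\varepsilon(u)\,I+2\mu\,\varepsilon(u)\big):\varepsilon(\varphi)\,dx=\int_\Omega f(t)\cdot\varphi\,dx+\int_{\Gamma_2}\tau(t)\cdot\varphi\,d\mathcal H^1\qquad(\varphi\in V),$$ and the right-hand side of the damage equation is $$r(t,x,v)=g\big(t,x,\nabla^\mu u[t,v](x)\big)\,(1-v(x))^{-\alpha},$$ which is meaningful at the points $x$ with $v(x)\in[0,\omega_1]$ and $\nabla^\mu u[t,v](x)\in\overline Y$. Let moreover $\mathcal T$ be a finite conforming triangulation of a polygonal domain $\Omega_h$ (for example $\Omega_h=\Omega$ if $\Omega$ is polygonal), let $\Gamma_{0,h},\Gamma_{2,h}\subset\partial\Omega_h$,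 where $\Gamma_{0,h}$ contains at least two points and $\Gamma_{2,h}$ is measurable, let $\lambda_h,\mu_h\in L^\infty(\Omega_h)$ satisfy the same ellipticity condition, and let $\tau_h(t)$ be tractions on $\Gamma_{2,h}$. Let $V_h$ be the space of continuous vector fields on $\overline\Omega_h$ that are affine on each triangle and vanish on $\Gamma_{0,h}$. Then $r_h(t,x,v)$ is defined in the same way, with $u[t,v]$ replaced by a solution $u_h[t,v]\in V_h$ of the same equation on $\Omega_h$ (with $\lambda_h,\mu_h,f(t),\tau_h(t),\Gamma_{2,h}$, test fields in $V_h$, and $v$ extended by $0$ outside $\Omega$), and with the integral in $\nabla^\mu$ taken over $\Omega_h$. **Lemma.** The right-hand sides $r$ and $r_h$ are Lipschitz with respect to the damage for almost every $x\in\Omega$. Precisely, for every $M\ge0$ there is $L\ge0$ such that for every $t\in S$ with $\|f(t)\|_{L^2(\Omega)}\le M$ and $\|\tau(t)\|_{L^2(\Gamma_2)}\le M$ (hence for almost every $t\in S$, if $f$ and $\tau$ are essentially bounded in time by $M$) and for almost every $x\in\Omega$, $$|r(t,x,v_1)-r(t,x,v_2)|\le L\big(|v_1(x)-v_2(x)|+\|v_1-v_2\|_{L^\infty(\Omega)}\big)$$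 for all damage states $v_1,v_2$, and all displacements for them, for which both values of $r$ are meaningful at $x$; the exceptional null set of $x$ may depend on $t$ but not on $v_1,v_2$. For every triangulation as above the same holds for $r_h$ (with a constant $L$ that may depend on the triangulation and the discrete data), with $\|f(t)\|_{L^2(\Omega_h)}\le M$ and $\|\tau_h(t)\|_{L^2(\Gamma_{2,h})}\le M$ in place of the bounds on the loads. -/

import Mathlib

open MeasureTheory Set Topology
open scoped NNReal ENNReal ContDiff

noncomputable section

namespace Damage

/-- Points and vectors of the Euclidean plane. -/
abbrev Plane := EuclideanSpace ℝ (Fin 2)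

/-- Real `2 × 2` matrices, identified with `ℝ⁴` and its Euclidean (Frobenius) norm. -/
abbrev Mat2 := EuclideanSpace ℝ (Fin 2 × Fin 2)

/-! ### Geometry -/

/-- A bounded Lipschitz domain in the plane: a bounded, connected, open set which near each
boundary point is, in suitable Cartesian coordinates, the region above a Lipschitz graph. -/
structure IsLipschitzDomain (Ω : Set Plane) : Prop where
  isOpen : IsOpen Ω
  isConnected : IsConnected Ω
  isBounded : Bornology.IsBounded Ω
  exists_chart : ∀ p ∈ frontier Ω, ∃ (Φ : Plane ≃ᵃⁱ[ℝ] Plane) (r h : ℝ) (K : ℝ≥0) (γ : ℝ → ℝ),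
    0 < r ∧ 0 < h ∧ LipschitzWith K γ ∧ Φ p = 0 ∧
      ∀ z : Plane, |Φ z 0| < r → |Φ z 1| < h → (z ∈ Ω ↔ γ (Φ z 0) < Φ z 1)

/-- Decomposition of the boundary of `Ω` into the clamped part `Γ₀`, the traction-free part `Γ₁`
and the loaded part `Γ₂`: relatively open, pairwise disjoint, covering up to a set of length zero,
with `Γ₀` non-empty. -/
structure IsBoundaryPartition (Ω Γ₀ Γ₁ Γ₂ : Set Plane) : Prop where
  relOpen₀ : ∃ U, IsOpen U ∧ Γ₀ = U ∩ frontier Ω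
  relOpen₁ : ∃ U, IsOpen U ∧ Γ₁ = U ∩ frontier Ω
  relOpen₂ : ∃ U, IsOpen U ∧ Γ₂ = U ∩ frontier Ω
  disjoint₀₁ : Disjoint Γ₀ Γ₁
  disjoint₀₂ : Disjoint Γ₀ Γ₂
  disjoint₁₂ : Disjoint Γ₁ Γ₂
  null_compl : (μH[1] : Measure Plane) (frontier Ω \ (Γ₀ ∪ Γ₁ ∪ Γ₂)) = 0
  nonempty₀ : Γ₀.Nonempty

/-- A (finite, conforming) triangulation of a polygonal domain: every simplex of the complex is a
face of a triangle. The triangulated domain is the interior of the union of the triangles. -/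
structure IsTriangulation (K : Geometry.SimplicialComplex ℝ Plane) : Prop where
  finite : K.faces.Finite
  pure : ∀ s ∈ K.faces, ∃ t ∈ K.faces, s ⊆ t ∧ t.card = 3
  isConnected : IsConnected (interior K.space)

/-! ### Linear elasticity with damage -/

/-- The displacement gradient, `(∇φ)ᵢⱼ = ∂ⱼ φᵢ`. -/
def grad (φ : Plane → Plane) (x : Plane) : Mat2 :=
  WithLp.toLp 2 fun p => fderiv ℝ φ x (EuclideanSpace.single p.2 1) p.1

/-- The symmetric part of a matrix; `sym (∇u)` is the linearized strain `ε(u)`. -/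
def sym (A : Mat2) : Mat2 :=
  WithLp.toLp 2 fun p => (A (p.1, p.2) + A (p.2, p.1)) / 2

/-- The trace of a matrix. -/
def tr (A : Mat2) : ℝ := A (0, 0) + A (1, 1)

/-- `(l tr(ε) I + 2 m ε) : η` with `ε = sym A` and `η = sym B`. -/
def stiffness (l m : ℝ) (A B : Mat2) : ℝ :=
  l * tr (sym A) * tr (sym B) + 2 * m * inner ℝ (sym A) (sym B)

/-- Bounded measurable Lamé coefficients on `Ω` for which Hooke's law is uniformly elliptic. -/
structure IsLame (Ω : Set Plane) (lam mu : Plane → ℝ) : Prop where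
  aemeasurable_lam : AEMeasurable lam (volume.restrict Ω)
  aemeasurable_mu : AEMeasurable mu (volume.restrict Ω)
  bounded : ∃ C : ℝ, ∀ᵐ x ∂(volume.restrict Ω), |lam x| ≤ C ∧ |mu x| ≤ C
  elliptic : ∃ c > 0, ∀ᵐ x ∂(volume.restrict Ω), c ≤ mu x ∧ c ≤ lam x + mu x

/-- `∫_Ω (1 - v) (lam tr(ε) I + 2 mu ε) : η`, where `ε`, `η` are the strains of the displacement
gradients `G`, `H` and `v` is the damage. -/
def energyForm (Ω : Set Plane) (lam mu v : Plane → ℝ) (G H : Plane → Mat2) : ℝ :=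
  ∫ x in Ω, (1 - v x) * stiffness (lam x) (mu x) (G x) (H x)

/-- Work of the volume force `f` and of the traction `τ` on `Γ₂`,
`∫_Ω f · φ + ∫_{Γ₂} τ · φ dℋ¹`. -/
def load (Ω Γ₂ : Set Plane) (f τ φ : Plane → Plane) : ℝ :=
  (∫ x in Ω, inner ℝ (f x) (φ x)) + ∫ x in Γ₂, inner ℝ (τ x) (φ x) ∂(μH[1] : Measure Plane)

/-- The volume force and the traction are square integrable with `L²` norms at most `M`. -/
structure LoadBound (Ω Γ₂ : Set Plane) (f τ : Plane → Plane) (M : ℝ≥0) : Prop where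
  memLp_f : MemLp f 2 (volume.restrict Ω)
  memLp_τ : MemLp τ 2 ((μH[1] : Measure Plane).restrict Γ₂)
  norm_f : eLpNorm f 2 (volume.restrict Ω) ≤ M
  norm_τ : eLpNorm τ 2 ((μH[1] : Measure Plane).restrict Γ₂) ≤ M

/-- Smooth vector fields (up to the boundary) which vanish on `Γ₀`. -/
def IsTestField (Γ₀ : Set Plane) (φ : Plane → Plane) : Prop :=
  ContDiff ℝ ∞ φ ∧ ∀ x ∈ Γ₀, φ x = 0

/-- `u` is in `V = {u ∈ H¹(Ω)², u = 0 on Γ₀}` with weak gradient `G`. The space `V` is the closure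
in the `H¹(Ω)` norm of the smooth vector fields vanishing on `Γ₀`. -/
structure MemV (Ω Γ₀ : Set Plane) (u : Plane → Plane) (G : Plane → Mat2) : Prop where
  memLp : MemLp u 2 (volume.restrict Ω)
  memLp_grad : MemLp G 2 (volume.restrict Ω)
  approx : ∀ δ : ℝ≥0, 0 < δ → ∃ φ, IsTestField Γ₀ φ ∧
    eLpNorm (fun x => φ x - u x) 2 (volume.restrict Ω) ≤ δ ∧
    eLpNorm (fun x => grad φ x - G x) 2 (volume.restrict Ω) ≤ δ

/-- `u ∈ V` (with gradient `G`) is the displacement belonging to the damage `v`, i.e. the weak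
solution of the equation of motion
`-div ((1 - v) (lam tr(ε(u)) I + 2 mu ε(u))) = f` in `Ω`,
with `u = 0` on `Γ₀`, normal stress `τ` on `Γ₂` and zero normal stress on the rest. -/
structure IsDisplacement (Ω Γ₀ Γ₂ : Set Plane) (lam mu : Plane → ℝ) (f τ : Plane → Plane)
    (v : Plane → ℝ) (u : Plane → Plane) (G : Plane → Mat2) : Prop where
  memV : MemV Ω Γ₀ u G
  weak_eq : ∀ φ, IsTestField Γ₀ φ → energyForm Ω lam mu v G (grad φ) = load Ω Γ₂ f τ φ

/-- The finite element space `V_h` of continuous, piecewise affine vector fields on a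
triangulation which vanish on `Γ₀`. -/
structure MemVh (K : Geometry.SimplicialComplex ℝ Plane) (Γ₀ : Set Plane)
    (φ : Plane → Plane) : Prop where
  continuousOn : ContinuousOn φ K.space
  affine : ∀ s ∈ K.faces, ∃ A : Plane →ᵃ[ℝ] Plane, EqOn φ A (convexHull ℝ (s : Set Plane))
  vanish : ∀ x ∈ Γ₀, φ x = 0

/-- `u ∈ V_h` is the discrete displacement belonging to the damage `v`, i.e. the solution of the
finite element equation of motion on the triangulated domain. -/
structure IsDiscreteDisplacement (K : Geometry.SimplicialComplex ℝ Plane) (Γ₀ Γ₂ : Set Plane)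
    (lam mu : Plane → ℝ) (f τ : Plane → Plane) (v : Plane → ℝ) (u : Plane → Plane) : Prop where
  memVh : MemVh K Γ₀ u
  discrete_eq : ∀ φ, MemVh K Γ₀ φ →
    energyForm (interior K.space) lam mu v (grad u) (grad φ) = load (interior K.space) Γ₂ f τ φ

/-! ### Damage states and damage processes -/

/-- A damage state on `Ω` (the value at one time of a damage function): a class in `L^∞(Ω)` with
values in `[0, ω₁]`. -/
structure IsDamageState (Ω : Set Plane) (ω₁ : ℝ) (v : Plane → ℝ) : Prop where
  aemeasurable : AEMeasurable v (volume.restrict Ω)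
  mem_Icc : ∀ᵐ x ∂(volume.restrict Ω), v x ∈ Icc 0 ω₁

/-- `q` is of class `C^{1,1}` on the closed ball of radius `R` about `0`, and the sup norms of `q`
and of its derivative and the Lipschitz constant of the derivative are all at most `M`. -/
def C11Bound (R M : ℝ) (q : Mat2 → ℝ) : Prop :=
  ∃ q' : Mat2 → Mat2 →L[ℝ] ℝ,
    (∀ y ∈ Metric.closedBall 0 R, HasFDerivWithinAt q (q' y) (Metric.closedBall 0 R) y) ∧
    (∀ y ∈ Metric.closedBall 0 R, |q y| ≤ M ∧ ‖q' y‖ ≤ M) ∧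
    ∀ y ∈ Metric.closedBall 0 R, ∀ z ∈ Metric.closedBall 0 R, ‖q' y - q' z‖ ≤ M * ‖y - z‖

/-- The set `𝒢` of admissible damage processes, on the time interval `(0, T)`, the domain `Ω` and
the closed ball of radius `R` in the space of matrices. -/
structure IsDamageProcess (T : ℝ) (Ω : Set Plane) (R α ω₀ ω₁ : ℝ)
    (g : ℝ → Plane → Mat2 → ℝ) : Prop where
  aestronglyMeasurable : ∀ y ∈ Metric.closedBall (0 : Mat2) R,
    AEStronglyMeasurable (fun p : ℝ × Plane => g p.1 p.2 y)
      ((volume.restrict (Ioo 0 T)).prod (volume.restrict Ω))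
  bounded : ∃ M : ℝ, ∀ᵐ t ∂(volume.restrict (Ioo 0 T)), ∀ᵐ x ∂(volume.restrict Ω),
    C11Bound R M (g t x)
  range : ∀ y ∈ Metric.closedBall (0 : Mat2) R,
    ∀ᵐ t ∂(volume.restrict (Ioo 0 T)), ∀ᵐ x ∂(volume.restrict Ω),
      g t x y ∈ Icc 0 (T⁻¹ * (ω₁ - ω₀) * (1 - ω₁) ^ α)

/-- The condition `g ∈ C^{0,1}(S; L^∞(Ω; C^{1,1}))` of Lipschitz dependence on time. -/
def IsLipschitzInTime (T : ℝ) (Ω : Set Plane) (R : ℝ) (g : ℝ → Plane → Mat2 → ℝ) : Prop :=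
  ∃ L : ℝ, ∀ s ∈ Ioo 0 T, ∀ t ∈ Ioo 0 T, ∀ᵐ x ∂(volume.restrict Ω),
    C11Bound R (L * |s - t|) (fun y => g s x y - g t x y)

/-- A smooth mollification kernel. -/
structure IsMollifier (ρ : Plane → ℝ) : Prop where
  contDiff : ContDiff ℝ ∞ ρ
  hasCompactSupport : HasCompactSupport ρ
  nonneg : ∀ x, 0 ≤ ρ x
  integral_eq_one : ∫ x, ρ x = 1

/-- The mollified gradient `(∇^μ u)(x) = ∫_Ω ρ(x - y) ∇u(y) dy`, as a function of `G = ∇u`. -/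
def mollifiedGrad (ρ : Plane → ℝ) (Ω : Set Plane) (G : Plane → Mat2) (x : Plane) : Mat2 :=
  ∫ y in Ω, ρ (x - y) • G y

/-- The right-hand side of the damage equation at time `t` and point `x`,
`g(t, x, (∇^μ u)(x)) (1 - v(x))^{-α}`, where `u` is the displacement, with gradient `G` on `Ω`,
that belongs to the damage `v`. -/
def rhs (α : ℝ) (ρ : Plane → ℝ) (Ω : Set Plane) (g : ℝ → Plane → Mat2 → ℝ) (t : ℝ) (x : Plane)
    (v : Plane → ℝ) (G : Plane → Mat2) : ℝ :=
  g t x (mollifiedGrad ρ Ω G x) * (1 - v x) ^ (-α)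

/-- The norm of `L^∞(Ω)`. -/
def supNorm (Ω : Set Plane) (w : Plane → ℝ) : ℝ :=
  (eLpNorm w ∞ (volume.restrict Ω)).toReal

end Damage

end

/-! At a fixed point the right-hand side is a product of `g`, which is Lipschitz in its matrix
argument, and `(1 - v)^(-α)`, which is Lipschitz on `[0, ω₁]` because `ω₁ < 1`. Everything therefore
reduces to a bound of the difference of two mollified gradients by the sup norm of the damage
difference.

For the strains this is an energy argument (`l2_strain_sub_le`). The form with weight `1 - v` is
coercive in the strain with a constant independent of `v`. Subtracting the two equations shows that
`u₁ - u₂` solves a problem whose load is the integral of `(v₁ - v₂)` times the stress of `u₂`, so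
the strain of `u₁ - u₂` is at most a constant times `‖v₁ - v₂‖_∞` times the strain of `u₂`. The
latter is bounded by the loads once the work of the loads is bounded by the strain of the test
field.

Two facts remain: the loads and the mollified gradient must be controlled by the strain alone. The
full Korn inequality is not needed. The component of a field along a line has a derivative given by
the strain, so values propagate along lines; two independent directions recover the whole vector.
Starting at the clamped boundary and spreading by connectedness and through Lipschitz charts, this
gives the `L²` bound `controlled_domain` and then the trace bound `exists_trace`. In the mollified
gradient only the rotation is not already a strain; integrating it by parts against the smooth
kernel leaves `L²` and boundary terms, which those two bounds control
(`exists_mollifiedGrad_bound`).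

For finite elements the geometry is replaced by finite-dimensional algebra. A strain-free field in
`V_h` is an infinitesimal rigid motion (`eq_zero_of_strain_eq_zero`), and vanishing at two points
kills it. Hence values and gradients are linear functions of the finitely many triangle strains, and
are bounded by them (`exists_fem_bound`). Both cases then feed the same abstract estimate
`exists_lipschitz_rhs`. -/

noncomputable section

namespace Damage

/-! ### Square integrable functions -/

/-- The `L²` norm as a real number. -/
def l2 {X E : Type*} [MeasurableSpace X] [NormedAddCommGroup E] (μ : Measure X) (F : X → E) : ℝ :=
  (eLpNorm F 2 μ).toReal

section L2

variable {X E E' H : Type*} [MeasurableSpace X] {μ : Measure X}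
  [NormedAddCommGroup E] [NormedAddCommGroup E'] [NormedAddCommGroup H]

lemma l2_nonneg (F : X → E) : 0 ≤ l2 μ F := ENNReal.toReal_nonneg

lemma l2_congr {F G : X → E} (h : F =ᵐ[μ] G) : l2 μ F = l2 μ G := by
  simp only [l2, eLpNorm_congr_ae h]

lemma l2_add_le {F G : X → E} (hF : MemLp F 2 μ) (hG : MemLp G 2 μ) :
    l2 μ (fun x => F x + G x) ≤ l2 μ F + l2 μ G := by
  unfold l2
  rw [← ENNReal.toReal_add hF.eLpNorm_ne_top hG.eLpNorm_ne_top]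
  exact ENNReal.toReal_mono (ENNReal.add_ne_top.2 ⟨hF.eLpNorm_ne_top, hG.eLpNorm_ne_top⟩)
    (eLpNorm_add_le hF.1 hG.1 (by norm_num))

lemma l2_le_mul {F : X → E} {G : X → E'} {c : ℝ} (hc : 0 ≤ c)
    (hG : MemLp G 2 μ) (h : ∀ᵐ x ∂μ, ‖F x‖ ≤ c * ‖G x‖) : l2 μ F ≤ c * l2 μ G := by
  have := eLpNorm_le_mul_eLpNorm_of_ae_le_mul h 2
  unfold l2
  have h2 := ENNReal.toReal_mono (ENNReal.mul_ne_top ENNReal.ofReal_ne_top hG.eLpNorm_ne_top) this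
  rwa [ENNReal.toReal_mul, ENNReal.toReal_ofReal hc] at h2

lemma ofReal_l2 {F : X → E} (hF : MemLp F 2 μ) : ENNReal.ofReal (l2 μ F) = eLpNorm F 2 μ :=
  ENNReal.ofReal_toReal hF.eLpNorm_ne_top

lemma eLpNorm_two_sq (F : X → E) : eLpNorm F 2 μ ^ 2 = ∫⁻ x, ‖F x‖ₑ ^ 2 ∂μ := by
  have := eLpNorm_nnreal_pow_eq_lintegral (f := F) (μ := μ) (p := 2) (by norm_num)
  norm_num at this
  exact_mod_cast this

lemma l2_sq_eq_integral {F : X → E} (hF : MemLp F 2 μ) : l2 μ F ^ 2 = ∫ x, ‖F x‖ ^ 2 ∂μ := by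
  have h1 := eLpNorm_two_sq (μ := μ) F
  rw [integral_eq_lintegral_of_nonneg_ae (Filter.Eventually.of_forall fun x => by positivity)
    (hF.1.norm.aemeasurable.pow_const 2).aestronglyMeasurable]
  unfold l2
  rw [← ENNReal.toReal_pow, h1]
  congr 1
  refine lintegral_congr fun x => ?_
  rw [ENNReal.ofReal_pow (norm_nonneg _), ofReal_norm]

lemma integrable_norm_mul_norm {F : X → E} {G : X → E'} (hF : MemLp F 2 μ) (hG : MemLp G 2 μ) :
    Integrable (fun x => ‖F x‖ * ‖G x‖) μ :=
  hF.norm.integrable_mul hG.norm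

lemma integral_norm_mul_norm_le {F : X → E} {G : X → E'} (hF : MemLp F 2 μ) (hG : MemLp G 2 μ) :
    ∫ x, ‖F x‖ * ‖G x‖ ∂μ ≤ l2 μ F * l2 μ G := by
  have h := integral_mul_norm_le_Lp_mul_Lq (μ := μ) (p := 2) (q := 2)
    Real.HolderConjugate.two_two (f := fun x => ‖F x‖) (g := fun x => ‖G x‖)
    (by simpa using hF.norm) (by simpa using hG.norm)
  simp only [norm_norm, Real.rpow_ofNat] at h
  rw [← l2_sq_eq_integral hF, ← l2_sq_eq_integral hG, ← Real.sqrt_eq_rpow,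
    Real.sqrt_sq (l2_nonneg _), ← Real.sqrt_eq_rpow, Real.sqrt_sq (l2_nonneg _)] at h
  exact h

/-- The Cauchy–Schwarz inequality. -/
lemma norm_integral_le_mul_l2 [NormedSpace ℝ H] {F : X → E} {G : X → E'} {h : X → H} {C : ℝ}
    (hC : 0 ≤ C) (hF : MemLp F 2 μ) (hG : MemLp G 2 μ)
    (hh : ∀ᵐ x ∂μ, ‖h x‖ ≤ C * (‖F x‖ * ‖G x‖)) : ‖∫ x, h x ∂μ‖ ≤ C * (l2 μ F * l2 μ G) := by
  refine (norm_integral_le_of_norm_le ((integrable_norm_mul_norm hF hG).const_mul C) hh).trans ?_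
  rw [integral_const_mul]
  exact mul_le_mul_of_nonneg_left (integral_norm_mul_norm_le hF hG) hC

lemma norm_setIntegral_smul_le_l2 [NormedSpace ℝ E] {B V : ℝ} (hV : μ.real univ ≤ V ^ 2)
    (hV0 : 0 ≤ V) [IsFiniteMeasure μ] (hB : 0 ≤ B) {ζ : X → ℝ} (hζ : ∀ x, |ζ x| ≤ B) {G : X → E}
    (hG : MemLp G 2 μ) : ‖∫ x, ζ x • G x ∂μ‖ ≤ B * V * l2 μ G := by
  have h1 : l2 μ (fun _ : X => (1 : ℝ)) ≤ V := by
    refine le_of_sq_le_sq ?_ hV0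
    rw [l2_sq_eq_integral (memLp_const 1)]
    simpa using hV
  have h2 := norm_integral_le_mul_l2 (μ := μ) (h := fun x => ζ x • G x) hB
    (memLp_const (1 : ℝ)) hG (Filter.Eventually.of_forall fun x => by
      rw [norm_smul, norm_one, one_mul]
      exact mul_le_mul_of_nonneg_right (hζ x) (norm_nonneg _))
  refine h2.trans ?_
  rw [mul_assoc]
  exact mul_le_mul_of_nonneg_left (mul_le_mul_of_nonneg_right h1 (l2_nonneg _)) hB

end L2

/-- Limit passage for density arguments: replacing a field by a test field within `δ` costs an error
linear in `δ`. -/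
lemma le_of_forall_le_add_mul {a b c : ℝ} (hc : 0 ≤ c)
    (h : ∀ δ > 0, a ≤ b + δ * c) : a ≤ b := by
  refine le_of_forall_pos_le_add fun ε hε => ?_
  refine (h (ε / (c + 1)) (by positivity)).trans ?_
  have : ε / (c + 1) * c ≤ ε := by
    rw [div_mul_eq_mul_div, div_le_iff₀ (by positivity)]
    nlinarith
  linarith

/-! ### Hooke's law -/

/-- The symmetric part as a continuous linear map. -/
def symL : Mat2 →L[ℝ] Mat2 :=
  LinearMap.toContinuousLinearMap
    { toFun := sym
      map_add' := fun A B => by ext p; simp [sym]; ring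
      map_smul' := fun c A => by ext p; simp [sym]; ring }

lemma sym_sub (A B : Mat2) : sym (A - B) = sym A - sym B := symL.map_sub A B

lemma continuous_sym : Continuous sym := symL.continuous

lemma norm_sq_mat (A : Mat2) :
    ‖A‖ ^ 2 = A (0, 0) ^ 2 + A (0, 1) ^ 2 + (A (1, 0) ^ 2 + A (1, 1) ^ 2) := by
  rw [EuclideanSpace.norm_sq_eq]
  simp [Fintype.sum_prod_type, Fin.sum_univ_two]

lemma norm_sym_le (A : Mat2) : ‖sym A‖ ≤ ‖A‖ := by
  refine le_of_sq_le_sq ?_ (norm_nonneg _)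
  rw [norm_sq_mat, norm_sq_mat]
  simp only [sym]
  nlinarith [sq_nonneg (A (0, 1) - A (1, 0))]

lemma memLp_sym {X : Type*} [MeasurableSpace X] {μ : Measure X} {G : X → Mat2}
    (hG : MemLp G 2 μ) : MemLp (fun x => sym (G x)) 2 μ :=
  hG.of_le (continuous_sym.comp_aestronglyMeasurable hG.1)
    (Filter.Eventually.of_forall fun _ => norm_sym_le _)

lemma abs_tr_sym_le (A : Mat2) : |tr (sym A)| ≤ 2 * ‖sym A‖ := by
  refine abs_le_of_sq_le_sq ?_ (by positivity)
  rw [mul_pow, norm_sq_mat]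
  simp only [tr]
  nlinarith [sq_nonneg ((sym A) (0, 0) - (sym A) (1, 1)), sq_nonneg ((sym A) (0, 1)),
    sq_nonneg ((sym A) (1, 0)), sq_nonneg ((sym A) (0, 0)), sq_nonneg ((sym A) (1, 1))]

lemma stiffness_sub_left (l m : ℝ) (A B C : Mat2) :
    stiffness l m (A - B) C = stiffness l m A C - stiffness l m B C := by
  simp only [stiffness, sym_sub, inner_sub_left, tr, PiLp.sub_apply]; ring

lemma stiffness_sub_right (l m : ℝ) (A B C : Mat2) :
    stiffness l m A (B - C) = stiffness l m A B - stiffness l m A C := by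
  simp only [stiffness, sym_sub, inner_sub_right, tr, PiLp.sub_apply]; ring

/-- The 6 is `2 * 2` from the two traces plus 2 from the term `2 * m`. -/
lemma abs_stiffness_le {l m C : ℝ} (hl : |l| ≤ C) (hm : |m| ≤ C) (A B : Mat2) :
    |stiffness l m A B| ≤ 6 * C * (‖sym A‖ * ‖sym B‖) := by
  have h1 := abs_real_inner_le_norm (sym A) (sym B)
  have hC : 0 ≤ C := (abs_nonneg _).trans hl
  have h2 : |l * tr (sym A) * tr (sym B)| ≤ C * (2 * ‖sym A‖) * (2 * ‖sym B‖) := by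
    rw [abs_mul, abs_mul]
    gcongr
    · exact abs_tr_sym_le A
    · exact abs_tr_sym_le B
  have h3 : |2 * m * inner ℝ (sym A) (sym B)| ≤ 2 * C * (‖sym A‖ * ‖sym B‖) := by
    rw [abs_mul, abs_mul, abs_two]
    gcongr
  exact (abs_add_le _ _).trans (by linarith)

/-- With strain entries `a, b, b', d` the quadratic form is `(l + m)(a + d)² + m(a - d)² + 2m(b² +
b'²)`, so ellipticity is exactly positivity of `m` and `l + m`. -/
lemma le_stiffness_self {l m c : ℝ} (hm : c ≤ m) (hlm : c ≤ l + m) (A : Mat2) :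
    2 * c * ‖sym A‖ ^ 2 ≤ stiffness l m A A := by
  rw [stiffness, real_inner_self_eq_norm_sq, norm_sq_mat]
  simp only [tr]
  have h1 := mul_nonneg (sub_nonneg.2 hm) (sq_nonneg ((sym A) (0, 0) - (sym A) (1, 1)))
  have h2 := mul_nonneg (sub_nonneg.2 hlm) (sq_nonneg ((sym A) (0, 0) + (sym A) (1, 1)))
  have h3 := mul_nonneg (sub_nonneg.2 hm) (sq_nonneg ((sym A) (0, 1)))
  have h4 := mul_nonneg (sub_nonneg.2 hm) (sq_nonneg ((sym A) (1, 0)))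
  nlinarith

/-! ### Energy estimates: stability of the strain under changes of the damage -/

section Energy

variable {Ω : Set Plane} {lam mu : Plane → ℝ}

lemma aestronglyMeasurable_stiffness (hlam : AEMeasurable lam (volume.restrict Ω))
    (hmu : AEMeasurable mu (volume.restrict Ω)) {G H : Plane → Mat2}
    (hG : AEStronglyMeasurable G (volume.restrict Ω))
    (hH : AEStronglyMeasurable H (volume.restrict Ω)) :
    AEStronglyMeasurable (fun x => stiffness (lam x) (mu x) (G x) (H x))
      (volume.restrict Ω) := by
  have htr : Continuous fun A : Mat2 => tr (sym A) := by
    have : Continuous tr := by unfold tr; fun_prop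
    exact this.comp continuous_sym
  have h1 := htr.comp_aestronglyMeasurable hG
  have h2 := htr.comp_aestronglyMeasurable hH
  have h3 := (continuous_sym.comp_aestronglyMeasurable hG).inner (𝕜 := ℝ)
    (continuous_sym.comp_aestronglyMeasurable hH)
  exact ((hlam.aestronglyMeasurable.mul h1).mul h2).add
    ((aestronglyMeasurable_const.mul hmu.aestronglyMeasurable).mul h3)

lemma weighted_stiffness_bound {w : Plane → ℝ} {C W : ℝ} (hW : 0 ≤ W)
    (hC : ∀ᵐ x ∂(volume.restrict Ω), |lam x| ≤ C ∧ |mu x| ≤ C)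
    (hw : ∀ᵐ x ∂(volume.restrict Ω), |w x| ≤ W) (G H : Plane → Mat2) :
    ∀ᵐ x ∂(volume.restrict Ω), ‖w x * stiffness (lam x) (mu x) (G x) (H x)‖
      ≤ W * (6 * C) * (‖sym (G x)‖ * ‖sym (H x)‖) := by
  filter_upwards [hC, hw] with x hx hwx
  rw [Real.norm_eq_abs, abs_mul, mul_assoc W]
  exact mul_le_mul hwx (abs_stiffness_le hx.1 hx.2 _ _) (abs_nonneg _) hW

lemma integrable_weighted_stiffness {w : Plane → ℝ} {C W : ℝ} (hW : 0 ≤ W)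
    (hlam : AEMeasurable lam (volume.restrict Ω)) (hmu : AEMeasurable mu (volume.restrict Ω))
    (hC : ∀ᵐ x ∂(volume.restrict Ω), |lam x| ≤ C ∧ |mu x| ≤ C)
    (hwm : AEMeasurable w (volume.restrict Ω))
    (hw : ∀ᵐ x ∂(volume.restrict Ω), |w x| ≤ W) {G H : Plane → Mat2}
    (hG : MemLp G 2 (volume.restrict Ω)) (hH : MemLp H 2 (volume.restrict Ω)) :
    Integrable (fun x => w x * stiffness (lam x) (mu x) (G x) (H x)) (volume.restrict Ω) :=
  ((integrable_norm_mul_norm (memLp_sym hG) (memLp_sym hH)).const_mul (W * (6 * C))).mono'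
    (hwm.aestronglyMeasurable.mul (aestronglyMeasurable_stiffness hlam hmu hG.1 hH.1))
    (weighted_stiffness_bound hW hC hw G H)

/-- The strain of the displacement depends Lipschitz continuously on the damage. Here `ℓ` is the
load and `𝒯` a class of test fields on which `ℓ` is bounded by the norm of the strain. -/
theorem l2_strain_sub_le (hlame : IsLame Ω lam mu) {ω₁ : ℝ} (hω₁ : ω₁ < 1) :
    ∃ C : ℝ, 0 ≤ C ∧ ∀ (v₁ v₂ : Plane → ℝ) (G₁ G₂ : Plane → Mat2) (ℓ : (Plane → Plane) → ℝ)
      (𝒯 : Set (Plane → Plane)) (A D : ℝ), 0 ≤ A →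
      MemLp G₁ 2 (volume.restrict Ω) → MemLp G₂ 2 (volume.restrict Ω) →
      AEMeasurable v₁ (volume.restrict Ω) → AEMeasurable v₂ (volume.restrict Ω) →
      (∀ᵐ x ∂(volume.restrict Ω), v₁ x ∈ Icc 0 ω₁) →
      (∀ᵐ x ∂(volume.restrict Ω), v₂ x ∈ Icc 0 ω₁) →
      0 ≤ D → (∀ᵐ x ∂(volume.restrict Ω), |v₁ x - v₂ x| ≤ D) →
      (∀ φ ∈ 𝒯, MemLp (grad φ) 2 (volume.restrict Ω)) →
      (∀ φ ∈ 𝒯, |ℓ φ| ≤ A * l2 (volume.restrict Ω) (fun x => sym (grad φ x))) →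
      (∀ φ ∈ 𝒯, energyForm Ω lam mu v₁ G₁ (grad φ) = ℓ φ) →
      (∀ φ ∈ 𝒯, energyForm Ω lam mu v₂ G₂ (grad φ) = ℓ φ) →
      (∀ δ > 0, ∃ φ ∈ 𝒯, l2 (volume.restrict Ω) (fun x => grad φ x - G₂ x) ≤ δ) →
      (∀ δ > 0, ∃ φ ∈ 𝒯, l2 (volume.restrict Ω) (fun x => grad φ x - (G₁ x - G₂ x)) ≤ δ) →
      l2 (volume.restrict Ω) (fun x => sym (G₁ x - G₂ x)) ≤ C * A * D := by
  obtain ⟨c, hc, hell⟩ := hlame.elliptic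
  obtain ⟨C₀, hC₀⟩ := hlame.bounded
  have hC₀' : ∀ᵐ x ∂(volume.restrict Ω), |lam x| ≤ |C₀| ∧ |mu x| ≤ |C₀| := by
    filter_upwards [hC₀] with x hx
    exact ⟨hx.1.trans (le_abs_self _), hx.2.trans (le_abs_self _)⟩
  have hC1 : 0 ≤ 6 * |C₀| := by positivity
  -- The coercivity constant, uniform over damage states since `1 - v ≥ 1 - ω₁`. It is used twice,
  -- for `G₂` and for `G₁ - G₂`, which explains `k ^ 2` in the final constant.
  set k : ℝ := (1 - ω₁) * (2 * c) with hk
  have hk0 : 0 < k := mul_pos (by linarith) (by linarith)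
  refine ⟨6 * |C₀| / k ^ 2, by positivity, ?_⟩
  intro v₁ v₂ G₁ G₂ ℓ 𝒯 A D hA hG₁ hG₂ hv₁m hv₂m hv₁ hv₂ hD hvD h𝒯 hℓ he₁ he₂ ha₂ ha
  set μ := volume.restrict Ω with hμ
  have hlm := hlame.aemeasurable_lam
  have hmm := hlame.aemeasurable_mu
  have hw : ∀ v : Plane → ℝ, (∀ᵐ x ∂μ, v x ∈ Icc 0 ω₁) → ∀ᵐ x ∂μ, |1 - v x| ≤ 1 := by
    intro v hv
    filter_upwards [hv] with x hx
    rw [abs_le]; constructor <;> linarith [hx.1, hx.2]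
  have hint : ∀ v : Plane → ℝ, AEMeasurable v μ → (∀ᵐ x ∂μ, v x ∈ Icc 0 ω₁) →
      ∀ G H : Plane → Mat2, MemLp G 2 μ → MemLp H 2 μ →
      Integrable (fun x => (1 - v x) * stiffness (lam x) (mu x) (G x) (H x)) μ :=
    fun v hvm hv G H hG hH => integrable_weighted_stiffness zero_le_one hlm hmm hC₀'
      (aemeasurable_const.sub hvm) (hw v hv) hG hH
  have hcoer : ∀ v : Plane → ℝ, AEMeasurable v μ → (∀ᵐ x ∂μ, v x ∈ Icc 0 ω₁) →
      ∀ G : Plane → Mat2, MemLp G 2 μ → k * l2 μ (fun x => sym (G x)) ^ 2 ≤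
        energyForm Ω lam mu v G G := by
    intro v hvm hv G hG
    rw [l2_sq_eq_integral (memLp_sym hG), ← integral_const_mul]
    refine integral_mono_ae (((memLp_sym hG).norm.integrable_sq).const_mul _)
      (hint v hvm hv G G hG hG) ?_
    filter_upwards [hv, hell] with x hx hx2
    have h1 := le_stiffness_self hx2.1 hx2.2 (G x)
    have h2 : 0 ≤ 2 * c * ‖sym (G x)‖ ^ 2 := by positivity
    simp only [hk]
    nlinarith [hx.1, hx.2]
  have hbd : ∀ v : Plane → ℝ, (∀ᵐ x ∂μ, v x ∈ Icc 0 ω₁) →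
      ∀ G H : Plane → Mat2, MemLp G 2 μ → MemLp H 2 μ → |energyForm Ω lam mu v G H| ≤
        1 * (6 * |C₀|) * (l2 μ (fun x => sym (G x)) * l2 μ (fun x => sym (H x))) :=
    fun v hv G H hG hH => norm_integral_le_mul_l2 (by positivity) (memLp_sym hG) (memLp_sym hH)
      (weighted_stiffness_bound zero_le_one hC₀' (hw v hv) G H)
  have hsymle : ∀ G : Plane → Mat2, MemLp G 2 μ → l2 μ (fun x => sym (G x)) ≤ l2 μ G := by
    intro G hG
    have := l2_le_mul (F := fun x => sym (G x)) zero_le_one hG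
      (Filter.Eventually.of_forall fun _ => by rw [one_mul]; exact norm_sym_le _)
    simpa using this
  have hesubr : ∀ v : Plane → ℝ, AEMeasurable v μ → (∀ᵐ x ∂μ, v x ∈ Icc 0 ω₁) →
      ∀ G H H' : Plane → Mat2, MemLp G 2 μ → MemLp H 2 μ → MemLp H' 2 μ →
      energyForm Ω lam mu v G (fun x => H x - H' x) =
        energyForm Ω lam mu v G H - energyForm Ω lam mu v G H' := by
    intro v hvm hv G H H' hG hH hH'
    unfold energyForm
    rw [← integral_sub (hint v hvm hv G H hG hH) (hint v hvm hv G H' hG hH')]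
    simp only [stiffness_sub_right, mul_sub, ← hμ]
  -- closeness of strains of approximating fields
  have hclose : ∀ (G : Plane → Mat2), MemLp G 2 μ → ∀ δ > 0, ∀ φ ∈ 𝒯,
      l2 μ (fun x => grad φ x - G x) ≤ δ →
      l2 μ (fun x => sym (grad φ x)) ≤ l2 μ (fun x => sym (G x)) + δ := by
    intro G hG δ hδ φ hφ hd
    have hm := (h𝒯 φ hφ).sub hG
    have h1 := l2_add_le (memLp_sym hm) (memLp_sym hG)
    have h2 := hsymle _ hm
    have h3 : (fun x => sym ((grad φ - G) x) + sym (G x)) = fun x => sym (grad φ x) := by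
      funext x; rw [Pi.sub_apply, sym_sub, sub_add_cancel]
    rw [h3] at h1
    have h4 : l2 μ (grad φ - G) ≤ δ := hd
    linarith
  -- Cancels one factor of the norm in an energy estimate; the case of norm zero is separate.
  have hdiv : ∀ a b : ℝ, 0 ≤ a → k * a ^ 2 ≤ b * a → 0 ≤ b → a ≤ b / k := by
    intro a b ha0 hab hb
    rcases ha0.eq_or_lt with h | h
    · rw [← h]; positivity
    · rw [le_div_iff₀ hk0]
      refine le_of_mul_le_mul_right ?_ h
      linarith [hab, sq a, mul_comm (a * a) k, mul_assoc a k a, mul_comm a k, mul_assoc k a a]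
  set S := l2 μ (fun x => sym (G₂ x)) with hS
  have hS0 : 0 ≤ S := l2_nonneg _
  have hSA : S ≤ A / k := by
    refine hdiv _ _ hS0 ?_ hA
    -- `G₂` need not be the gradient of an admissible test field, so the equation is tested with `φ`
    -- within `δ`. The load bound contributes the error `A * δ` and the energy form `6 * |C₀| * S *
    -- δ`.
    refine le_of_forall_le_add_mul (c := A + 6 * |C₀| * S) (by positivity) fun δ hδ => ?_
    obtain ⟨φ, hφ, hd⟩ := ha₂ δ hδ
    have h1 := hcoer v₂ hv₂m hv₂ G₂ hG₂
    have h2 := hesubr v₂ hv₂m hv₂ G₂ (grad φ) G₂ hG₂ (h𝒯 φ hφ) hG₂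
    have hm : MemLp (fun x => grad φ x - G₂ x) 2 μ := (h𝒯 φ hφ).sub hG₂
    have h3 := hbd v₂ hv₂ G₂ _ hG₂ hm
    have h4 := hℓ φ hφ
    rw [← he₂ φ hφ] at h4
    have h5 := hclose G₂ hG₂ δ hδ φ hφ hd
    have h6 : l2 μ (fun x => sym (grad φ x - G₂ x)) ≤ δ := (hsymle _ hm).trans hd
    rw [h2, abs_le] at h3
    rw [abs_le] at h4
    have h7 : A * l2 μ (fun x => sym (grad φ x)) ≤ A * (S + δ) :=
      mul_le_mul_of_nonneg_left h5 hA
    have h8 : 1 * (6 * |C₀|) * (S * l2 μ (fun x => sym (grad φ x - G₂ x)))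
        ≤ 1 * (6 * |C₀|) * (S * δ) := by gcongr
    rw [← hS] at h3 h1
    nlinarith [h3.1, h3.2, h4.1, h4.2]
  set G : Plane → Mat2 := fun x => G₁ x - G₂ x with hGdef
  have hG : MemLp G 2 μ := hG₁.sub hG₂
  set E := l2 μ (fun x => sym (G x)) with hE
  have hE0 : 0 ≤ E := l2_nonneg _
  have hEb : E ≤ (D * (6 * |C₀|) * S) / k := by
    refine hdiv _ _ hE0 ?_ (by positivity)
    refine le_of_forall_le_add_mul (c := D * (6 * |C₀|) * S + 6 * |C₀| * E) (by positivity)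
      fun δ hδ => ?_
    obtain ⟨φ, hφ, hd⟩ := ha δ hδ
    have h1 := hcoer v₁ hv₁m hv₁ G hG
    have h2 := hesubr v₁ hv₁m hv₁ G (grad φ) G hG (h𝒯 φ hφ) hG
    have hm : MemLp (fun x => grad φ x - G x) 2 μ := (h𝒯 φ hφ).sub hG
    have h3 := hbd v₁ hv₁ G _ hG hm
    have h5 := hclose G hG δ hδ φ hφ hd
    have h6 : l2 μ (fun x => sym (grad φ x - G x)) ≤ δ := (hsymle _ hm).trans hd
    -- Both equations have the same load, so the form with weight `1 - v₁` at `G₁` may be replaced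
    -- by the form with weight `1 - v₂` at `G₂`; only the difference of the weights survives.
    have h9 : energyForm Ω lam mu v₁ G (grad φ) =
        ∫ x in Ω, (v₁ x - v₂ x) * stiffness (lam x) (mu x) (G₂ x) (grad φ x) := by
      have e1 : energyForm Ω lam mu v₁ G (grad φ) =
          energyForm Ω lam mu v₁ G₁ (grad φ) - energyForm Ω lam mu v₁ G₂ (grad φ) := by
        unfold energyForm
        rw [← integral_sub (hint v₁ hv₁m hv₁ G₁ _ hG₁ (h𝒯 φ hφ))
          (hint v₁ hv₁m hv₁ G₂ _ hG₂ (h𝒯 φ hφ))]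
        simp only [hGdef, stiffness_sub_left, mul_sub, ← hμ]
      rw [e1, he₁ φ hφ, ← he₂ φ hφ]
      unfold energyForm
      rw [← integral_sub (hint v₂ hv₂m hv₂ G₂ _ hG₂ (h𝒯 φ hφ))
          (hint v₁ hv₁m hv₁ G₂ _ hG₂ (h𝒯 φ hφ))]
      congr 1; funext x; ring
    have h10 : |energyForm Ω lam mu v₁ G (grad φ)| ≤
        D * (6 * |C₀|) * (S * l2 μ (fun x => sym (grad φ x))) := by
      rw [h9]
      exact norm_integral_le_mul_l2 (by positivity) (memLp_sym hG₂) (memLp_sym (h𝒯 φ hφ))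
        (weighted_stiffness_bound hD hC₀' hvD G₂ (grad φ))
    rw [h2, abs_le] at h3
    rw [abs_le] at h10
    have h7 : D * (6 * |C₀|) * (S * l2 μ (fun x => sym (grad φ x))) ≤
        D * (6 * |C₀|) * (S * (E + δ)) := by gcongr
    have h8 : 1 * (6 * |C₀|) * (E * l2 μ (fun x => sym (grad φ x - G x)))
        ≤ 1 * (6 * |C₀|) * (E * δ) := by gcongr
    rw [← hE] at h3 h1
    nlinarith [h3.1, h3.2, h10.1, h10.2]
  refine hEb.trans ?_
  have : (D * (6 * |C₀|) * S) / k ≤ (D * (6 * |C₀|) * (A / k)) / k := by gcongr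
  refine this.trans (le_of_eq ?_)
  field_simp

end Energy

/-! ### The damage process -/

lemma C11Bound.abs_le {R M : ℝ} {q : Mat2 → ℝ} (h : C11Bound R M q) {y : Mat2}
    (hy : y ∈ Metric.closedBall (0 : Mat2) R) : |q y| ≤ M := by
  obtain ⟨q', -, h2, -⟩ := h
  exact (h2 y hy).1

lemma C11Bound.abs_sub_le {R M : ℝ} {q : Mat2 → ℝ} (h : C11Bound R M q) {y z : Mat2}
    (hy : y ∈ Metric.closedBall (0 : Mat2) R) (hz : z ∈ Metric.closedBall (0 : Mat2) R) :
    |q y - q z| ≤ M * ‖y - z‖ := by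
  obtain ⟨q', h1, h2, -⟩ := h
  exact (convex_closedBall (0 : Mat2) R).norm_image_sub_le_of_norm_hasFDerivWithin_le h1
    (fun x hx => (h2 x hx).2) hz hy

/-- An admissible damage process which is Lipschitz in time is, at every time, bounded and
Lipschitz on the ball, uniformly in time. -/
lemma exists_bound_damageProcess {T R α ω₀ ω₁ : ℝ} (hT : 0 < T) {Ω : Set Plane}
    {g : ℝ → Plane → Mat2 → ℝ} (hg : IsDamageProcess T Ω R α ω₀ ω₁ g)
    (hgt : IsLipschitzInTime T Ω R g) :
    ∃ M : ℝ, 0 ≤ M ∧ ∀ t ∈ Ioo 0 T, ∀ᵐ x ∂(volume.restrict Ω),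
      ∀ y ∈ Metric.closedBall (0 : Mat2) R, |g t x y| ≤ M ∧
        ∀ z ∈ Metric.closedBall (0 : Mat2) R, |g t x y - g t x z| ≤ M * ‖y - z‖ := by
  obtain ⟨M, hM⟩ := hg.bounded
  obtain ⟨L, hL⟩ := hgt
  -- The bound on `g` is known only for almost every time. As the interval has positive length it
  -- holds at some time `s`, and Lipschitz continuity in time carries it to every `t` at the cost
  -- `|L| * T`.
  have : NeZero (volume.restrict (Ioo 0 T)) := ⟨by
    rw [Ne, Measure.restrict_eq_zero, Real.volume_Ioo]; simpa using hT⟩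
  have hne : ∃ s, s ∈ Ioo 0 T ∧ ∀ᵐ x ∂(volume.restrict Ω), C11Bound R M (g s x) :=
    ((ae_restrict_mem measurableSet_Ioo).and hM).exists
  obtain ⟨s, hs, hsM⟩ := hne
  refine ⟨|M| + |L| * T, by positivity, fun t ht => ?_⟩
  filter_upwards [hsM, hL t ht s hs] with x h1 h2 y hy
  have hLT : L * |t - s| ≤ |L| * T := by
    refine mul_le_mul (le_abs_self L) ?_ (abs_nonneg _) (abs_nonneg _)
    rw [abs_le]; constructor <;> linarith [ht.1, ht.2, hs.1, hs.2]
  refine ⟨?_, fun z hz => ?_⟩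
  · have h3 := h1.abs_le hy
    have h4 : |g t x y - g s x y| ≤ L * |t - s| := h2.abs_le hy
    rw [abs_le] at *
    constructor <;> linarith [le_abs_self M, h3.1, h3.2, h4.1, h4.2]
  · have h3 := h1.abs_sub_le hy hz
    have h4 : |(g t x y - g s x y) - (g t x z - g s x z)| ≤ L * |t - s| * ‖y - z‖ :=
      h2.abs_sub_le hy hz
    have h5 : L * |t - s| * ‖y - z‖ ≤ |L| * T * ‖y - z‖ := by gcongr
    have h6 : M * ‖y - z‖ ≤ |M| * ‖y - z‖ := by gcongr; exact le_abs_self M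
    rw [abs_le] at h3 h4 ⊢
    constructor <;> linarith [h3.1, h3.2, h4.1, h4.2]

/-- The power and its derivative `α (1 - a)^(-(α + 1))` both increase with `a`, so their values at
`ω₁` serve as bounds, and the mean value inequality applies. -/
lemma exists_bound_rpow {α ω₁ : ℝ} (hα : 1 ≤ α) (hω₁ : ω₁ < 1) :
    ∃ C : ℝ, 0 ≤ C ∧ ∀ a ∈ Icc 0 ω₁, |(1 - a) ^ (-α)| ≤ C ∧
      ∀ b ∈ Icc 0 ω₁, |(1 - a) ^ (-α) - (1 - b) ^ (-α)| ≤ C * |a - b| := by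
  have h0 : 0 < 1 - ω₁ := by linarith
  have hm : ∀ β : ℝ, 0 ≤ β → ∀ a ∈ Icc 0 ω₁, (1 - a) ^ (-β) ≤ (1 - ω₁) ^ (-β) :=
    fun β hβ a ha => Real.rpow_le_rpow_of_nonpos h0 (by linarith [ha.2]) (by linarith)
  refine ⟨max ((1 - ω₁) ^ (-α)) (α * (1 - ω₁) ^ (-(α + 1))),
    le_max_of_le_left (Real.rpow_nonneg h0.le _), fun a ha => ⟨?_, fun b hb => ?_⟩⟩
  · rw [abs_of_nonneg (Real.rpow_nonneg (by linarith [ha.2]) _)]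
    exact (hm α (by linarith) a ha).trans (le_max_left _ _)
  · refine ((convex_Icc (0 : ℝ) ω₁).norm_image_sub_le_of_norm_hasDerivWithin_le
      (f := fun a : ℝ => (1 - a) ^ (-α)) (f' := fun a => α * (1 - a) ^ (-(α + 1)))
      (C := α * (1 - ω₁) ^ (-(α + 1))) (fun x hx => ?_) (fun x hx => ?_) hb ha).trans ?_
    · have h1 : HasDerivAt (fun a : ℝ => 1 - a) (-1) x := by
        simpa using (hasDerivAt_id x).const_sub 1
      have h2 := h1.rpow_const (p := -α) (Or.inl (by linarith [hx.2]))
      convert h2.hasDerivWithinAt using 1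
      rw [neg_add']; ring
    · have h3 : 0 ≤ (1 - x) ^ (-(α + 1)) := Real.rpow_nonneg (by linarith [hx.2]) _
      rw [Real.norm_eq_abs, abs_of_nonneg (by positivity)]
      exact mul_le_mul_of_nonneg_left (hm (α + 1) (by linarith) x hx) (by linarith)
    · exact mul_le_mul_of_nonneg_right (le_max_right _ _) (norm_nonneg _)

/-- Lipschitz dependence of the right-hand side on the local damage and the mollified gradient. -/
lemma exists_rhs_sub_le {T R α ω₀ ω₁ : ℝ} (hT : 0 < T) (hα : 1 ≤ α) (hω₁ : ω₁ < 1)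
    {Ω : Set Plane} {g : ℝ → Plane → Mat2 → ℝ} (hg : IsDamageProcess T Ω R α ω₀ ω₁ g)
    (hgt : IsLipschitzInTime T Ω R g) (ρ : Plane → ℝ) (Ω' : Set Plane) :
    ∃ L : ℝ, 0 ≤ L ∧ ∀ t ∈ Ioo 0 T, ∀ᵐ x ∂(volume.restrict Ω), ∀ (v₁ v₂ : Plane → ℝ)
      (G₁ G₂ : Plane → Mat2), v₁ x ∈ Icc 0 ω₁ → v₂ x ∈ Icc 0 ω₁ →
      ‖mollifiedGrad ρ Ω' G₁ x‖ ≤ R → ‖mollifiedGrad ρ Ω' G₂ x‖ ≤ R →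
      |rhs α ρ Ω' g t x v₁ G₁ - rhs α ρ Ω' g t x v₂ G₂| ≤
        L * (|v₁ x - v₂ x| + ‖mollifiedGrad ρ Ω' G₁ x - mollifiedGrad ρ Ω' G₂ x‖) := by
  obtain ⟨M, hM, hgM⟩ := exists_bound_damageProcess hT hg hgt
  obtain ⟨C, hC, hpow⟩ := exists_bound_rpow hα hω₁
  refine ⟨M * C, by positivity, fun t ht => ?_⟩
  -- The exceptional null set comes from `g` at time `t` only and is fixed before the damage states
  -- and displacements are chosen.
  filter_upwards [hgM t ht] with x hx v₁ v₂ G₁ G₂ h1 h2 hm1 hm2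
  set y := mollifiedGrad ρ Ω' G₁ x
  set z := mollifiedGrad ρ Ω' G₂ x
  have hy : y ∈ Metric.closedBall (0 : Mat2) R := by simpa using hm1
  have hz : z ∈ Metric.closedBall (0 : Mat2) R := by simpa using hm2
  have e : rhs α ρ Ω' g t x v₁ G₁ - rhs α ρ Ω' g t x v₂ G₂ =
      (g t x y - g t x z) * (1 - v₁ x) ^ (-α) +
        g t x z * ((1 - v₁ x) ^ (-α) - (1 - v₂ x) ^ (-α)) := by
    simp only [rhs]; ring
  have b1 : |(g t x y - g t x z) * (1 - v₁ x) ^ (-α)| ≤ M * ‖y - z‖ * C := by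
    rw [abs_mul]
    exact mul_le_mul ((hx y hy).2 z hz) (hpow _ h1).1 (abs_nonneg _) (by positivity)
  have b2 : |g t x z * ((1 - v₁ x) ^ (-α) - (1 - v₂ x) ^ (-α))| ≤ M * (C * |v₁ x - v₂ x|) := by
    rw [abs_mul]
    exact mul_le_mul (hx z hz).1 ((hpow _ h1).2 _ h2) (abs_nonneg _) hM
  rw [e]
  refine (abs_add_le _ _).trans ((add_le_add b1 b2).trans (le_of_eq ?_))
  ring

/-! ### Sup norm of damage differences, bounds for the kernel -/

lemma supNorm_nonneg (Ω : Set Plane) (w : Plane → ℝ) : 0 ≤ supNorm Ω w := ENNReal.toReal_nonneg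

lemma IsDamageState.abs_sub_le_supNorm {Ω : Set Plane} {ω₁ : ℝ} {v₁ v₂ : Plane → ℝ}
    (h₁ : IsDamageState Ω ω₁ v₁) (h₂ : IsDamageState Ω ω₁ v₂) :
    ∀ᵐ x ∂(volume.restrict Ω), |v₁ x - v₂ x| ≤ supNorm Ω (fun y => v₁ y - v₂ y) := by
  -- Finiteness matters: `supNorm` is a `toReal`, which would be 0 at infinity.
  have hfin : eLpNorm (fun y => v₁ y - v₂ y) ∞ (volume.restrict Ω) ≠ ⊤ := by
    rw [eLpNorm_exponent_top]
    refine (eLpNormEssSup_lt_top_of_ae_bound (C := ω₁) ?_).ne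
    filter_upwards [h₁.mem_Icc, h₂.mem_Icc] with x hx1 hx2
    rw [Real.norm_eq_abs, abs_le]
    constructor <;> linarith [hx1.1, hx1.2, hx2.1, hx2.2]
  have h := ae_le_eLpNormEssSup (f := fun y => v₁ y - v₂ y) (μ := volume.restrict Ω)
  filter_upwards [h] with x hx
  rw [← eLpNorm_exponent_top] at hx
  have := ENNReal.toReal_mono hfin hx
  simpa [supNorm] using this

lemma IsMollifier.exists_bound {ρ : Plane → ℝ} (hρ : IsMollifier ρ) :
    ∃ B : ℝ, 0 ≤ B ∧ ∀ x, |ρ x| ≤ B := by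
  obtain ⟨B, hB⟩ := hρ.hasCompactSupport.exists_bound_of_continuous hρ.contDiff.continuous
  exact ⟨B, (norm_nonneg _).trans (hB 0), hB⟩

section Mollified

variable {ρ : Plane → ℝ} {Ω : Set Plane}

lemma IsMollifier.integrable_smul (hρ : IsMollifier ρ) (hΩ : volume Ω ≠ ⊤) {G : Plane → Mat2}
    (hG : MemLp G 2 (volume.restrict Ω)) (x : Plane) :
    Integrable (fun y => ρ (x - y) • G y) (volume.restrict Ω) := by
  have : IsFiniteMeasure (volume.restrict Ω) := ⟨by simpa using hΩ.lt_top⟩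
  obtain ⟨B, hB0, hB⟩ := hρ.exists_bound
  refine Integrable.bdd_smul (φ := fun y => ρ (x - y)) (hG.integrable (by norm_num)) B ?_ ?_
  · exact (hρ.contDiff.continuous.comp (continuous_const.sub continuous_id)).aestronglyMeasurable
  · exact Filter.Eventually.of_forall fun _ => hB _

lemma mollifiedGrad_sub (hρ : IsMollifier ρ) (hΩ : volume Ω ≠ ⊤) {G H : Plane → Mat2}
    (hG : MemLp G 2 (volume.restrict Ω)) (hH : MemLp H 2 (volume.restrict Ω)) (x : Plane) :
    mollifiedGrad ρ Ω (fun y => G y - H y) x = mollifiedGrad ρ Ω G x - mollifiedGrad ρ Ω H x := by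
  unfold mollifiedGrad
  rw [← integral_sub (hρ.integrable_smul hΩ hG x) (hρ.integrable_smul hΩ hH x)]
  simp only [smul_sub]

/-- A bound of the mollified gradient by the strain extends from a class of test fields to its
closure. -/
lemma norm_mollifiedGrad_le_of_approx (hρ : IsMollifier ρ) (hΩ : volume Ω ≠ ⊤)
    {𝒯 : Set (Plane → Plane)} {C : ℝ} (hC : 0 ≤ C)
    (h𝒯 : ∀ φ ∈ 𝒯, MemLp (grad φ) 2 (volume.restrict Ω))
    (hb : ∀ φ ∈ 𝒯, ∀ x, ‖mollifiedGrad ρ Ω (grad φ) x‖ ≤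
      C * l2 (volume.restrict Ω) (fun y => sym (grad φ y)))
    {G : Plane → Mat2} (hG : MemLp G 2 (volume.restrict Ω))
    (ha : ∀ δ > 0, ∃ φ ∈ 𝒯, l2 (volume.restrict Ω) (fun x => grad φ x - G x) ≤ δ) (x : Plane) :
    ‖mollifiedGrad ρ Ω G x‖ ≤ C * l2 (volume.restrict Ω) (fun y => sym (G y)) := by
  have : IsFiniteMeasure (volume.restrict Ω) := ⟨by simpa using hΩ.lt_top⟩
  obtain ⟨B, hB0, hB⟩ := hρ.exists_bound
  set V := √((volume.restrict Ω).real univ)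
  refine le_of_forall_le_add_mul (c := C + B * V) (by positivity) fun δ hδ => ?_
  obtain ⟨φ, hφ, hd⟩ := ha δ hδ
  have hm : MemLp (fun y => grad φ y - G y) 2 (volume.restrict Ω) := (h𝒯 φ hφ).sub hG
  have h1 := norm_setIntegral_smul_le_l2 (μ := volume.restrict Ω) (V := V)
    (Real.sq_sqrt measureReal_nonneg).ge (Real.sqrt_nonneg _) hB0 (ζ := fun y => ρ (x - y))
    (fun y => hB _) hm
  have h2 := mollifiedGrad_sub hρ hΩ (h𝒯 φ hφ) hG x
  have h3 : ‖mollifiedGrad ρ Ω (fun y => grad φ y - G y) x‖ ≤ B * V * δ :=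
    h1.trans (mul_le_mul_of_nonneg_left hd (by positivity))
  rw [h2] at h3
  have h4 : l2 (volume.restrict Ω) (fun y => sym (grad φ y)) ≤
      l2 (volume.restrict Ω) (fun y => sym (G y)) + δ := by
    have h5 := l2_add_le (memLp_sym hm) (memLp_sym hG)
    have h6 := l2_le_mul (F := fun y => sym (grad φ y - G y)) zero_le_one hm
      (Filter.Eventually.of_forall fun _ => by rw [one_mul]; exact norm_sym_le _)
    simp only [sym_sub, sub_add_cancel] at h5 h6
    linarith
  have h7 := hb φ hφ x
  have h8 := norm_sub_norm_le (mollifiedGrad ρ Ω G x) (mollifiedGrad ρ Ω (grad φ) x)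
  rw [norm_sub_rev] at h8
  have h9 := mul_le_mul_of_nonneg_left h4 hC
  linarith

end Mollified

/-- Abstract form of the Lipschitz estimate, for displacements in the closure of a class `𝒯` of test
fields on `Ω'` which satisfies a Korn type inequality. -/
theorem exists_lipschitz_rhs {T R α ω₀ ω₁ : ℝ} (hT : 0 < T) (hα : 1 ≤ α) (hω₁ : ω₁ < 1)
    {Ω Ω' : Set Plane} {g : ℝ → Plane → Mat2 → ℝ} (hg : IsDamageProcess T Ω R α ω₀ ω₁ g)
    (hgt : IsLipschitzInTime T Ω R g) {ρ : Plane → ℝ} (hρ : IsMollifier ρ)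
    {lam mu : Plane → ℝ} (hlame : IsLame Ω' lam mu) (hΩ' : volume Ω' ≠ ⊤)
    {𝒯 : Set (Plane → Plane)} {C : ℝ} (hC : 0 ≤ C)
    (h𝒯 : ∀ φ ∈ 𝒯, MemLp (grad φ) 2 (volume.restrict Ω'))
    (hsub : ∀ φ ∈ 𝒯, ∀ ψ ∈ 𝒯, ∃ χ ∈ 𝒯, grad χ =ᵐ[volume.restrict Ω'] fun x => grad φ x - grad ψ x)
    (hb : ∀ φ ∈ 𝒯, ∀ x, ‖mollifiedGrad ρ Ω' (grad φ) x‖ ≤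
      C * l2 (volume.restrict Ω') (fun y => sym (grad φ y))) {A : ℝ} (hA : 0 ≤ A) :
    ∃ L : ℝ≥0, ∀ t ∈ Ioo 0 T, ∀ᵐ x ∂(volume.restrict Ω), ∀ (v₁ v₂ w₁ w₂ : Plane → ℝ)
      (G₁ G₂ : Plane → Mat2) (ℓ : (Plane → Plane) → ℝ) (D : ℝ),
      MemLp G₁ 2 (volume.restrict Ω') → MemLp G₂ 2 (volume.restrict Ω') →
      AEMeasurable w₁ (volume.restrict Ω') → AEMeasurable w₂ (volume.restrict Ω') →
      (∀ᵐ x ∂(volume.restrict Ω'), w₁ x ∈ Icc 0 ω₁) →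
      (∀ᵐ x ∂(volume.restrict Ω'), w₂ x ∈ Icc 0 ω₁) →
      0 ≤ D → (∀ᵐ x ∂(volume.restrict Ω'), |w₁ x - w₂ x| ≤ D) →
      (∀ φ ∈ 𝒯, |ℓ φ| ≤ A * l2 (volume.restrict Ω') (fun x => sym (grad φ x))) →
      (∀ φ ∈ 𝒯, energyForm Ω' lam mu w₁ G₁ (grad φ) = ℓ φ) →
      (∀ φ ∈ 𝒯, energyForm Ω' lam mu w₂ G₂ (grad φ) = ℓ φ) →
      (∀ δ > 0, ∃ φ ∈ 𝒯, l2 (volume.restrict Ω') (fun x => grad φ x - G₁ x) ≤ δ) →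
      (∀ δ > 0, ∃ φ ∈ 𝒯, l2 (volume.restrict Ω') (fun x => grad φ x - G₂ x) ≤ δ) →
      v₁ x ∈ Icc 0 ω₁ → v₂ x ∈ Icc 0 ω₁ →
      ‖mollifiedGrad ρ Ω' G₁ x‖ ≤ R → ‖mollifiedGrad ρ Ω' G₂ x‖ ≤ R →
      |rhs α ρ Ω' g t x v₁ G₁ - rhs α ρ Ω' g t x v₂ G₂| ≤ L * (|v₁ x - v₂ x| + D) := by
  obtain ⟨L, hL0, hL⟩ := exists_rhs_sub_le hT hα hω₁ hg hgt ρ Ω'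
  obtain ⟨C₁, hC₁0, hC₁⟩ := l2_strain_sub_le hlame hω₁
  refine ⟨(L * (1 + C * (C₁ * A))).toNNReal, fun t ht => ?_⟩
  filter_upwards [hL t ht] with x hx v₁ v₂ w₁ w₂ G₁ G₂ ℓ D hG₁ hG₂ hw₁m hw₂m hw₁ hw₂ hD hwD hℓ
    he₁ he₂ ha₁ ha₂ hv₁ hv₂ hm₁ hm₂
  have hG : MemLp (fun y => G₁ y - G₂ y) 2 (volume.restrict Ω') := hG₁.sub hG₂
  -- The closure of the test gradients is stable under differences, so the difference of two
  -- displacements is itself approximable, with `δ / 2` for each.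
  have ha : ∀ δ > 0, ∃ φ ∈ 𝒯,
      l2 (volume.restrict Ω') (fun x => grad φ x - (G₁ x - G₂ x)) ≤ δ := by
    intro δ hδ
    obtain ⟨φ, hφ, h1⟩ := ha₁ (δ / 2) (by linarith)
    obtain ⟨ψ, hψ, h2⟩ := ha₂ (δ / 2) (by linarith)
    obtain ⟨χ, hχ, h3⟩ := hsub φ hφ ψ hψ
    refine ⟨χ, hχ, ?_⟩
    have m1 : MemLp (fun x => grad φ x - G₁ x) 2 (volume.restrict Ω') := (h𝒯 φ hφ).sub hG₁
    have m2 : MemLp (fun x => G₂ x - grad ψ x) 2 (volume.restrict Ω') := hG₂.sub (h𝒯 ψ hψ)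
    have h4 := l2_add_le m1 m2
    have h5 : l2 (volume.restrict Ω') (fun x => G₂ x - grad ψ x) ≤ 1 *
        l2 (volume.restrict Ω') (fun x => grad ψ x - G₂ x) :=
      l2_le_mul zero_le_one ((h𝒯 ψ hψ).sub hG₂)
        (Filter.Eventually.of_forall fun y => by rw [one_mul, norm_sub_rev])
    -- The gradient of the difference field is given only almost everywhere, since finite element
    -- fields need not be differentiable across edges.
    rw [l2_congr (G := fun x => grad φ x - G₁ x + (G₂ x - grad ψ x))
      (by filter_upwards [h3] with y hy; rw [hy]; abel)]
    linarith
  have k1 := hC₁ w₁ w₂ G₁ G₂ ℓ 𝒯 A D hA hG₁ hG₂ hw₁m hw₂m hw₁ hw₂ hD hwD h𝒯 hℓ he₁ he₂ ha₂ ha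
  have k2 := norm_mollifiedGrad_le_of_approx hρ hΩ' hC h𝒯 hb hG ha x
  rw [mollifiedGrad_sub hρ hΩ' hG₁ hG₂] at k2
  have k3 := k2.trans (mul_le_mul_of_nonneg_left k1 hC)
  refine (hx v₁ v₂ G₁ G₂ hv₁ hv₂ hm₁ hm₂).trans ?_
  rw [Real.coe_toNNReal _ (by positivity), mul_assoc L]
  refine mul_le_mul_of_nonneg_left ?_ hL0
  have k4 : 0 ≤ C * (C₁ * A) * |v₁ x - v₂ x| := by positivity
  nlinarith

/-! ### Displacements along lines -/

/-- The rank one matrix `η ⊗ ξ`. -/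
def outer (η ξ : Plane) : Mat2 := WithLp.toLp 2 fun p => η p.1 * ξ p.2

lemma inner_plane (x y : Plane) : inner ℝ x y = x 0 * y 0 + x 1 * y 1 := by
  simp [PiLp.inner_apply, Fin.sum_univ_two, mul_comm]

lemma norm_sq_plane (x : Plane) : ‖x‖ ^ 2 = x 0 ^ 2 + x 1 ^ 2 := by
  rw [EuclideanSpace.norm_sq_eq]; simp [Fin.sum_univ_two]

lemma inner_mat (A B : Mat2) : inner ℝ A B =
    A (0, 0) * B (0, 0) + A (0, 1) * B (0, 1) + (A (1, 0) * B (1, 0) + A (1, 1) * B (1, 1)) := by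
  simp [PiLp.inner_apply, Fintype.sum_prod_type, Fin.sum_univ_two, mul_comm]

lemma norm_outer (η ξ : Plane) : ‖outer η ξ‖ = ‖η‖ * ‖ξ‖ := by
  rw [← sq_eq_sq₀ (norm_nonneg _) (by positivity), mul_pow, norm_sq_mat, norm_sq_plane,
    norm_sq_plane]
  simp only [outer]
  ring

lemma plane_eq_sum (ξ : Plane) :
    ξ = ξ 0 • EuclideanSpace.single 0 (1 : ℝ) + ξ 1 • EuclideanSpace.single 1 (1 : ℝ) := by
  ext i; fin_cases i <;> simp

lemma inner_fderiv (φ : Plane → Plane) (x ξ η : Plane) :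
    inner ℝ (fderiv ℝ φ x ξ) η = inner ℝ (grad φ x) (outer η ξ) := by
  conv_lhs => rw [plane_eq_sum ξ]
  rw [map_add, map_smul, map_smul, inner_plane, inner_mat]
  simp only [grad, outer, PiLp.add_apply, PiLp.smul_apply, smul_eq_mul]
  ring

/-- Symmetrizing in the two directions removes the rotation. For `η = ξ` the derivative along a line
of the component in that line is a pure strain, which is what makes propagation along lines
possible. -/
lemma inner_fderiv_add (φ : Plane → Plane) (x ξ η : Plane) :
    inner ℝ (fderiv ℝ φ x ξ) η + inner ℝ (fderiv ℝ φ x η) ξ =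
      2 * inner ℝ (sym (grad φ x)) (outer η ξ) := by
  rw [inner_fderiv, inner_fderiv, inner_mat, inner_mat, inner_mat]
  simp only [sym, outer]
  ring

lemma abs_inner_fderiv_self_le (φ : Plane → Plane) (x ξ : Plane) :
    |inner ℝ (fderiv ℝ φ x ξ) ξ| ≤ ‖ξ‖ ^ 2 * ‖sym (grad φ x)‖ := by
  have h := inner_fderiv_add φ x ξ ξ
  have h2 := abs_real_inner_le_norm (sym (grad φ x)) (outer ξ ξ)
  rw [norm_outer] at h2
  rw [show inner ℝ (fderiv ℝ φ x ξ) ξ = inner ℝ (sym (grad φ x)) (outer ξ ξ) by linarith]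
  linarith [sq ‖ξ‖, mul_comm (‖ξ‖ * ‖ξ‖) ‖sym (grad φ x)‖]

lemma continuous_grad {φ : Plane → Plane} (hφ : ContDiff ℝ ∞ φ) : Continuous (grad φ) := by
  have h := hφ.continuous_fderiv (by simp)
  have : Continuous fun x => fun p : Fin 2 × Fin 2 =>
      fderiv ℝ φ x (EuclideanSpace.single p.2 1) p.1 := by fun_prop
  exact (PiLp.continuous_toLp 2 _).comp this

lemma enorm_sq_le_two_mul {E : Type*} [NormedAddCommGroup E] (a b : E) :
    ‖a‖ₑ ^ 2 ≤ 2 * ‖b‖ₑ ^ 2 + 2 * ‖b - a‖ₑ ^ 2 := by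
  have h : ‖a‖ ^ 2 ≤ 2 * ‖b‖ ^ 2 + 2 * ‖b - a‖ ^ 2 := by
    have h1 : ‖a‖ ≤ ‖b‖ + ‖b - a‖ := by
      have := norm_sub_norm_le a b
      rw [norm_sub_rev] at this; linarith
    nlinarith [norm_nonneg a, norm_nonneg b, norm_nonneg (b - a), sq_nonneg (‖b‖ - ‖b - a‖)]
  have h2 := ENNReal.ofReal_le_ofReal h
  rwa [ENNReal.ofReal_add (by positivity) (by positivity), ENNReal.ofReal_mul zero_le_two,
    ENNReal.ofReal_mul zero_le_two, ENNReal.ofReal_pow (norm_nonneg _),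
    ENNReal.ofReal_pow (norm_nonneg _), ENNReal.ofReal_pow (norm_nonneg _), ofReal_norm,
    ofReal_norm, ofReal_norm, ENNReal.ofReal_ofNat] at h2

/-- The fundamental theorem of calculus followed by Cauchy–Schwarz on an interval of length at most
1. -/
lemma enorm_sq_le_of_hasDerivAt {w w' : ℝ → ℝ} (hw : ∀ s, HasDerivAt w (w' s) s)
    (hc : Continuous w') {s : ℝ} (hs : s ∈ Icc (0 : ℝ) 1) :
    ‖w 0‖ₑ ^ 2 ≤ 2 * ‖w s‖ₑ ^ 2 + 2 * ∫⁻ σ in Ioo 0 s, ‖w' σ‖ₑ ^ 2 := by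
  have h1 : ∫ σ in (0 : ℝ)..s, w' σ = w s - w 0 :=
    intervalIntegral.integral_eq_sub_of_hasDerivAt (fun x _ => hw x) (hc.intervalIntegrable _ _)
  rw [intervalIntegral.integral_of_le hs.1, integral_Ioc_eq_integral_Ioo] at h1
  obtain ⟨B, hB⟩ := isCompact_Icc.exists_bound_of_continuousOn (s := Icc 0 s) hc.continuousOn
  have hm : MemLp w' 2 (volume.restrict (Ioo 0 s)) :=
    MemLp.of_bound hc.aestronglyMeasurable B <| (ae_restrict_mem measurableSet_Ioo).mono
      fun x hx => hB x (Ioo_subset_Icc_self hx)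
  have h2 := norm_setIntegral_smul_le_l2 (μ := volume.restrict (Ioo 0 s)) (V := 1) (B := 1)
    (by simpa [Measure.real, hs.1] using hs.2) zero_le_one zero_le_one (ζ := fun _ => 1) (by simp) hm
  simp only [one_smul, one_mul, h1] at h2
  have h3 := ENNReal.ofReal_le_ofReal h2
  rw [ofReal_norm, ofReal_l2 hm] at h3
  have h4 : ‖w s - w 0‖ₑ ^ 2 ≤ ∫⁻ σ in Ioo 0 s, ‖w' σ‖ₑ ^ 2 := by
    rw [← eLpNorm_two_sq]; gcongr
  refine (enorm_sq_le_two_mul (w 0) (w s)).trans ?_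
  gcongr

/-- The component of a displacement along a line is controlled by the strain. -/
lemma enorm_inner_sq_le {φ : Plane → Plane} (hφ : ContDiff ℝ ∞ φ) (x ξ : Plane) {s : ℝ}
    (hs : s ∈ Icc (0 : ℝ) 1) :
    ‖(inner ℝ (φ x) ξ : ℝ)‖ₑ ^ 2 ≤ 2 * ‖(inner ℝ (φ (x + s • ξ)) ξ : ℝ)‖ₑ ^ 2 +
      2 * ‖ξ‖ₑ ^ 4 * ∫⁻ σ in Ioo 0 s, ‖sym (grad φ (x + σ • ξ))‖ₑ ^ 2 := by
  have hd : Differentiable ℝ φ := hφ.differentiable (by simp)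
  have hl : ∀ σ : ℝ, HasDerivAt (fun σ : ℝ => x + σ • ξ) ξ σ := fun σ => by
    simpa using ((hasDerivAt_id σ).smul_const ξ).const_add x
  have hw : ∀ σ : ℝ, HasDerivAt (fun σ : ℝ => (inner ℝ (φ (x + σ • ξ)) ξ : ℝ))
      (inner ℝ (fderiv ℝ φ (x + σ • ξ) ξ) ξ) σ := fun σ => by
    have h1 := (hd (x + σ • ξ)).hasFDerivAt.comp_hasDerivAt σ (hl σ)
    simpa using h1.inner ℝ (hasDerivAt_const σ ξ)
  have hcf := hφ.continuous_fderiv (by simp)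
  have hc : Continuous fun σ : ℝ => (inner ℝ (fderiv ℝ φ (x + σ • ξ) ξ) ξ : ℝ) := by fun_prop
  have h := enorm_sq_le_of_hasDerivAt hw hc hs
  simp only [zero_smul, add_zero] at h
  refine h.trans (add_le_add le_rfl ?_)
  rw [mul_assoc]
  gcongr
  rw [← lintegral_const_mul' _ _ (by simp)]
  refine lintegral_mono fun σ => ?_
  have h2 := ENNReal.ofReal_le_ofReal (abs_inner_fderiv_self_le φ (x + σ • ξ) ξ)
  rw [← Real.norm_eq_abs, ofReal_norm, ENNReal.ofReal_mul (by positivity), ofReal_norm,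
    ENNReal.ofReal_pow (norm_nonneg _), ofReal_norm] at h2
  calc _ ≤ (‖ξ‖ₑ ^ 2 * ‖sym (grad φ (x + σ • ξ))‖ₑ) ^ 2 := by gcongr
    _ = _ := by ring

/-- The energy `∫_Ω |ε(φ)|²`. -/
def strainEnergy (Ω : Set Plane) (φ : Plane → Plane) : ℝ≥0∞ :=
  ∫⁻ x in Ω, ‖sym (grad φ x)‖ₑ ^ 2

/-- Enlarging the strain integral to the whole unit interval, cut off by the indicator of `Ω`, makes
it independent of the exit parameter `s`, which varies with `x` in an uncontrolled way. -/
lemma enorm_inner_sq_le_of_segment {φ : Plane → Plane} (hφ : ContDiff ℝ ∞ φ) {Ω : Set Plane}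
    {x ξ : Plane} {s : ℝ} (hs : s ∈ Icc (0 : ℝ) 1) (hΩ : ∀ σ ∈ Ioo 0 s, x + σ • ξ ∈ Ω) :
    ‖(inner ℝ (φ x) ξ : ℝ)‖ₑ ^ 2 ≤ 2 * ‖(inner ℝ (φ (x + s • ξ)) ξ : ℝ)‖ₑ ^ 2 +
      2 * ‖ξ‖ₑ ^ 4 * ∫⁻ σ in Ioo (0 : ℝ) 1, Ω.indicator (fun y => ‖sym (grad φ y)‖ₑ ^ 2)
        (x + σ • ξ) := by
  refine (enorm_inner_sq_le hφ x ξ hs).trans (add_le_add le_rfl (mul_le_mul_right ?_ _))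
  calc _ = ∫⁻ σ in Ioo 0 s, Ω.indicator (fun y => ‖sym (grad φ y)‖ₑ ^ 2) (x + σ • ξ) :=
        setLIntegral_congr_fun measurableSet_Ioo fun σ hσ => by
          simp only [indicator_of_mem (hΩ σ hσ)]
    _ ≤ _ := lintegral_mono_set (Ioo_subset_Ioo_right hs.2)

lemma measurable_strain_sq {φ : Plane → Plane} (hφ : ContDiff ℝ ∞ φ) :
    Measurable fun y => ‖sym (grad φ y)‖ₑ ^ 2 :=
  (continuous_sym.comp (continuous_grad hφ)).measurable.enorm.pow_const 2

/-- Tonelli and translation invariance: for each `σ` the shift by `σ • ξ` preserves Lebesgue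
measure. -/
lemma lintegral_lines_le {F : Plane → ℝ≥0∞} (hF : Measurable F) {Ω : Set Plane}
    (hΩ : MeasurableSet Ω) (D : Set Plane) (ξ : Plane) :
    ∫⁻ x in D, ∫⁻ σ in Ioo (0 : ℝ) 1, Ω.indicator F (x + σ • ξ) ≤ ∫⁻ x in Ω, F x := by
  have hm : Measurable (Ω.indicator F) := hF.indicator hΩ
  calc _ ≤ ∫⁻ x, ∫⁻ σ in Ioo (0 : ℝ) 1, Ω.indicator F (x + σ • ξ) := setLIntegral_le_lintegral _ _
    _ = ∫⁻ σ in Ioo (0 : ℝ) 1, ∫⁻ x, Ω.indicator F (x + σ • ξ) :=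
        lintegral_lintegral_swap (hm.comp (by fun_prop)).aemeasurable
    _ = ∫⁻ σ in Ioo (0 : ℝ) 1, ∫⁻ x, Ω.indicator F x := by
        simp only [lintegral_add_right_eq_self]
    _ = _ := by simp [lintegral_indicator hΩ]

/-! ### Two directions -/

/-- The determinant of two vectors of the plane. -/
def cross (ξ η : Plane) : ℝ := ξ 0 * η 1 - ξ 1 * η 0

lemma cross_sq (ξ η : Plane) : cross ξ η ^ 2 = ‖ξ‖ ^ 2 * ‖η‖ ^ 2 - (inner ℝ ξ η) ^ 2 := by
  rw [norm_sq_plane, norm_sq_plane, inner_plane, cross]; ring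

/-- A vector is recovered from its products with two independent ones by Cramer's rule: with `J` a
rotation by a right angle, `cross ξ η • z = ⟨z, ξ⟩ • J η - ⟨z, η⟩ • J ξ`. -/
lemma abs_cross_mul_norm_le (ξ η z : Plane) :
    |cross ξ η| * ‖z‖ ≤ ‖η‖ * |inner ℝ z ξ| + ‖ξ‖ * |inner ℝ z η| := by
  set J : Plane → Plane := fun w => !₂[w 1, -w 0]
  have hJ : ∀ w, ‖J w‖ = ‖w‖ := fun w => by
    rw [← sq_eq_sq₀ (norm_nonneg _) (norm_nonneg _), norm_sq_plane, norm_sq_plane]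
    simp [J]; ring
  have h : cross ξ η • z = (inner ℝ z ξ : ℝ) • J η - (inner ℝ z η : ℝ) • J ξ := by
    ext i
    rw [inner_plane, inner_plane]
    fin_cases i <;> simp [J, cross] <;> ring
  rw [← Real.norm_eq_abs, ← norm_smul, h]
  refine (norm_sub_le _ _).trans (le_of_eq ?_)
  rw [norm_smul, norm_smul, hJ, hJ, Real.norm_eq_abs, Real.norm_eq_abs]
  ring

lemma exists_enorm_sq_le_of_cross {ξ η : Plane} (h : cross ξ η ≠ 0) :
    ∃ C : ℝ≥0, ∀ z : Plane, ‖z‖ₑ ^ 2 ≤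
      C * (‖(inner ℝ z ξ : ℝ)‖ₑ ^ 2 + ‖(inner ℝ z η : ℝ)‖ₑ ^ 2) := by
  set c := |cross ξ η| with hc
  have hc0 : 0 < c := abs_pos.2 h
  set N := ‖ξ‖ ^ 2 + ‖η‖ ^ 2 with hN
  refine ⟨(N / c ^ 2).toNNReal, fun z => ?_⟩
  have h1 := abs_cross_mul_norm_le ξ η z
  have h2 : ‖z‖ ^ 2 ≤ N / c ^ 2 * (‖(inner ℝ z ξ : ℝ)‖ ^ 2 + ‖(inner ℝ z η : ℝ)‖ ^ 2) := by
    rw [div_mul_eq_mul_div, le_div_iff₀ (by positivity)]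
    simp only [Real.norm_eq_abs]
    have h3 : (c * ‖z‖) ^ 2 ≤ (‖η‖ * |inner ℝ z ξ| + ‖ξ‖ * |inner ℝ z η|) ^ 2 := by gcongr
    nlinarith [sq_nonneg (‖η‖ * |inner ℝ z η| - ‖ξ‖ * |inner ℝ z ξ|)]
  have h3 := ENNReal.ofReal_le_ofReal h2
  rwa [ENNReal.ofReal_mul (by positivity), ENNReal.ofReal_add (by positivity) (by positivity),
    ENNReal.ofReal_pow (norm_nonneg _), ENNReal.ofReal_pow (norm_nonneg _),
    ENNReal.ofReal_pow (norm_nonneg _), ofReal_norm, ofReal_norm, ofReal_norm] at h3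

/-! ### Sets on which displacements are controlled by the strain -/

/-- On `D` the `L²` norm of test fields is bounded by the `L²(Ω)` norm of the strain. -/
def Controlled (Ω Γ₀ D : Set Plane) : Prop :=
  ∃ C : ℝ≥0, ∀ φ, IsTestField Γ₀ φ → ∫⁻ x in D, ‖φ x‖ₑ ^ 2 ≤ C * strainEnergy Ω φ

section Controlled

variable {Ω Γ₀ D D' : Set Plane}

lemma controlled_empty : Controlled Ω Γ₀ ∅ := ⟨0, fun φ _ => by simp⟩

lemma Controlled.mono (h : Controlled Ω Γ₀ D') (hD : D ⊆ D') : Controlled Ω Γ₀ D := by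
  obtain ⟨C, hC⟩ := h
  exact ⟨C, fun φ hφ => (lintegral_mono_set hD).trans (hC φ hφ)⟩

lemma Controlled.union (h : Controlled Ω Γ₀ D) (h' : Controlled Ω Γ₀ D') :
    Controlled Ω Γ₀ (D ∪ D') := by
  obtain ⟨C, hC⟩ := h
  obtain ⟨C', hC'⟩ := h'
  refine ⟨C + C', fun φ hφ => (lintegral_union_le _ _ _).trans ?_⟩
  rw [ENNReal.coe_add, add_mul]
  exact add_le_add (hC φ hφ) (hC' φ hφ)

/-- The line estimate is integrated over all starting points in `D`. The strain integrals are
absorbed by `lintegral_lines_le`, the end values by the clamping or by the control on `D'`. -/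
lemma lintegral_inner_sq_le (hΩ : IsOpen Ω) (hD' : MeasurableSet D') {C : ℝ≥0}
    (hC : ∀ φ, IsTestField Γ₀ φ → ∫⁻ x in D', ‖φ x‖ₑ ^ 2 ≤ C * strainEnergy Ω φ)
    (hD : MeasurableSet D) {ξ : Plane}
    (hξ : ∀ x ∈ D, ∃ s ∈ Icc (0 : ℝ) 1, (∀ σ ∈ Ioo 0 s, x + σ • ξ ∈ Ω) ∧
      (x + s • ξ ∈ Γ₀ ∨ (s = 1 ∧ x + ξ ∈ D'))) {φ : Plane → Plane} (hφ : IsTestField Γ₀ φ) :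
    ∫⁻ x in D, ‖(inner ℝ (φ x) ξ : ℝ)‖ₑ ^ 2 ≤
      (2 * ‖ξ‖₊ ^ 2 * C + 2 * ‖ξ‖₊ ^ 4 : ℝ≥0) * strainEnergy Ω φ := by
  set F : Plane → ℝ≥0∞ := fun y => ‖sym (grad φ y)‖ₑ ^ 2
  have hF : Measurable F := measurable_strain_sq hφ.1
  set N : Plane → ℝ≥0∞ := fun y => ‖φ y‖ₑ ^ 2
  have hN : Measurable N := hφ.1.continuous.measurable.enorm.pow_const 2
  have key : ∀ x ∈ D, ‖(inner ℝ (φ x) ξ : ℝ)‖ₑ ^ 2 ≤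
      2 * ‖ξ‖ₑ ^ 2 * D'.indicator N (x + ξ) +
        2 * ‖ξ‖ₑ ^ 4 * ∫⁻ σ in Ioo (0 : ℝ) 1, Ω.indicator F (x + σ • ξ) := by
    intro x hx
    obtain ⟨s, hs, hsΩ, hs'⟩ := hξ x hx
    refine (enorm_inner_sq_le_of_segment hφ.1 hs hsΩ).trans (add_le_add ?_ le_rfl)
    -- At a clamped end the value is zero, so `s` may vary with `x`. In the other case `s = 1`,
    -- which makes the end point a fixed translate of `x` and so preserves the `L²` norm.
    rcases hs' with h0 | ⟨rfl, h1⟩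
    · simp [hφ.2 _ h0]
    · rw [indicator_of_mem h1, one_smul, mul_assoc]
      gcongr
      rw [← mul_pow]
      gcongr
      have := ENNReal.ofReal_le_ofReal (norm_inner_le_norm (𝕜 := ℝ) (φ (x + ξ)) ξ)
      rwa [ENNReal.ofReal_mul (norm_nonneg _), ofReal_norm, ofReal_norm, ofReal_norm,
        mul_comm] at this
  calc _ ≤ ∫⁻ x in D, (2 * ‖ξ‖ₑ ^ 2 * D'.indicator N (x + ξ) +
        2 * ‖ξ‖ₑ ^ 4 * ∫⁻ σ in Ioo (0 : ℝ) 1, Ω.indicator F (x + σ • ξ)) :=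
        setLIntegral_mono' hD key
    _ = 2 * ‖ξ‖ₑ ^ 2 * (∫⁻ x in D, D'.indicator N (x + ξ)) +
        2 * ‖ξ‖ₑ ^ 4 * ∫⁻ x in D, ∫⁻ σ in Ioo (0 : ℝ) 1, Ω.indicator F (x + σ • ξ) := by
        rw [lintegral_add_left, lintegral_const_mul, lintegral_const_mul']
        · exact ENNReal.mul_ne_top (by simp) (by simp)
        · exact (hN.indicator hD').comp (measurable_add_const ξ)
        · exact ((hN.indicator hD').comp (measurable_add_const ξ)).const_mul _
    _ ≤ 2 * ‖ξ‖ₑ ^ 2 * (C * strainEnergy Ω φ) + 2 * ‖ξ‖ₑ ^ 4 * strainEnergy Ω φ := by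
        gcongr
        · refine le_trans ?_ (hC φ hφ)
          refine (setLIntegral_le_lintegral _ _).trans ?_
          rw [lintegral_add_right_eq_self (D'.indicator N) ξ, lintegral_indicator hD']
        · exact lintegral_lines_le hF hΩ.measurableSet D ξ
    _ = _ := by
        push_cast
        simp only [enorm_eq_nnnorm]
        ring

/-- `D` is controlled if one can travel within `Ω` in two independent directions from each point of
`D` either to a controlled set or to the clamped boundary. -/
lemma Controlled.of_directions (hΩ : IsOpen Ω) (hD' : MeasurableSet D')
    (hc : Controlled Ω Γ₀ D') (hD : MeasurableSet D) {ξ η : Plane} (hcross : cross ξ η ≠ 0)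
    (h : ∀ ζ, (ζ = ξ ∨ ζ = η) → ∀ x ∈ D, ∃ s ∈ Icc (0 : ℝ) 1, (∀ σ ∈ Ioo 0 s, x + σ • ζ ∈ Ω) ∧
      (x + s • ζ ∈ Γ₀ ∨ (s = 1 ∧ x + ζ ∈ D'))) : Controlled Ω Γ₀ D := by
  obtain ⟨C, hC⟩ := hc
  obtain ⟨C', hC'⟩ := exists_enorm_sq_le_of_cross hcross
  refine ⟨C' * ((2 * ‖ξ‖₊ ^ 2 * C + 2 * ‖ξ‖₊ ^ 4) + (2 * ‖η‖₊ ^ 2 * C + 2 * ‖η‖₊ ^ 4)),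
    fun φ hφ => ?_⟩
  have h1 := lintegral_inner_sq_le hΩ hD' hC hD (h ξ (Or.inl rfl)) hφ
  have h2 := lintegral_inner_sq_le hΩ hD' hC hD (h η (Or.inr rfl)) hφ
  calc _ ≤ ∫⁻ x in D, C' * (‖(inner ℝ (φ x) ξ : ℝ)‖ₑ ^ 2 + ‖(inner ℝ (φ x) η : ℝ)‖ₑ ^ 2) :=
        lintegral_mono fun x => hC' (φ x)
    _ = C' * ((∫⁻ x in D, ‖(inner ℝ (φ x) ξ : ℝ)‖ₑ ^ 2) +
          ∫⁻ x in D, ‖(inner ℝ (φ x) η : ℝ)‖ₑ ^ 2) := by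
        rw [lintegral_const_mul' _ _ (by simp), lintegral_add_left]
        have := hφ.1.continuous
        exact (Continuous.measurable (by fun_prop)).enorm.pow_const 2
    _ ≤ _ := by
        rw [ENNReal.coe_mul, mul_assoc, ENNReal.coe_add, add_mul]
        gcongr

end Controlled

/-! ### Lipschitz charts -/

/-- Near `p` the set `Ω` is the region above the graph of the Lipschitz function `γ`. -/
structure IsChart (Ω : Set Plane) (p : Plane) (Φ : Plane ≃ᵃⁱ[ℝ] Plane) (r h : ℝ) (K : ℝ≥0)
    (γ : ℝ → ℝ) : Prop where
  r_pos : 0 < r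
  h_pos : 0 < h
  lipschitz : LipschitzWith K γ
  map_eq_zero : Φ p = 0
  mem_iff : ∀ z : Plane, |Φ z 0| < r → |Φ z 1| < h → (z ∈ Ω ↔ γ (Φ z 0) < Φ z 1)

lemma IsLipschitzDomain.exists_isChart {Ω : Set Plane} (hΩ : IsLipschitzDomain Ω) {p : Plane}
    (hp : p ∈ frontier Ω) : ∃ Φ r h K γ, IsChart Ω p Φ r h K γ := by
  obtain ⟨Φ, r, h, K, γ, h1, h2, h3, h4, h5⟩ := hΩ.exists_chart p hp
  exact ⟨Φ, r, h, K, γ, h1, h2, h3, h4, h5⟩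

/-- The direction with coordinates `(κ, 1)` in a chart. -/
def chartDir (Φ : Plane ≃ᵃⁱ[ℝ] Plane) (κ : ℝ) : Plane :=
  Φ.symm.linearIsometryEquiv !₂[κ, 1]

section ChartDir

variable (Φ : Plane ≃ᵃⁱ[ℝ] Plane)

lemma chart_add_smul (x : Plane) (c κ : ℝ) : Φ (x + c • chartDir Φ κ) = Φ x + c • !₂[κ, 1] := by
  have h := Φ.map_vadd x (c • chartDir Φ κ)
  rw [vadd_eq_add, vadd_eq_add, add_comm] at h
  rw [h, map_smul, chartDir, add_comm]
  congr 2
  exact Φ.linearIsometryEquiv.apply_symm_apply _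

@[simp] lemma chart_add_smul_zero (x : Plane) (c κ : ℝ) :
    Φ (x + c • chartDir Φ κ) 0 = Φ x 0 + c * κ := by
  rw [chart_add_smul]; simp

@[simp] lemma chart_add_smul_one (x : Plane) (c κ : ℝ) :
    Φ (x + c • chartDir Φ κ) 1 = Φ x 1 + c := by
  rw [chart_add_smul]; simp

lemma norm_chartDir_le {κ : ℝ} (hκ : κ ∈ Icc (0 : ℝ) 1) : ‖chartDir Φ κ‖ ≤ 2 := by
  rw [chartDir, LinearIsometryEquiv.norm_map]
  refine le_of_sq_le_sq ?_ zero_le_two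
  rw [norm_sq_plane]
  simp only [Matrix.cons_val_zero, Matrix.cons_val_one]
  nlinarith [hκ.1, hκ.2]

/-- A chart may reverse orientation, so the sign of the determinant is not available; its square is
a Gram determinant and is invariant under isometries. -/
lemma cross_chartDir_ne {κ : ℝ} (hκ : κ ≠ 0) {c : ℝ} (hc : c ≠ 0) :
    cross (c • chartDir Φ 0) (c • chartDir Φ κ) ≠ 0 := by
  have h : cross (c • chartDir Φ 0) (c • chartDir Φ κ) ^ 2 = (c ^ 2 * κ) ^ 2 := by
    rw [cross_sq, norm_smul, norm_smul, real_inner_smul_left, real_inner_smul_right, chartDir,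
      chartDir, LinearIsometryEquiv.norm_map, LinearIsometryEquiv.norm_map,
      LinearIsometryEquiv.inner_map_map, mul_pow, mul_pow, norm_sq_plane, norm_sq_plane,
      inner_plane, Real.norm_eq_abs, sq_abs]
    simp
    ring
  intro h0
  rw [h0] at h
  have : c ^ 2 * κ ≠ 0 := mul_ne_zero (pow_ne_zero _ hc) hκ
  exact this (pow_eq_zero_iff two_ne_zero |>.1 (by linarith))

end ChartDir

namespace IsChart

variable {Ω : Set Plane} {p : Plane} {Φ : Plane ≃ᵃⁱ[ℝ] Plane} {r h : ℝ} {K : ℝ≥0} {γ : ℝ → ℝ}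

/-- A slope for which lines in the direction `chartDir Φ slope` are transversal to the graph. -/
def slope (K : ℝ≥0) : ℝ := 1 / (2 * (K + 1))

lemma slope_pos (K : ℝ≥0) : 0 < slope K := by unfold slope; positivity

lemma slope_le (K : ℝ≥0) : slope K ≤ 1 := by
  unfold slope
  rw [div_le_one (by positivity)]
  linarith [K.2]

lemma mul_slope_le (K : ℝ≥0) : K * slope K ≤ 1 / 2 := by
  unfold slope
  rw [mul_one_div, div_le_div_iff₀ (by positivity) (by norm_num)]
  linarith [K.2]

/-- The transversal slopes used. -/
def Transversal (K : ℝ≥0) (κ : ℝ) : Prop := 0 ≤ κ ∧ κ ≤ 1 ∧ K * κ ≤ 1 / 2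

lemma transversal_zero (K : ℝ≥0) : Transversal K 0 := ⟨le_rfl, zero_le_one, by norm_num⟩

lemma transversal_slope (K : ℝ≥0) : Transversal K (slope K) :=
  ⟨(slope_pos K).le, slope_le K, mul_slope_le K⟩

lemma abs_sub_le (hC : IsChart Ω p Φ r h K γ) (a b : ℝ) : |γ a - γ b| ≤ K * |a - b| := by
  have := hC.lipschitz.dist_le_mul a b
  rwa [Real.dist_eq, Real.dist_eq] at this

lemma abs_coord_le (hC : IsChart Ω p Φ r h K γ) (z : Plane) (i : Fin 2) : |Φ z i| ≤ dist z p := by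
  have h1 : dist z p = ‖Φ z‖ := by rw [← Φ.dist_map z p, hC.map_eq_zero, dist_zero_right]
  rw [h1]
  exact PiLp.norm_apply_le (Φ z) i

/-- If `γ 0 < 0` the centre would lie in `Ω`. Conversely points of `Ω` close to `p` lie above the
graph, which by the Lipschitz bound forces `γ 0` below every positive number. -/
lemma gamma_zero (hC : IsChart Ω p Φ r h K γ) (hΩ : IsOpen Ω) (hp : p ∈ frontier Ω) :
    γ 0 = 0 := by
  have hp0 : Φ p 0 = 0 := by rw [hC.map_eq_zero]; rfl
  have hp1 : Φ p 1 = 0 := by rw [hC.map_eq_zero]; rfl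
  have hpn : p ∉ Ω := by
    rw [hΩ.frontier_eq] at hp; exact hp.2
  have h1 : 0 ≤ γ 0 := by
    by_contra hlt
    refine hpn ((hC.mem_iff p ?_ ?_).2 ?_)
    · rw [hp0, abs_zero]; exact hC.r_pos
    · rw [hp1, abs_zero]; exact hC.h_pos
    · rw [hp0, hp1]; linarith
  refine le_antisymm (le_of_forall_pos_le_add fun ε hε => ?_) h1
  have hpc : p ∈ closure Ω := frontier_subset_closure hp
  obtain ⟨z, hz, hzp⟩ := Metric.mem_closure_iff.1 hpc (min (min r h) (ε / (K + 1)))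
    (lt_min (lt_min hC.r_pos hC.h_pos) (by positivity))
  rw [dist_comm] at hzp
  have h0 := hC.abs_coord_le z 0
  have h2 := hC.abs_coord_le z 1
  have hz' := (hC.mem_iff z (h0.trans_lt (hzp.trans_le ((min_le_left _ _).trans (min_le_left _ _))))
    (h2.trans_lt (hzp.trans_le ((min_le_left _ _).trans (min_le_right _ _))))).1 hz
  have h3 := hC.abs_sub_le 0 (Φ z 0)
  have h4 := hzp.trans_le (min_le_right _ _)
  rw [lt_div_iff₀ (by positivity)] at h4
  rw [zero_sub, abs_neg] at h3
  have h5 : K * |Φ z 0| ≤ K * dist z p := by gcongr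
  have h6 := (abs_le.1 h3).2
  have h7 := (abs_le.1 h2).2
  linarith

/-- Moving upwards from a point on or above the graph leads into `Ω`. -/
lemma add_mem (hC : IsChart Ω p Φ r h K γ) {κ : ℝ} (hκ : Transversal K κ) {x : Plane} {c : ℝ}
    (hc : 0 < c) (h0 : |Φ x 0| + c < r) (h1 : |Φ x 1| + c < h) (hx : γ (Φ x 0) ≤ Φ x 1) :
    x + c • chartDir Φ κ ∈ Ω := by
  have hcκ : c * κ ≤ c := by nlinarith [hκ.2.1]
  have hcκ0 : 0 ≤ c * κ := mul_nonneg hc.le hκ.1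
  refine (hC.mem_iff _ ?_ ?_).2 ?_
  · rw [chart_add_smul_zero]
    refine (abs_add_le _ _).trans_lt ?_
    rw [abs_of_nonneg hcκ0]; linarith
  · rw [chart_add_smul_one]
    refine (abs_add_le _ _).trans_lt ?_
    rwa [abs_of_pos hc]
  · rw [chart_add_smul_zero, chart_add_smul_one]
    -- The graph rises by at most `K * κ * c ≤ c / 2`, less than the climb `c`.
    have h2 := (abs_le.1 (hC.abs_sub_le (Φ x 0 + c * κ) (Φ x 0))).2
    rw [add_sub_cancel_left, abs_of_nonneg hcκ0] at h2
    nlinarith [hκ.2.2]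

lemma add_mem_of_mem (hC : IsChart Ω p Φ r h K γ) {κ : ℝ} (hκ : Transversal K κ) {x : Plane}
    {c : ℝ} (hc : 0 ≤ c) (h0 : |Φ x 0| + c < r) (h1 : |Φ x 1| + c < h) (hx : x ∈ Ω) :
    x + c • chartDir Φ κ ∈ Ω := by
  rcases hc.eq_or_lt with rfl | hc'
  · simpa using hx
  · exact hC.add_mem hκ hc' h0 h1 ((hC.mem_iff x (by linarith) (by linarith)).1 hx).le

/-- Moving downwards far enough leads out of `Ω`. -/
lemma sub_notMem (hC : IsChart Ω p Φ r h K γ) {κ : ℝ} (hκ : Transversal K κ) {x : Plane} {c : ℝ}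
    (hc : 0 ≤ c) (h0 : |Φ x 0| + c < r) (h1 : |Φ x 1| + c < h)
    (hx : 2 * (Φ x 1 - γ (Φ x 0)) ≤ c) : x + (-c) • chartDir Φ κ ∉ Ω := by
  have hcκ : c * κ ≤ c := by nlinarith [hκ.2.1]
  have hcκ0 : 0 ≤ c * κ := mul_nonneg hc hκ.1
  rw [hC.mem_iff]
  · rw [chart_add_smul_zero, chart_add_smul_one]
    -- The point sinks by `c` and the graph by at most `c / 2`, so a step of twice the initial
    -- height suffices.
    have h2 := (abs_le.1 (hC.abs_sub_le (Φ x 0) (Φ x 0 + -c * κ))).2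
    rw [show Φ x 0 - (Φ x 0 + -c * κ) = c * κ by ring, abs_of_nonneg hcκ0] at h2
    nlinarith [hκ.2.2]
  · rw [chart_add_smul_zero]
    refine (abs_add_le _ _).trans_lt ?_
    rw [neg_mul, abs_neg, abs_of_nonneg hcκ0]; linarith
  · rw [chart_add_smul_one]
    refine (abs_add_le _ _).trans_lt ?_
    rwa [abs_neg, abs_of_nonneg hc]

/-- Frontier points in the chart lie on the graph. -/
lemma eq_of_mem_frontier (hC : IsChart Ω p Φ r h K γ) (hΩ : IsOpen Ω) {z : Plane}
    (hz : z ∈ frontier Ω) (h0 : |Φ z 0| < r) (h1 : |Φ z 1| < h) : Φ z 1 = γ (Φ z 0) := by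
  have hzn : z ∉ Ω := by
    rw [hΩ.frontier_eq] at hz; exact hz.2
  rw [hC.mem_iff z h0 h1, not_lt] at hzn
  refine hzn.antisymm ?_
  have hcont : ∀ i, Continuous fun y : Plane => Φ y i := fun i => by
    have := Φ.continuous
    fun_prop
  by_contra hlt
  rw [not_le] at hlt
  have hU : IsOpen {y : Plane | Φ y 1 < γ (Φ y 0) ∧ |Φ y 0| < r ∧ |Φ y 1| < h} :=
    (isOpen_lt (hcont 1) (hC.lipschitz.continuous.comp (hcont 0))).inter
      ((isOpen_lt (hcont 0).abs continuous_const).inter (isOpen_lt (hcont 1).abs continuous_const))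
  obtain ⟨y, hy, hyΩ⟩ := mem_closure_iff.1 (frontier_subset_closure hz) _ hU ⟨hlt, h0, h1⟩
  exact absurd ((hC.mem_iff y hy.2.1 hy.2.2).1 hyΩ) (not_lt.2 hy.1.le)

end IsChart

/-! ### The Korn–Poincaré inequality -/

/-- The points near which test fields are controlled. -/
def controlledPoints (Ω Γ₀ : Set Plane) : Set Plane :=
  {q | ∃ δ > 0, Controlled Ω Γ₀ (Metric.ball q δ ∩ Ω)}

section KornPoincare

variable {Ω Γ₀ : Set Plane}

lemma isOpen_controlledPoints : IsOpen (controlledPoints Ω Γ₀) := by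
  rw [Metric.isOpen_iff]
  rintro q ⟨δ, hδ, hc⟩
  refine ⟨δ, hδ, fun q' hq' => ⟨δ - dist q' q, sub_pos.2 hq', hc.mono ?_⟩⟩
  exact inter_subset_inter_left _ (Metric.ball_subset_ball' (by linarith))

lemma exists_first_exit (hΩ : IsOpen Ω) {x ξ : Plane} (hx : x ∈ Ω) (hxξ : x + ξ ∉ Ω) :
    ∃ s ∈ Icc (0 : ℝ) 1, (∀ σ ∈ Ioo 0 s, x + σ • ξ ∈ Ω) ∧ x + s • ξ ∈ frontier Ω := by
  have hcont : Continuous fun σ : ℝ => x + σ • ξ := by fun_prop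
  set S := Icc (0 : ℝ) 1 ∩ (fun σ : ℝ => x + σ • ξ) ⁻¹' Ωᶜ with hS
  have hSc : IsCompact S := isCompact_Icc.inter_right (hΩ.isClosed_compl.preimage hcont)
  have hne : S.Nonempty := ⟨1, ⟨zero_le_one, le_rfl⟩, by simpa using hxξ⟩
  obtain ⟨s, hsS, hs⟩ := hSc.exists_isLeast hne
  have hin : ∀ σ ∈ Ico 0 s, x + σ • ξ ∈ Ω := by
    intro σ hσ
    by_contra hn
    exact absurd (hs ⟨⟨hσ.1, hσ.2.le.trans hsS.1.2⟩, hn⟩) (not_le.2 hσ.2)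
  refine ⟨s, hsS.1, fun σ hσ => hin σ ⟨hσ.1.le, hσ.2⟩, ?_⟩
  rw [hΩ.frontier_eq]
  refine ⟨?_, hsS.2⟩
  -- Positivity of the exit parameter makes the exit point a limit of points of `Ω`.
  have hs0 : 0 < s := hsS.1.1.lt_of_ne (by
    rintro rfl
    exact hsS.2 (by simpa using hx))
  have h1 : s ∈ closure (Ico 0 s) := by
    rw [closure_Ico hs0.ne]; exact ⟨hs0.le, le_rfl⟩
  exact map_mem_closure (f := fun σ : ℝ => x + σ • ξ) hcont h1 hin

/-- Going down in two transversal directions leaves `Ω` close to `p`, hence inside `U` and through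
`Γ₀`. No previously controlled set is needed, so this starts the propagation with `D' = ∅`. -/
lemma mem_controlledPoints_of_mem_clamped (hΩ : IsLipschitzDomain Ω) {U : Set Plane}
    (hU : IsOpen U) (hΓ : Γ₀ = U ∩ frontier Ω) {p : Plane} (hp : p ∈ Γ₀) :
    p ∈ controlledPoints Ω Γ₀ := by
  rw [hΓ] at hp
  obtain ⟨Φ, r, h, K, γ, hC⟩ := hΩ.exists_isChart hp.2
  have hγ := hC.gamma_zero hΩ.isOpen hp.2
  obtain ⟨ε, hε, hεU⟩ := Metric.isOpen_iff.1 hU p hp.1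
  have hr := hC.r_pos
  have hh := hC.h_pos
  set c := min (min r h) ε / 4 with hcdef
  have hc : 0 < c := by positivity
  have hcr : 4 * c ≤ r := by
    rw [hcdef]; linarith [min_le_left (min r h) ε, min_le_left r h]
  have hch : 4 * c ≤ h := by
    rw [hcdef]; linarith [min_le_left (min r h) ε, min_le_right r h]
  have hcε : 4 * c ≤ ε := by
    rw [hcdef]; linarith [min_le_right (min r h) ε]
  -- Points of the ball lie at most `δ * (1 + K) = c / 2` above the graph, so a downward step `c`
  -- leaves `Ω`. The exit point is within `δ + 2 * c < 4 * c ≤ ε` of `p`.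
  set δ := c / (2 * (1 + K)) with hδdef
  have hδ : 0 < δ := by positivity
  have hδK : 2 * (δ * (1 + K)) = c := by rw [hδdef]; field_simp
  have hδc : δ ≤ c := by nlinarith [K.2, mul_nonneg hδ.le K.2]
  refine ⟨δ, hδ, Controlled.of_directions hΩ.isOpen MeasurableSet.empty controlled_empty
    (Metric.isOpen_ball.inter hΩ.isOpen).measurableSet
    (cross_chartDir_ne Φ (IsChart.slope_pos K).ne' (neg_ne_zero.2 hc.ne')) ?_⟩
  have key : ∀ κ, IsChart.Transversal K κ → ∀ x ∈ Metric.ball p δ ∩ Ω,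
      ∃ s ∈ Icc (0 : ℝ) 1, (∀ σ ∈ Ioo 0 s, x + σ • ((-c) • chartDir Φ κ) ∈ Ω) ∧
        x + s • ((-c) • chartDir Φ κ) ∈ Γ₀ := by
    rintro κ hκ x ⟨hxp, hxΩ⟩
    have hxp' : dist x p < δ := hxp
    have h0 := (hC.abs_coord_le x 0).trans_lt hxp'
    have h1 := (hC.abs_coord_le x 1).trans_lt hxp'
    have hout : x + (-c) • chartDir Φ κ ∉ Ω := by
      refine hC.sub_notMem hκ hc.le (by linarith) (by linarith) ?_
      have h2 := hC.abs_sub_le 0 (Φ x 0)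
      rw [hγ, zero_sub, zero_sub, abs_neg, abs_neg] at h2
      have h3 : K * |Φ x 0| ≤ K * δ := by gcongr
      have h4 := (abs_le.1 h2).1
      have h5 := (abs_le.1 h1.le).2
      linarith
    obtain ⟨s, hs, hin, hfr⟩ := exists_first_exit hΩ.isOpen hxΩ hout
    refine ⟨s, hs, hin, ?_⟩
    rw [hΓ]
    refine ⟨hεU ?_, hfr⟩
    rw [Metric.mem_ball, dist_eq_norm]
    have h6 : ‖s • (-c) • chartDir Φ κ‖ ≤ 2 * c := by
      rw [norm_smul, norm_smul, norm_neg, Real.norm_of_nonneg hs.1, Real.norm_of_nonneg hc.le]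
      have := norm_chartDir_le Φ ⟨hκ.1, hκ.2.1⟩
      have h8 : c * ‖chartDir Φ κ‖ ≤ c * 2 := by gcongr
      nlinarith [hs.1, hs.2, mul_nonneg hc.le (norm_nonneg (chartDir Φ κ))]
    have h7 : x + s • (-c) • chartDir Φ κ - p = (x - p) + s • (-c) • chartDir Φ κ := by abel
    rw [h7]
    refine (norm_add_le _ _).trans_lt ?_
    rw [← dist_eq_norm]
    linarith
  rintro ζ (rfl | rfl) x hx
  · obtain ⟨s, hs, h1, h2⟩ := key 0 (IsChart.transversal_zero K) x hx
    exact ⟨s, hs, h1, Or.inl h2⟩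
  · obtain ⟨s, hs, h1, h2⟩ := key _ (IsChart.transversal_slope K) x hx
    exact ⟨s, hs, h1, Or.inl h2⟩

/-- Near any vector there are two linearly independent ones. -/
lemma exists_cross_ne_zero (z : Plane) {ε : ℝ} (hε : 0 < ε) :
    ∃ ξ η : Plane, cross ξ η ≠ 0 ∧ ‖ξ - z‖ < ε ∧ ‖η - z‖ < ε := by
  obtain ⟨ξ, hξ0, hξ⟩ : ∃ ξ : Plane, ξ ≠ 0 ∧ ‖ξ - z‖ < ε / 2 := by
    by_cases hz : z = 0
    · refine ⟨EuclideanSpace.single 0 (ε / 4), ?_, ?_⟩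
      · intro h
        have := congrArg (fun w : Plane => w 0) h
        simp at this; linarith
      · rw [hz, sub_zero, PiLp.norm_single, Real.norm_of_nonneg (by linarith)]; linarith
    · exact ⟨z, hz, by simpa using hε⟩
  have hn : 0 < ‖ξ‖ := norm_pos_iff.2 hξ0
  set J : Plane := !₂[-ξ 1, ξ 0]
  have hJ : ‖J‖ = ‖ξ‖ := by
    rw [← sq_eq_sq₀ (norm_nonneg _) (norm_nonneg _), norm_sq_plane, norm_sq_plane]
    simp [J]; ring
  set t := ε / (4 * ‖ξ‖) with ht
  have ht0 : 0 < t := by positivity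
  refine ⟨ξ, ξ + t • J, ?_, by linarith, ?_⟩
  · have : cross ξ (ξ + t • J) = t * ‖ξ‖ ^ 2 := by
      rw [norm_sq_plane]; simp [cross, J]; ring
    rw [this]; positivity
  · have h1 : ‖t • J‖ = ε / 4 := by
      rw [norm_smul, hJ, Real.norm_of_nonneg ht0.le, ht]; field_simp
    rw [show ξ + t • J - z = (ξ - z) + t • J by abel]
    linarith [norm_add_le (ξ - z) (t • J)]

/-- From a controlled point `p` near `q`, within a ball contained in `Ω`, control is transported to
`q`: every vector close to `p - q` carries a small ball about `q` into a controlled ball about `p`,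
and two such vectors can be chosen independent. -/
lemma closure_controlledPoints_inter_subset (hΩ : IsOpen Ω) :
    closure (controlledPoints Ω Γ₀) ∩ Ω ⊆ controlledPoints Ω Γ₀ := by
  rintro q ⟨hq, hqΩ⟩
  obtain ⟨R, hR, hRΩ⟩ := Metric.isOpen_iff.1 hΩ q hqΩ
  obtain ⟨p, ⟨δ₀, hδ₀, hc⟩, hpq⟩ := Metric.mem_closure_iff.1 hq (R / 4) (by linarith)
  set δ := min δ₀ (R / 4) with hδdef
  have hδ : 0 < δ := lt_min hδ₀ (by linarith)
  have hδR : δ ≤ R / 4 := min_le_right _ _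
  have hc' := hc.mono (D := Metric.ball p δ ∩ Ω)
    (inter_subset_inter_left _ (Metric.ball_subset_ball (min_le_left _ _)))
  obtain ⟨ξ, η, hcr, hξ, hη⟩ := exists_cross_ne_zero (p - q) (half_pos hδ)
  refine ⟨δ / 2, half_pos hδ, Controlled.of_directions hΩ
    (Metric.isOpen_ball.inter hΩ).measurableSet hc'
    (Metric.isOpen_ball.inter hΩ).measurableSet hcr ?_⟩
  have key : ∀ ζ : Plane, ‖ζ - (p - q)‖ < δ / 2 → ∀ x ∈ Metric.ball q (δ / 2) ∩ Ω,
      ∃ s ∈ Icc (0 : ℝ) 1, (∀ σ ∈ Ioo 0 s, x + σ • ζ ∈ Ω) ∧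
        (x + s • ζ ∈ Γ₀ ∨ (s = 1 ∧ x + ζ ∈ Metric.ball p δ ∩ Ω)) := by
    rintro ζ hζ x ⟨hxq, -⟩
    have hx : ‖x - q‖ < δ / 2 := by rwa [← dist_eq_norm]
    have hpq' : ‖p - q‖ < R / 4 := by rwa [← dist_eq_norm, dist_comm]
    have hζn : ‖ζ‖ < δ / 2 + R / 4 := by
      have := norm_add_le (ζ - (p - q)) (p - q)
      rw [sub_add_cancel] at this
      linarith
    have hin : ∀ σ ∈ Icc (0 : ℝ) 1, x + σ • ζ ∈ Ω := by
      intro σ hσ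
      refine hRΩ ?_
      rw [Metric.mem_ball, dist_eq_norm, show x + σ • ζ - q = (x - q) + σ • ζ by abel]
      have h1 : ‖σ • ζ‖ ≤ ‖ζ‖ := by
        rw [norm_smul, Real.norm_of_nonneg hσ.1]
        nlinarith [norm_nonneg ζ, hσ.2]
      linarith [norm_add_le (x - q) (σ • ζ)]
    refine ⟨1, ⟨zero_le_one, le_rfl⟩, fun σ hσ => hin σ (Ioo_subset_Icc_self hσ), Or.inr ⟨rfl, ?_, ?_⟩⟩
    · rw [Metric.mem_ball, dist_eq_norm, show x + ζ - p = (x - q) + (ζ - (p - q)) by abel]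
      linarith [norm_add_le (x - q) (ζ - (p - q))]
    · simpa using hin 1 ⟨zero_le_one, le_rfl⟩
  rintro ζ (rfl | rfl)
  · exact key _ hξ
  · exact key _ hη

/-- Near a boundary point, two upward transversal shifts by `c` push `Ω` into neighbourhoods of
interior points, where control is already known; the target set is the union of the two
neighbourhoods. -/
lemma mem_controlledPoints_of_mem_frontier (hΩ : IsLipschitzDomain Ω)
    (hsub : Ω ⊆ controlledPoints Ω Γ₀) {p : Plane} (hp : p ∈ frontier Ω) :
    p ∈ controlledPoints Ω Γ₀ := by
  obtain ⟨Φ, r, h, K, γ, hC⟩ := hΩ.exists_isChart hp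
  have hγ := hC.gamma_zero hΩ.isOpen hp
  have hr := hC.r_pos
  have hh := hC.h_pos
  set c := min r h / 4 with hcdef
  have hc : 0 < c := by positivity
  have hcr : 4 * c ≤ r := by
    rw [hcdef]; linarith [min_le_left r h]
  have hch : 4 * c ≤ h := by
    rw [hcdef]; linarith [min_le_right r h]
  have hp0 : Φ p 0 = 0 := by rw [hC.map_eq_zero]; rfl
  have hp1 : Φ p 1 = 0 := by rw [hC.map_eq_zero]; rfl
  have hmem : ∀ κ, IsChart.Transversal K κ → p + c • chartDir Φ κ ∈ Ω := fun κ hκ =>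
    hC.add_mem hκ hc (by rw [hp0, abs_zero]; linarith) (by rw [hp1, abs_zero]; linarith)
      (by rw [hp0, hp1, hγ])
  obtain ⟨δ₁, hδ₁, hc₁⟩ := hsub (hmem 0 (IsChart.transversal_zero K))
  obtain ⟨δ₂, hδ₂, hc₂⟩ := hsub (hmem _ (IsChart.transversal_slope K))
  set δ := min (min δ₁ δ₂) c with hδdef
  have hδ : 0 < δ := lt_min (lt_min hδ₁ hδ₂) hc
  have hδc : δ ≤ c := min_le_right _ _
  refine ⟨δ, hδ, Controlled.of_directions hΩ.isOpen
    ((Metric.isOpen_ball.inter hΩ.isOpen).union (Metric.isOpen_ball.inter hΩ.isOpen)).measurableSet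
    (hc₁.union hc₂) (Metric.isOpen_ball.inter hΩ.isOpen).measurableSet
    (cross_chartDir_ne Φ (IsChart.slope_pos K).ne' hc.ne') ?_⟩
  have hin : ∀ κ, IsChart.Transversal K κ → ∀ x ∈ Metric.ball p δ ∩ Ω, ∀ σ ∈ Icc (0 : ℝ) 1,
      x + σ • (c • chartDir Φ κ) ∈ Ω := by
    rintro κ hκ x ⟨hxp, hxΩ⟩ σ hσ
    have hxp' : dist x p < δ := hxp
    have h0 := (hC.abs_coord_le x 0).trans_lt hxp'
    have h1 := (hC.abs_coord_le x 1).trans_lt hxp'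
    have h2 : σ * c ≤ c := by nlinarith [hσ.2]
    rw [smul_smul]
    exact hC.add_mem_of_mem hκ (mul_nonneg hσ.1 hc.le) (by linarith) (by linarith) hxΩ
  have hball : ∀ κ, ∀ δ', δ ≤ δ' → ∀ x ∈ Metric.ball p δ ∩ Ω,
      x + c • chartDir Φ κ ∈ Metric.ball (p + c • chartDir Φ κ) δ' := by
    rintro κ δ' hδ' x ⟨hxp, -⟩
    rw [Metric.mem_ball, dist_add_right]
    exact lt_of_lt_of_le hxp hδ'
  rintro ζ (rfl | rfl) x hx
  · refine ⟨1, ⟨zero_le_one, le_rfl⟩, fun σ hσ => hin 0 (IsChart.transversal_zero K) x hx σ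
      (Ioo_subset_Icc_self hσ), Or.inr ⟨rfl, Or.inl ⟨?_, ?_⟩⟩⟩
    · exact hball 0 δ₁ ((min_le_left _ _).trans (min_le_left _ _)) x hx
    · simpa using hin 0 (IsChart.transversal_zero K) x hx 1 ⟨zero_le_one, le_rfl⟩
  · refine ⟨1, ⟨zero_le_one, le_rfl⟩, fun σ hσ => hin _ (IsChart.transversal_slope K) x hx σ
      (Ioo_subset_Icc_self hσ), Or.inr ⟨rfl, Or.inr ⟨?_, ?_⟩⟩⟩
    · exact hball _ δ₂ ((min_le_left _ _).trans (min_le_right _ _)) x hx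
    · simpa using hin _ (IsChart.transversal_slope K) x hx 1 ⟨zero_le_one, le_rfl⟩

/-- The Korn–Poincaré inequality. -/
theorem controlled_domain (hΩ : IsLipschitzDomain Ω) {U : Set Plane}
    (hU : IsOpen U) (hΓ : Γ₀ = U ∩ frontier Ω) (hne : Γ₀.Nonempty) : Controlled Ω Γ₀ Ω := by
  obtain ⟨p, hp⟩ := hne
  have hpP := mem_controlledPoints_of_mem_clamped hΩ hU hΓ hp
  have hpc : p ∈ closure Ω := by
    rw [hΓ] at hp; exact frontier_subset_closure hp.2
  have hne' : (Ω ∩ controlledPoints Ω Γ₀).Nonempty := by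
    obtain ⟨z, hz1, hz2⟩ := mem_closure_iff.1 hpc _ isOpen_controlledPoints hpP
    exact ⟨z, hz2, hz1⟩
  -- The controlled points are open, relatively closed in `Ω` and meet `Ω` near the clamped
  -- boundary, so connectedness gives all of `Ω`.
  have hsub : Ω ⊆ controlledPoints Ω Γ₀ :=
    hΩ.isConnected.isPreconnected.subset_of_closure_inter_subset isOpen_controlledPoints hne'
      (closure_controlledPoints_inter_subset hΩ.isOpen)
  have hall : closure Ω ⊆ controlledPoints Ω Γ₀ := by
    intro q hq
    by_cases hqΩ : q ∈ Ω
    · exact hsub hqΩ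
    · exact mem_controlledPoints_of_mem_frontier hΩ hsub (by
        rw [hΩ.isOpen.frontier_eq]; exact ⟨hq, hqΩ⟩)
  -- Compactness of the closure turns local constants into one global constant; this is why boundary
  -- points had to be controlled too.
  have h := hΩ.isBounded.isCompact_closure.induction_on (p := fun S => Controlled Ω Γ₀ (S ∩ Ω))
    (by simpa using controlled_empty)
    (fun S S' hS h => h.mono (inter_subset_inter_left _ hS))
    (fun S S' h h' => by rw [union_inter_distrib_right]; exact h.union h')
    (fun q hq => by
      obtain ⟨δ, hδ, hc⟩ := hall hq
      exact ⟨Metric.ball q δ, mem_nhdsWithin_of_mem_nhds (Metric.ball_mem_nhds q hδ), hc⟩)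
  exact h.mono fun x hx => ⟨subset_closure hx, hx⟩

end KornPoincare

/-! ### The trace inequality -/

/-- The point of the graph of `γ` over `a`, in the coordinates `Φ`. -/
def graphPoint (Φ : Plane ≃ᵃⁱ[ℝ] Plane) (γ : ℝ → ℝ) (a : ℝ) : Plane := Φ.symm !₂[a, γ a]

/-- Both measures are translation invariant Haar measures. Comparability is all that is needed to
use the behaviour of Hausdorff measure under antilipschitz maps in volume estimates. -/
lemma exists_hausdorffMeasure_eq_smul :
    ∃ k : ℝ≥0, (μH[2] : Measure Plane) ≤ (k : ℝ≥0∞) • volume ∧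
      (volume : Measure Plane) ≤ (k : ℝ≥0∞) • μH[2] := by
  have h : (μH[2] : Measure Plane).IsAddHaarMeasure := by
    simpa using isAddHaarMeasure_hausdorffMeasure (E := Plane)
  refine ⟨Measure.addHaarScalarFactor (μH[2] : Measure Plane) volume +
    Measure.addHaarScalarFactor (volume : Measure Plane) μH[2], ?_, ?_⟩
  · conv_lhs => rw [Measure.isAddLeftInvariant_eq_smul (μH[2] : Measure Plane) volume]
    refine Measure.le_iff.2 fun s _ => ?_
    simp only [Measure.smul_apply, smul_eq_mul, ENNReal.coe_add, ENNReal.smul_def]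
    gcongr
    exact le_self_add
  · conv_lhs => rw [Measure.isAddLeftInvariant_eq_smul (volume : Measure Plane) μH[2]]
    refine Measure.le_iff.2 fun s _ => ?_
    simp only [Measure.smul_apply, smul_eq_mul, ENNReal.coe_add, ENNReal.smul_def]
    gcongr
    exact le_add_self

lemma lintegral_comp_le_of_measure_preimage_le {X Y : Type*} [MeasurableSpace X]
    [MeasurableSpace Y] {μ : Measure X} {ν : Measure Y} {f : X → Y} (hf : Measurable f) {C : ℝ≥0∞}
    (h : ∀ s, MeasurableSet s → μ (f ⁻¹' s) ≤ C * ν s) {F : Y → ℝ≥0∞} (hF : Measurable F) :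
    ∫⁻ x, F (f x) ∂μ ≤ C * ∫⁻ y, F y ∂ν := by
  rw [← lintegral_map hF hf, ← smul_eq_mul, ← lintegral_smul_measure]
  refine lintegral_mono' (Measure.le_iff.2 fun s hs => ?_) le_rfl
  rw [Measure.map_apply hf hs]
  exact h s hs

lemma norm_plane_le (x : Plane) : ‖x‖ ≤ |x 0| + |x 1| := by
  refine le_of_sq_le_sq ?_ (by positivity)
  rw [norm_sq_plane, add_sq, sq_abs, sq_abs]
  nlinarith [mul_nonneg (abs_nonneg (x 0)) (abs_nonneg (x 1))]

section Trace

variable {Ω Γ₀ : Set Plane} {p : Plane} {Φ : Plane ≃ᵃⁱ[ℝ] Plane} {r h : ℝ} {K : ℝ≥0} {γ : ℝ → ℝ}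

@[simp] lemma chart_graphPoint (Φ : Plane ≃ᵃⁱ[ℝ] Plane) (γ : ℝ → ℝ) (a : ℝ) :
    Φ (graphPoint Φ γ a) = !₂[a, γ a] := by
  simp [graphPoint]

lemma lipschitzWith_graphPoint (hγ : LipschitzWith K γ) :
    LipschitzWith (1 + K) (graphPoint Φ γ) := by
  refine LipschitzWith.of_dist_le_mul fun a b => ?_
  rw [graphPoint, graphPoint, Φ.symm.dist_map, dist_eq_norm]
  refine (norm_plane_le _).trans ?_
  have := hγ.dist_le_mul a b
  rw [Real.dist_eq, Real.dist_eq] at this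
  simp only [PiLp.sub_apply, Matrix.cons_val_zero, Matrix.cons_val_one, NNReal.coe_add,
    NNReal.coe_one, Real.dist_eq]
  linarith

/-- Points reached from the graph by moving in a transversal direction. -/
def graphShift (Φ : Plane ≃ᵃⁱ[ℝ] Plane) (γ : ℝ → ℝ) (ξ : Plane) (q : ℝ × ℝ) : Plane :=
  graphPoint Φ γ q.1 + q.2 • ξ

lemma continuous_graphShift (hγ : LipschitzWith K γ) (ξ : Plane) :
    Continuous (graphShift Φ γ ξ) := by
  have := (lipschitzWith_graphPoint (Φ := Φ) hγ).continuous
  unfold graphShift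
  fun_prop

/-- In the chart the map is `(a, s) ↦ (a + s c κ, γ a + s c)`. Subtracting `κ` times the second
coordinate from the first eliminates `s` and leaves `a - κ γ a`, which determines `a` because `K * κ
≤ 1 / 2`; then `s` is read off the second coordinate. -/
lemma exists_antilipschitz_graphShift (hγ : LipschitzWith K γ) {κ : ℝ}
    (hκ : IsChart.Transversal K κ) {c : ℝ} (hc : 0 < c) :
    ∃ K' : ℝ≥0, AntilipschitzWith K' (graphShift Φ γ (c • chartDir Φ κ)) := by
  refine ⟨(4 + (1 + 4 * K) / c).toNNReal, AntilipschitzWith.of_le_mul_dist fun x y => ?_⟩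
  rw [Real.coe_toNNReal _ (by positivity)]
  set d := dist (graphShift Φ γ (c • chartDir Φ κ) x) (graphShift Φ γ (c • chartDir Φ κ) y) with hd
  have hΦ : ∀ q : ℝ × ℝ, Φ (graphShift Φ γ (c • chartDir Φ κ) q) =
      !₂[q.1 + q.2 * c * κ, γ q.1 + q.2 * c] := by
    intro q
    rw [graphShift, smul_smul, chart_add_smul, chart_graphPoint]
    ext i; fin_cases i <;> simp
  have hi : ∀ i, |Φ (graphShift Φ γ (c • chartDir Φ κ) x) i -
      Φ (graphShift Φ γ (c • chartDir Φ κ) y) i| ≤ d := by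
    intro i
    rw [hd, ← Φ.dist_map, dist_eq_norm]
    exact PiLp.norm_apply_le (Φ (graphShift Φ γ (c • chartDir Φ κ) x) -
      Φ (graphShift Φ γ (c • chartDir Φ κ) y)) i
  have h0 := hi 0
  have h1 := hi 1
  rw [hΦ, hΦ] at h0 h1
  simp only [Matrix.cons_val_zero, Matrix.cons_val_one] at h0 h1
  have h2 := hγ.dist_le_mul x.1 y.1
  rw [Real.dist_eq, Real.dist_eq] at h2
  obtain ⟨hκ0, hκ1, hκK⟩ := hκ
  have hd0 : 0 ≤ d := dist_nonneg
  have ha : |x.1 - y.1| ≤ 4 * d := by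
    have e : x.1 - y.1 = (x.1 + x.2 * c * κ - (y.1 + y.2 * c * κ)) -
        κ * (γ x.1 + x.2 * c - (γ y.1 + y.2 * c)) + κ * (γ x.1 - γ y.1) := by ring
    have h3 : |x.1 - y.1| ≤ d + κ * d + κ * (K * |x.1 - y.1|) := by
      conv_lhs => rw [e]
      refine (abs_add_le _ _).trans (add_le_add ((abs_sub _ _).trans (add_le_add h0 ?_)) ?_)
      · rw [abs_mul, abs_of_nonneg hκ0]; gcongr
      · rw [abs_mul, abs_of_nonneg hκ0]; gcongr
    nlinarith [abs_nonneg (x.1 - y.1)]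
  have hs : |x.2 - y.2| ≤ (1 + 4 * K) / c * d := by
    rw [div_mul_eq_mul_div, le_div_iff₀ hc]
    have e : (x.2 - y.2) * c = (γ x.1 + x.2 * c - (γ y.1 + y.2 * c)) - (γ x.1 - γ y.1) := by ring
    rw [show |x.2 - y.2| * c = |(x.2 - y.2) * c| by rw [abs_mul, abs_of_pos hc], e]
    refine (abs_sub _ _).trans ?_
    have : K * |x.1 - y.1| ≤ K * (4 * d) := by gcongr
    linarith
  have hpos : 0 ≤ (1 + 4 * K) / c * d := by positivity
  rw [Prod.dist_eq, Real.dist_eq, Real.dist_eq, add_mul]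
  exact max_le (by linarith) (by linarith)

/-- A change of variables without a Jacobian: `γ` is merely Lipschitz, but preimages under an
antilipschitz map enlarge two-dimensional Hausdorff measure by at most `K' ^ 2`, and on `ℝ × ℝ` that
measure is Lebesgue measure. -/
lemma exists_lintegral_graphShift_le (hγ : LipschitzWith K γ) {κ : ℝ}
    (hκ : IsChart.Transversal K κ) {c : ℝ} (hc : 0 < c) (hΩ : MeasurableSet Ω) {I : Set ℝ}
    (hmem : ∀ a ∈ I, ∀ s ∈ Ioo (0 : ℝ) 1, graphPoint Φ γ a + s • (c • chartDir Φ κ) ∈ Ω) :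
    ∃ C : ℝ≥0, ∀ F : Plane → ℝ≥0∞, Measurable F →
      ∫⁻ a in I, ∫⁻ s in Ioo (0 : ℝ) 1, F (graphPoint Φ γ a + s • (c • chartDir Φ κ)) ≤
        C * ∫⁻ x in Ω, F x := by
  obtain ⟨K', hK'⟩ := exists_antilipschitz_graphShift (Φ := Φ) hγ hκ hc
  obtain ⟨k, hk, -⟩ := exists_hausdorffMeasure_eq_smul
  refine ⟨K' ^ 2 * k, fun F hF => ?_⟩
  set Ψ := graphShift Φ γ (c • chartDir Φ κ) with hΨ
  have hΨc : Continuous Ψ := continuous_graphShift hγ _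
  have h1 : ∫⁻ a in I, ∫⁻ s in Ioo (0 : ℝ) 1, F (graphPoint Φ γ a + s • (c • chartDir Φ κ)) =
      ∫⁻ q in I ×ˢ Ioo (0 : ℝ) 1, F (Ψ q) := by
    rw [Measure.volume_eq_prod, ← Measure.prod_restrict,
      lintegral_prod (fun q => F (Ψ q)) (hF.comp hΨc.measurable).aemeasurable]
    rfl
  rw [h1]
  refine lintegral_comp_le_of_measure_preimage_le hΨc.measurable (fun s hs => ?_) hF
  rw [Measure.restrict_apply (hΨc.measurable hs), Measure.restrict_apply hs]
  have h2 : Ψ ⁻¹' s ∩ I ×ˢ Ioo (0 : ℝ) 1 ⊆ Ψ ⁻¹' (s ∩ Ω) :=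
    fun q hq => ⟨hq.1, hmem q.1 hq.2.1 q.2 hq.2.2⟩
  refine (measure_mono h2).trans ?_
  have h3 := hK'.hausdorffMeasure_preimage_le (d := 2) zero_le_two (s ∩ Ω)
  rw [hausdorffMeasure_prod_real] at h3
  refine h3.trans ?_
  have h4 := Measure.le_iff.1 hk (s ∩ Ω) (hs.inter hΩ)
  rw [ENNReal.rpow_ofNat, ENNReal.coe_mul, ENNReal.coe_pow, mul_assoc]
  gcongr
  simpa using h4

/-- A trace inequality in a chart. -/
lemma IsChart.exists_trace (hC : IsChart Ω p Φ r h K γ) (hΩ : IsOpen Ω) (hp : p ∈ frontier Ω)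
    (hctl : Controlled Ω Γ₀ Ω) :
    ∃ r' > 0, ∃ C : ℝ≥0, ∀ φ, IsTestField Γ₀ φ →
      ∫⁻ a in Ioo (-r') r', ‖φ (graphPoint Φ γ a)‖ₑ ^ 2 ≤ C * strainEnergy Ω φ := by
  have hγ := hC.gamma_zero hΩ hp
  have hr := hC.r_pos
  have hh := hC.h_pos
  set c := min r h / 4 with hcdef
  have hc : 0 < c := by positivity
  have hcr : 4 * c ≤ r := by
    rw [hcdef]; linarith [min_le_left r h]
  have hch : 4 * c ≤ h := by
    rw [hcdef]; linarith [min_le_right r h]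
  set r' := c / (1 + K) with hr'def
  have hr' : 0 < r' := by positivity
  have hrK : r' * (1 + K) = c := by rw [hr'def]; field_simp
  have hKr : 0 ≤ K * r' := by positivity
  have hmem : ∀ κ, IsChart.Transversal K κ → ∀ a ∈ Ioo (-r') r', ∀ s ∈ Ioo (0 : ℝ) 1,
      graphPoint Φ γ a + s • (c • chartDir Φ κ) ∈ Ω := by
    intro κ hκ a ha s hs
    rw [smul_smul]
    have h0 : |a| < r' := abs_lt.2 ha
    have h1 := hC.abs_sub_le a 0
    rw [hγ, sub_zero, sub_zero] at h1
    have h2 : K * |a| ≤ K * r' := by gcongr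
    have h3 : s * c ≤ c := by nlinarith [hs.2]
    refine hC.add_mem hκ (mul_pos hs.1 hc) ?_ ?_ ?_ <;> rw [chart_graphPoint] <;>
      simp only [Matrix.cons_val_zero, Matrix.cons_val_one, le_refl] <;> linarith
  obtain ⟨C₀, hC₀⟩ := hctl
  have key : ∀ κ, IsChart.Transversal K κ → ∃ C : ℝ≥0, ∀ φ, IsTestField Γ₀ φ →
      ∫⁻ a in Ioo (-r') r', ‖(inner ℝ (φ (graphPoint Φ γ a)) (c • chartDir Φ κ) : ℝ)‖ₑ ^ 2 ≤
        C * strainEnergy Ω φ := by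
    intro κ hκ
    obtain ⟨C₁, hC₁⟩ := exists_lintegral_graphShift_le (Φ := Φ) hC.lipschitz hκ hc
      hΩ.measurableSet (hmem κ hκ)
    set ξ := c • chartDir Φ κ with hξ
    refine ⟨2 * ‖ξ‖₊ ^ 2 * C₁ * C₀ + 2 * ‖ξ‖₊ ^ 4 * C₁, fun φ hφ => ?_⟩
    set F : Plane → ℝ≥0∞ := fun y => ‖sym (grad φ y)‖ₑ ^ 2
    have hF : Measurable F := measurable_strain_sq hφ.1
    set N : Plane → ℝ≥0∞ := fun y => ‖φ y‖ₑ ^ 2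
    have hN : Measurable N := hφ.1.continuous.measurable.enorm.pow_const 2
    have hgc := (lipschitzWith_graphPoint (Φ := Φ) hC.lipschitz).continuous
    -- The boundary value is compared with the value at distance parameter `s` inside `Ω`, and the
    -- inequality is averaged over `s` in the unit interval. This replaces a point value by a volume
    -- integral that Korn–Poincaré controls.
    have hbound : ∀ a ∈ Ioo (-r') r', ‖(inner ℝ (φ (graphPoint Φ γ a)) ξ : ℝ)‖ₑ ^ 2 ≤
        2 * ‖ξ‖ₑ ^ 2 * (∫⁻ s in Ioo (0 : ℝ) 1, N (graphPoint Φ γ a + s • ξ)) +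
        2 * ‖ξ‖ₑ ^ 4 * ∫⁻ σ in Ioo (0 : ℝ) 1, Ω.indicator F (graphPoint Φ γ a + σ • ξ) := by
      intro a ha
      set x := graphPoint Φ γ a
      have e : ∀ B : ℝ≥0∞, B = ∫⁻ _ in Ioo (0 : ℝ) 1, B := fun B => by simp
      rw [e (‖(inner ℝ (φ x) ξ : ℝ)‖ₑ ^ 2), e (2 * ‖ξ‖ₑ ^ 4 *
        ∫⁻ σ in Ioo (0 : ℝ) 1, Ω.indicator F (x + σ • ξ)),
        ← lintegral_const_mul (2 * ‖ξ‖ₑ ^ 2) (f := fun s : ℝ => N (x + s • ξ))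
          (hN.comp (by fun_prop)), ← lintegral_add_right _ measurable_const]
      refine setLIntegral_mono' measurableSet_Ioo fun s hs => ?_
      refine (enorm_inner_sq_le_of_segment hφ.1 (Ioo_subset_Icc_self hs)
        fun σ hσ => hmem κ hκ a ha σ ⟨hσ.1, hσ.2.trans hs.2⟩).trans (add_le_add ?_ le_rfl)
      rw [mul_assoc]
      gcongr
      rw [← mul_pow]
      gcongr
      have := ENNReal.ofReal_le_ofReal (norm_inner_le_norm (𝕜 := ℝ) (φ (x + s • ξ)) ξ)
      rwa [ENNReal.ofReal_mul (norm_nonneg _), ofReal_norm, ofReal_norm, ofReal_norm,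
        mul_comm] at this
    have hmeas : Measurable fun a => ∫⁻ s in Ioo (0 : ℝ) 1, N (graphPoint Φ γ a + s • ξ) := by
      refine Measurable.lintegral_prod_right' (f := fun q : ℝ × ℝ => N (graphPoint Φ γ q.1 + q.2 • ξ))
        (hN.comp ?_)
      exact (continuous_graphShift (Φ := Φ) hC.lipschitz ξ).measurable
    calc _ ≤ ∫⁻ a in Ioo (-r') r',
          (2 * ‖ξ‖ₑ ^ 2 * (∫⁻ s in Ioo (0 : ℝ) 1, N (graphPoint Φ γ a + s • ξ)) +
          2 * ‖ξ‖ₑ ^ 4 * ∫⁻ σ in Ioo (0 : ℝ) 1, Ω.indicator F (graphPoint Φ γ a + σ • ξ)) :=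
          setLIntegral_mono' measurableSet_Ioo hbound
      _ = 2 * ‖ξ‖ₑ ^ 2 * (∫⁻ a in Ioo (-r') r', ∫⁻ s in Ioo (0 : ℝ) 1,
            N (graphPoint Φ γ a + s • ξ)) +
          2 * ‖ξ‖ₑ ^ 4 * ∫⁻ a in Ioo (-r') r', ∫⁻ σ in Ioo (0 : ℝ) 1,
            Ω.indicator F (graphPoint Φ γ a + σ • ξ) := by
          rw [lintegral_add_left (hmeas.const_mul _), lintegral_const_mul _ hmeas,
            lintegral_const_mul']
          exact ENNReal.mul_ne_top (by simp) (by simp)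
      _ ≤ 2 * ‖ξ‖ₑ ^ 2 * (C₁ * (C₀ * strainEnergy Ω φ)) +
          2 * ‖ξ‖ₑ ^ 4 * (C₁ * strainEnergy Ω φ) := by
          gcongr
          · exact (hC₁ N hN).trans (mul_le_mul_right (hC₀ φ hφ) _)
          · refine (hC₁ _ (hF.indicator hΩ.measurableSet)).trans (mul_le_mul_right ?_ _)
            exact lintegral_mono fun x => indicator_le_self _ _ _
      _ = _ := by
          push_cast
          simp only [enorm_eq_nnnorm]
          ring
  obtain ⟨C₁, h1⟩ := key 0 (IsChart.transversal_zero K)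
  obtain ⟨C₂, h2⟩ := key _ (IsChart.transversal_slope K)
  obtain ⟨C₃, h3⟩ := exists_enorm_sq_le_of_cross
    (cross_chartDir_ne Φ (IsChart.slope_pos K).ne' hc.ne')
  refine ⟨r', hr', C₃ * (C₁ + C₂), fun φ hφ => ?_⟩
  refine (lintegral_mono fun a => h3 (φ (graphPoint Φ γ a))).trans ?_
  rw [lintegral_const_mul' _ _ (by simp), lintegral_add_left]
  · rw [ENNReal.coe_mul, mul_assoc, ENNReal.coe_add, add_mul]
    gcongr
    · exact h1 φ hφ
    · exact h2 φ hφ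
  · have h4 := hφ.1.continuous
    have hgc := (lipschitzWith_graphPoint (Φ := Φ) hC.lipschitz).continuous
    exact (Continuous.measurable (by fun_prop)).enorm.pow_const 2

/-- Near `p` the boundary lies in the image of an interval under the `(1 + K)`-Lipschitz map
`graphPoint`, so its length measure is at most `1 + K` times the pushforward of Lebesgue measure. -/
lemma exists_local_trace (hΩ : IsLipschitzDomain Ω) (hp : p ∈ frontier Ω)
    (hctl : Controlled Ω Γ₀ Ω) :
    ∃ δ > 0, ∃ C : ℝ≥0, ∀ φ, IsTestField Γ₀ φ →
      ∫⁻ x in Metric.ball p δ ∩ frontier Ω, ‖φ x‖ₑ ^ 2 ∂(μH[1] : Measure Plane) ≤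
        C * strainEnergy Ω φ := by
  obtain ⟨Φ, r, h, K, γ, hC⟩ := hΩ.exists_isChart hp
  obtain ⟨r', hr', C, hCφ⟩ := hC.exists_trace hΩ.isOpen hp hctl
  have hγl := lipschitzWith_graphPoint (Φ := Φ) hC.lipschitz
  set δ := min r' (min r h)
  have hδ : 0 < δ := lt_min hr' (lt_min hC.r_pos hC.h_pos)
  have hsub : Metric.ball p δ ∩ frontier Ω ⊆ graphPoint Φ γ '' Ioo (-r') r' := by
    rintro z ⟨hz, hzf⟩
    have hz' : dist z p < δ := hz
    have h0 := (hC.abs_coord_le z 0).trans_lt hz'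
    have h1 := (hC.abs_coord_le z 1).trans_lt hz'
    refine ⟨Φ z 0, abs_lt.1 (h0.trans_le (min_le_left _ _)), ?_⟩
    have h2 := hC.eq_of_mem_frontier hΩ.isOpen hzf
      (h0.trans_le ((min_le_right _ _).trans (min_le_left _ _)))
      (h1.trans_le ((min_le_right _ _).trans (min_le_right _ _)))
    rw [graphPoint, ← h2]
    refine Φ.injective ?_
    rw [Φ.apply_symm_apply]
    ext i; fin_cases i <;> simp
  refine ⟨δ, hδ, (1 + K) * C, fun φ hφ => ?_⟩
  have hN : Measurable fun y => ‖φ y‖ₑ ^ 2 := hφ.1.continuous.measurable.enorm.pow_const 2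
  refine (lintegral_mono_set hsub).trans ?_
  have hle : (μH[1] : Measure Plane).restrict (graphPoint Φ γ '' Ioo (-r') r') ≤
      (((1 + K : ℝ≥0) : ℝ≥0∞) • (volume.restrict (Ioo (-r') r')).map (graphPoint Φ γ)) := by
    refine Measure.le_iff.2 fun s hs => ?_
    rw [Measure.restrict_apply hs, Measure.smul_apply, Measure.map_apply hγl.continuous.measurable hs,
      Measure.restrict_apply (hγl.continuous.measurable hs), smul_eq_mul]
    have h1 : s ∩ graphPoint Φ γ '' Ioo (-r') r' ⊆
        graphPoint Φ γ '' (graphPoint Φ γ ⁻¹' s ∩ Ioo (-r') r') := by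
      rintro _ ⟨hx, a, ha, rfl⟩
      exact ⟨a, ⟨hx, ha⟩, rfl⟩
    refine (measure_mono h1).trans ?_
    have h2 := hγl.hausdorffMeasure_image_le zero_le_one (graphPoint Φ γ ⁻¹' s ∩ Ioo (-r') r')
    rwa [ENNReal.rpow_one, hausdorffMeasure_real] at h2
  refine (lintegral_mono' hle le_rfl).trans ?_
  rw [lintegral_smul_measure, lintegral_map hN hγl.continuous.measurable, ENNReal.coe_mul,
    mul_assoc, smul_eq_mul]
  exact mul_le_mul_right (hCφ φ hφ) _

/-- The trace inequality: boundary values are controlled by the strain. -/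
theorem exists_trace (hΩ : IsLipschitzDomain Ω) (hctl : Controlled Ω Γ₀ Ω) :
    ∃ C : ℝ≥0, ∀ φ, IsTestField Γ₀ φ →
      ∫⁻ x in frontier Ω, ‖φ x‖ₑ ^ 2 ∂(μH[1] : Measure Plane) ≤ C * strainEnergy Ω φ := by
  have hcpt : IsCompact (frontier Ω) :=
    hΩ.isBounded.isCompact_closure.of_isClosed_subset isClosed_frontier frontier_subset_closure
  have h := hcpt.induction_on (p := fun S => ∃ C : ℝ≥0, ∀ φ, IsTestField Γ₀ φ →
      ∫⁻ x in S ∩ frontier Ω, ‖φ x‖ₑ ^ 2 ∂(μH[1] : Measure Plane) ≤ C * strainEnergy Ω φ)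
    ⟨0, fun φ _ => by simp⟩
    (fun S S' hS ⟨C, hC⟩ => ⟨C, fun φ hφ =>
      (lintegral_mono_set (inter_subset_inter_left _ hS)).trans (hC φ hφ)⟩)
    (fun S S' ⟨C, hC⟩ ⟨C', hC'⟩ => ⟨C + C', fun φ hφ => by
      rw [union_inter_distrib_right, ENNReal.coe_add, add_mul]
      exact (lintegral_union_le _ _ _).trans (add_le_add (hC φ hφ) (hC' φ hφ))⟩)
    (fun q hq => by
      obtain ⟨δ, hδ, hc⟩ := exists_local_trace hΩ hq hctl
      exact ⟨Metric.ball q δ, mem_nhdsWithin_of_mem_nhds (Metric.ball_mem_nhds q hδ), hc⟩)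
  simpa using h

end Trace

/-! ### The mollified gradient of test fields -/

section Mollify

variable {Ω Γ₀ : Set Plane}

lemma memLp_two_of_continuous {E : Type*} [NormedAddCommGroup E] [SecondCountableTopology E]
    (hΩ : Bornology.IsBounded Ω) {f : Plane → E}
    (hf : Continuous f) : MemLp f 2 (volume.restrict Ω) := by
  have : IsFiniteMeasure (volume.restrict Ω) := ⟨by simpa using hΩ.measure_lt_top⟩
  obtain ⟨B, hB⟩ := hΩ.isCompact_closure.exists_bound_of_continuousOn hf.continuousOn
  refine MemLp.of_bound hf.aestronglyMeasurable B ?_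
  exact ae_restrict_of_ae_restrict_of_subset subset_closure <|
    (ae_restrict_mem isClosed_closure.measurableSet).mono fun x hx => hB x hx

lemma l2_le_of_lintegral_le {X E : Type*} [MeasurableSpace X] [NormedAddCommGroup E]
    {ν : Measure X} {f : X → E} (hΩ : Bornology.IsBounded Ω) {φ : Plane → Plane}
    (hφ : IsTestField Γ₀ φ) {C : ℝ≥0} (h : ∫⁻ x, ‖f x‖ₑ ^ 2 ∂ν ≤ C * strainEnergy Ω φ) :
    eLpNorm f 2 ν ≠ ⊤ ∧
      l2 ν f ≤ √C * l2 (volume.restrict Ω) (fun x => sym (grad φ x)) := by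
  have hm : MemLp (fun x => sym (grad φ x)) 2 (volume.restrict Ω) :=
    memLp_two_of_continuous hΩ (continuous_sym.comp (continuous_grad hφ.1))
  rw [strainEnergy, ← eLpNorm_two_sq, ← eLpNorm_two_sq] at h
  have hfin : (C : ℝ≥0∞) * eLpNorm (fun x => sym (grad φ x)) 2 (volume.restrict Ω) ^ 2 ≠ ⊤ :=
    ENNReal.mul_ne_top ENNReal.coe_ne_top (ENNReal.pow_ne_top hm.eLpNorm_ne_top)
  have h1 := ENNReal.toReal_mono hfin h
  rw [ENNReal.toReal_mul, ENNReal.toReal_pow, ENNReal.toReal_pow] at h1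
  refine ⟨fun ht => hfin (top_le_iff.1 (by simpa [ht] using h)), ?_⟩
  refine le_of_sq_le_sq ?_ (mul_nonneg (Real.sqrt_nonneg _) (l2_nonneg _))
  rw [mul_pow, Real.sq_sqrt (NNReal.coe_nonneg C)]
  exact h1

/-- The rotation of a vector field. -/
def curl (φ : Plane → Plane) (x : Plane) : ℝ := grad φ x (0, 1) - grad φ x (1, 0)

lemma continuous_grad_apply {φ : Plane → Plane} (hφ : ContDiff ℝ ∞ φ) (p : Fin 2 × Fin 2) :
    Continuous fun x => grad φ x p :=
  (EuclideanSpace.proj (𝕜 := ℝ) p).continuous.comp (continuous_grad hφ)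

lemma continuous_curl {φ : Plane → Plane} (hφ : ContDiff ℝ ∞ φ) : Continuous (curl φ) :=
  (continuous_grad_apply hφ (0, 1)).sub (continuous_grad_apply hφ (1, 0))

/-- Integrals of the rotation against smooth functions supported in `U` are controlled by the
strain. -/
def CurlControlled (Ω Γ₀ U : Set Plane) : Prop :=
  ∃ C : ℝ, 0 ≤ C ∧ ∀ ζ : Plane → ℝ, ContDiff ℝ ∞ ζ → HasCompactSupport ζ → tsupport ζ ⊆ U →
    ∀ B : ℝ, 0 ≤ B → (∀ x, |ζ x| ≤ B) → (∀ x, ‖fderiv ℝ ζ x‖ ≤ B) → ∀ φ, IsTestField Γ₀ φ →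
      |∫ x in Ω, ζ x * curl φ x| ≤ C * B * l2 (volume.restrict Ω) (fun x => sym (grad φ x))

lemma abs_integral_le_of_bound (hΩ : Bornology.IsBounded Ω) {E : Type*} [NormedAddCommGroup E]
    [SecondCountableTopology E] {G : Plane → E} (hG : Continuous G) {f : Plane → ℝ} {B : ℝ}
    (hB : 0 ≤ B) (hf : ∀ x, |f x| ≤ B * ‖G x‖) :
    |∫ x in Ω, f x| ≤ B * √(volume.real Ω) * l2 (volume.restrict Ω) G := by
  have : IsFiniteMeasure (volume.restrict Ω) := ⟨by simpa using hΩ.measure_lt_top⟩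
  have h1 : l2 (volume.restrict Ω) (fun _ : Plane => (1 : ℝ)) = √(volume.real Ω) := by
    rw [← Real.sqrt_sq (l2_nonneg _), l2_sq_eq_integral (memLp_const 1)]
    simp
  have h2 := norm_integral_le_mul_l2 (μ := volume.restrict Ω) (h := f) hB
    (memLp_const (1 : ℝ)) (memLp_two_of_continuous hΩ hG)
    (Filter.Eventually.of_forall fun x => by rw [norm_one, one_mul]; exact hf x)
  rw [h1, ← mul_assoc] at h2
  exact h2

lemma fderiv_coord {φ : Plane → Plane} (hφ : ContDiff ℝ ∞ φ) (x v : Plane) (i : Fin 2) :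
    fderiv ℝ (fun y => φ y i) x v = fderiv ℝ φ x v i := by
  have hd : DifferentiableAt ℝ φ x := hφ.differentiable (by simp) x
  have h := (PiLp.hasFDerivAt_apply (𝕜 := ℝ) 2 (φ x) i).comp x hd.hasFDerivAt
  rw [show (fun y => φ y i) = (fun f : Plane => f i) ∘ φ from rfl, h.fderiv]
  rfl

/-- As `ζ` is supported in `U`, both integrals extend to the whole plane and no boundary term
appears. -/
lemma setIntegral_mul_fderiv {U : Set Plane} {ζ w : Plane → ℝ} (hζ : ContDiff ℝ ∞ ζ)
    (hc : HasCompactSupport ζ) (hsub : tsupport ζ ⊆ U) (hw : ContDiff ℝ ∞ w) (v : Plane) :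
    ∫ x in U, ζ x * fderiv ℝ w x v = -∫ x in U, fderiv ℝ ζ x v * w x := by
  have hζf := hζ.continuous_fderiv (by simp)
  have hwf := hw.continuous_fderiv (by simp)
  have hζc := hζ.continuous
  have hwc := hw.continuous
  have h1 : ∀ x ∉ U, ζ x * fderiv ℝ w x v = 0 := fun x hx => by
    rw [image_eq_zero_of_notMem_tsupport fun h => hx (hsub h), zero_mul]
  have h2 : ∀ x ∉ U, fderiv ℝ ζ x v * w x = 0 := fun x hx => by
    have : fderiv ℝ ζ x = 0 :=
      image_eq_zero_of_notMem_tsupport fun h => hx (hsub (tsupport_fderiv_subset ℝ h))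
    simp [this]
  rw [setIntegral_eq_integral_of_forall_compl_eq_zero h1,
    setIntegral_eq_integral_of_forall_compl_eq_zero h2]
  refine integral_mul_fderiv_eq_neg_fderiv_mul_of_integrable ?_ ?_ ?_
    (fun x _ => hζ.differentiable (by simp) x) (fun x _ => hw.differentiable (by simp) x)
  · refine Continuous.integrable_of_hasCompactSupport (by fun_prop) ?_
    exact ((hc.fderiv_apply (𝕜 := ℝ) v).mul_right)
  · exact Continuous.integrable_of_hasCompactSupport (by fun_prop) hc.mul_right
  · exact Continuous.integrable_of_hasCompactSupport (by fun_prop) hc.mul_right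

/-- The derivatives in the rotation are moved onto `ζ`; what remains is the `L²` norm of `φ`,
bounded by the strain through Korn–Poincaré. -/
lemma curlControlled_interior (hΩ : Bornology.IsBounded Ω) (hctl : Controlled Ω Γ₀ Ω) :
    CurlControlled Ω Γ₀ Ω := by
  obtain ⟨C, hC⟩ := hctl
  set V := √(volume.real Ω)
  refine ⟨2 * V * √C, by positivity, fun ζ hζ hc hsub B hB hζB hζB' φ hφ => ?_⟩
  have hl2 := (l2_le_of_lintegral_le hΩ hφ (hC φ hφ)).2
  have hcφ := hφ.1.continuous
  have key : ∀ i j : Fin 2, |∫ x in Ω, ζ x * grad φ x (i, j)| ≤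
      B * V * l2 (volume.restrict Ω) φ := by
    intro i j
    have hw : ContDiff ℝ ∞ fun y => φ y i := by
      have := hφ.1; fun_prop
    have h1 := setIntegral_mul_fderiv hζ hc hsub hw (EuclideanSpace.single j 1)
    simp only [fderiv_coord hφ.1] at h1
    change |∫ x in Ω, ζ x * fderiv ℝ φ x (EuclideanSpace.single j 1) i| ≤ _
    rw [h1, abs_neg]
    refine abs_integral_le_of_bound hΩ hcφ hB fun x => ?_
    rw [abs_mul]
    refine mul_le_mul ?_ (PiLp.norm_apply_le (φ x) i) (abs_nonneg _) hB
    have := (fderiv ℝ ζ x).le_opNorm (EuclideanSpace.single j 1)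
    rw [PiLp.norm_single, norm_one, mul_one] at this
    exact this.trans (hζB' x)
  have hint : ∀ i j : Fin 2, IntegrableOn (fun x => ζ x * grad φ x (i, j)) Ω := by
    intro i j
    exact ((hζ.continuous.mul (continuous_grad_apply hφ.1 (i, j))).integrable_of_hasCompactSupport
      hc.mul_right).integrableOn
  simp only [curl, mul_sub]
  rw [integral_sub (hint 0 1) (hint 1 0)]
  refine (abs_sub _ _).trans ((add_le_add (key 0 1) (key 1 0)).trans ?_)
  have : B * V * l2 (volume.restrict Ω) φ ≤
      B * V * (√C * l2 (volume.restrict Ω) fun x => sym (grad φ x)) :=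
    mul_le_mul_of_nonneg_left hl2 (by positivity)
  linarith

/-- The point with coordinates `q` in a chart. -/
def chartPoint (Φ : Plane ≃ᵃⁱ[ℝ] Plane) (q : ℝ × ℝ) : Plane := Φ.symm !₂[q.1, q.2]

lemma measurePreserving_affineIsometryEquiv (Φ : Plane ≃ᵃⁱ[ℝ] Plane) : MeasurePreserving Φ := by
  have h : (Φ : Plane → Plane) = (fun y => y + Φ 0) ∘ Φ.linearIsometryEquiv := by
    funext y
    have := Φ.map_vadd 0 y
    simpa [vadd_eq_add] using this
  rw [h]
  exact (measurePreserving_add_right volume (Φ 0)).comp (Φ.linearIsometryEquiv.measurePreserving)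

lemma measurePreserving_chartPoint (Φ : Plane ≃ᵃⁱ[ℝ] Plane) :
    MeasurePreserving (chartPoint Φ) := by
  have h1 := (volume_preserving_finTwoArrow ℝ).symm
  have h2 := PiLp.volume_preserving_toLp (Fin 2)
  exact (measurePreserving_affineIsometryEquiv Φ.symm).comp (h2.comp h1)

@[simp] lemma chart_chartPoint (Φ : Plane ≃ᵃⁱ[ℝ] Plane) (q : ℝ × ℝ) :
    Φ (chartPoint Φ q) = !₂[q.1, q.2] := by
  simp [chartPoint]

lemma chartPoint_eq (Φ : Plane ≃ᵃⁱ[ℝ] Plane) (a b : ℝ) :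
    chartPoint Φ (a, b) = chartPoint Φ (a, 0) + b • chartDir Φ 0 := by
  refine Φ.injective ?_
  rw [chart_add_smul, chart_chartPoint, chart_chartPoint]
  ext i; fin_cases i <;> simp

/-! ### Integration by parts up to the boundary in a chart -/

section Chart

variable {p : Plane} {Φ : Plane ≃ᵃⁱ[ℝ] Plane} {r h : ℝ} {K : ℝ≥0} {γ : ℝ → ℝ}

/-- The divergence theorem in a chart, for the direction of the graph. -/
lemma IsChart.setIntegral_fderiv (hC : IsChart Ω p Φ r h K γ) (hΩ : IsOpen Ω) {δ : ℝ}
    (hδr : δ ≤ r) (hδh : δ ≤ h) {ψ : Plane → ℝ} (hψ : ContDiff ℝ ∞ ψ)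
    (hψc : HasCompactSupport ψ) (hψs : tsupport ψ ⊆ Metric.ball p δ) :
    ∫ x in Ω, fderiv ℝ ψ x (chartDir Φ 0) = -∫ a in Ioo (-δ) δ, ψ (graphPoint Φ γ a) := by
  set f : Plane → ℝ := fun x => fderiv ℝ ψ x (chartDir Φ 0) with hf
  have hψf := hψ.continuous_fderiv (by simp)
  have hfc : Continuous f := by fun_prop
  have hfcs : HasCompactSupport f := hψc.fderiv_apply (𝕜 := ℝ) (chartDir Φ 0)
  have hbox : ∀ x : Plane, x ∈ Metric.ball p δ → |Φ x 0| < δ ∧ |Φ x 1| < δ := fun x hx =>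
    ⟨(hC.abs_coord_le x 0).trans_lt hx, (hC.abs_coord_le x 1).trans_lt hx⟩
  have hψ0 : ∀ x, x ∉ Metric.ball p δ → ψ x = 0 := fun x hx =>
    image_eq_zero_of_notMem_tsupport fun h => hx (hψs h)
  have hf0 : ∀ x, x ∉ Metric.ball p δ → f x = 0 := fun x hx => by
    have : fderiv ℝ ψ x = 0 :=
      image_eq_zero_of_notMem_tsupport fun h => hx (hψs (tsupport_fderiv_subset ℝ h))
    simp [hf, this]
  have hint : Integrable (Ω.indicator f) :=
    (hfc.integrable_of_hasCompactSupport hfcs).indicator hΩ.measurableSet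
  have hmp := measurePreserving_chartPoint Φ
  have h1 : ∫ x in Ω, f x = ∫ q : ℝ × ℝ, Ω.indicator f (chartPoint Φ q) := by
    rw [← integral_indicator hΩ.measurableSet]
    conv_lhs => rw [← hmp.map_eq]
    rw [integral_map hmp.measurable.aemeasurable]
    rw [hmp.map_eq]
    exact hint.aestronglyMeasurable
  have hint2 : Integrable (fun q => Ω.indicator f (chartPoint Φ q)) (volume.prod volume) := by
    rw [← Measure.volume_eq_prod]
    exact hmp.integrable_comp_of_integrable hint
  have hinner : ∀ a : ℝ, ∫ b, Ω.indicator f (chartPoint Φ (a, b)) = -ψ (graphPoint Φ γ a) := by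
    intro a
    -- Inside the ball the vertical section of `Ω` is the ray above `γ a`; outside it `f` vanishes,
    -- so the ray may be used everywhere. The inner integral is then one-dimensional and only the
    -- value on the graph survives.
    have e1 : ∀ b, Ω.indicator f (chartPoint Φ (a, b)) =
        (Ioi (γ a)).indicator (fun b => f (chartPoint Φ (a, b))) b := by
      intro b
      by_cases hb : chartPoint Φ (a, b) ∈ Metric.ball p δ
      · have h2 := hbox _ hb
        have h3 := hC.mem_iff _ (h2.1.trans_le hδr) (h2.2.trans_le hδh)
        rw [chart_chartPoint] at h3
        simp only [Matrix.cons_val_zero, Matrix.cons_val_one] at h3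
        by_cases hm : chartPoint Φ (a, b) ∈ Ω
        · rw [indicator_of_mem hm, indicator_of_mem (show b ∈ Ioi (γ a) from h3.1 hm)]
        · rw [indicator_of_notMem hm, indicator_of_notMem (show b ∉ Ioi (γ a) from fun h => hm (h3.2 h))]
      · simp [indicator_apply, hf0 _ hb]
    simp only [e1]
    rw [integral_indicator measurableSet_Ioi]
    have hline : ∀ b : ℝ, HasDerivAt (fun b => chartPoint Φ (a, 0) + b • chartDir Φ 0)
        (chartDir Φ 0) b := fun b => by
      simpa using ((hasDerivAt_id b).smul_const (chartDir Φ 0)).const_add (chartPoint Φ (a, 0))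
    set u : ℝ → ℝ := fun b => ψ (chartPoint Φ (a, b)) with hu
    have hder : ∀ b, deriv u b = f (chartPoint Φ (a, b)) := by
      intro b
      have h2 := ((hψ.differentiable (by simp)
        (chartPoint Φ (a, 0) + b • chartDir Φ 0)).hasFDerivAt).comp_hasDerivAt b (hline b)
      have h3 : u = ψ ∘ fun b => chartPoint Φ (a, 0) + b • chartDir Φ 0 := by
        funext b; rw [hu]; simp only [Function.comp]; rw [chartPoint_eq]
      rw [h3, h2.deriv, hf, chartPoint_eq Φ a b]
    have hucd : ContDiff ℝ 1 u := by
      have h3 : u = ψ ∘ fun b => chartPoint Φ (a, 0) + b • chartDir Φ 0 := by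
        funext b; rw [hu]; simp only [Function.comp]; rw [chartPoint_eq]
      rw [h3]
      exact (hψ.of_le (by simp)).comp (by fun_prop)
    have hucs : HasCompactSupport u := by
      refine HasCompactSupport.intro (isCompact_Icc (a := -δ) (b := δ)) fun b hb => hψ0 _ fun h => hb ?_
      have h2 := (hbox _ h).2
      rw [chart_chartPoint] at h2
      simp only [Matrix.cons_val_one] at h2
      exact abs_le.1 h2.le
    have h4 := hucs.integral_Ioi_deriv_eq hucd (γ a)
    simp only [hder] at h4
    rw [h4]
    rfl
  rw [h1, Measure.volume_eq_prod, integral_prod _ hint2]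
  simp only [hinner]
  rw [integral_neg, setIntegral_eq_integral_of_forall_compl_eq_zero]
  intro a ha
  refine hψ0 _ fun h => ha ?_
  have h2 := (hbox _ h).1
  rw [chart_graphPoint] at h2
  exact abs_lt.1 h2

/-- In the plane the antisymmetric part of the gradient is one number, so the rotation is a single
directional derivative up to strain. The direction `η` is free, and the graph direction of a chart
is the one in which integration by parts is elementary. -/
lemma curl_mul_cross (φ : Plane → Plane) (x ξ η : Plane) :
    curl φ x * cross ξ η =
      2 * inner ℝ (fderiv ℝ φ x η) ξ - 2 * inner ℝ (sym (grad φ x)) (outer ξ η) := by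
  rw [inner_fderiv, inner_mat, inner_mat]
  simp only [curl, cross, sym, outer]
  ring

/-- By `curl_mul_cross` and the product rule for `ψ = ζ ⟨φ, ξ⟩` the integral splits into a boundary
term (trace inequality), a term with the derivative on `ζ` (Korn–Poincaré) and a strain term. -/
lemma exists_curlControlled_of_mem_frontier (hΩ : IsLipschitzDomain Ω) (hp : p ∈ frontier Ω)
    (hctl : Controlled Ω Γ₀ Ω) : ∃ δ > 0, CurlControlled Ω Γ₀ (Metric.ball p δ) := by
  obtain ⟨Φ, r, h, K, γ, hC⟩ := hΩ.exists_isChart hp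
  obtain ⟨r', hr', C₁, hC₁⟩ := hC.exists_trace hΩ.isOpen hp hctl
  obtain ⟨C, hCφ⟩ := hctl
  set δ := min r' (min r h) with hδdef
  have hδ : 0 < δ := lt_min hr' (lt_min hC.r_pos hC.h_pos)
  have hδr' : δ ≤ r' := min_le_left _ _
  set η := chartDir Φ 0 with hη
  set ξ := chartDir Φ 1 with hξ
  have hcr : cross η ξ ≠ 0 := by
    simpa using cross_chartDir_ne Φ (κ := 1) one_ne_zero (c := 1) one_ne_zero
  have hcr' : cross ξ η ≠ 0 := fun h0 => hcr (by
    have : cross η ξ = -cross ξ η := by unfold cross; ring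
    rw [this, h0, neg_zero])
  set k := |cross ξ η| with hk
  have hk0 : 0 < k := abs_pos.2 hcr'
  set V := √(volume.real Ω) with hV
  set C' := 2 * (‖ξ‖ * (√(2 * δ) * √C₁) + ‖η‖ * ‖ξ‖ * V * √C) + 2 * (‖ξ‖ * ‖η‖ * V) with hC'
  refine ⟨δ, hδ, C' / k, by positivity, fun ζ hζ hc hsub B hB hζB hζB' φ hφ => ?_⟩
  set E := l2 (volume.restrict Ω) (fun x => sym (grad φ x)) with hE
  have hE0 : 0 ≤ E := l2_nonneg _
  have hl2 := (l2_le_of_lintegral_le hΩ.isBounded hφ (hCφ φ hφ)).2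
  have hcφ := hφ.1.continuous
  have hcg := continuous_grad hφ.1
  have hcζ := hζ.continuous
  have hcζf := hζ.continuous_fderiv (by simp)
  have hcφf := hφ.1.continuous_fderiv (by simp)
  set w : Plane → ℝ := fun x => inner ℝ (φ x) ξ with hw
  have hwc : ContDiff ℝ ∞ w := hφ.1.inner ℝ contDiff_const
  set ψ : Plane → ℝ := fun x => ζ x * w x with hψ
  have hψc : ContDiff ℝ ∞ ψ := hζ.mul hwc
  have hψcs : HasCompactSupport ψ := hc.mul_right
  have hψs : tsupport ψ ⊆ Metric.ball p δ := (tsupport_mul_subset_left).trans hsub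
  have hdw : ∀ x, fderiv ℝ w x η = inner ℝ (fderiv ℝ φ x η) ξ := by
    intro x
    have hd : DifferentiableAt ℝ φ x := hφ.1.differentiable (by simp) x
    have := fderiv_inner_apply ℝ hd (differentiableAt_const ξ) η
    simpa using this
  have hdψ : ∀ x, fderiv ℝ ψ x η = ζ x * inner ℝ (fderiv ℝ φ x η) ξ + fderiv ℝ ζ x η * w x := by
    intro x
    have h1 := fderiv_fun_mul (hζ.differentiable (by simp) x) (hwc.differentiable (by simp) x)
    rw [hψ, h1]
    simp [hdw]
    ring
  -- the boundary term
  have hI1 : |∫ x in Ω, fderiv ℝ ψ x η| ≤ B * ‖ξ‖ * (√(2 * δ) * (√C₁ * E)) := by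
    rw [hC.setIntegral_fderiv hΩ.isOpen ((min_le_right _ _).trans (min_le_left _ _))
      ((min_le_right _ _).trans (min_le_right _ _)) hψc hψcs hψs, abs_neg]
    have hgc := (lipschitzWith_graphPoint (Φ := Φ) hC.lipschitz).continuous
    have h1 : ∫⁻ a in Ioo (-δ) δ, ‖φ (graphPoint Φ γ a)‖ₑ ^ 2 ≤ C₁ * strainEnergy Ω φ :=
      (lintegral_mono_set (Ioo_subset_Ioo (neg_le_neg hδr') hδr')).trans (hC₁ φ hφ)
    obtain ⟨h2, h3⟩ := l2_le_of_lintegral_le hΩ.isBounded hφ h1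
    have hm : MemLp (fun a => φ (graphPoint Φ γ a)) 2 (volume.restrict (Ioo (-δ) δ)) :=
      ⟨(hcφ.comp hgc).aestronglyMeasurable, h2.lt_top⟩
    have h4 := norm_integral_le_mul_l2 (μ := volume.restrict (Ioo (-δ) δ))
      (h := fun a => ψ (graphPoint Φ γ a)) (C := B * ‖ξ‖) (by positivity) (memLp_const (1 : ℝ)) hm
      (Filter.Eventually.of_forall fun a => by
        rw [norm_one, one_mul, hψ, norm_mul, mul_assoc, mul_comm ‖ξ‖]
        exact mul_le_mul (hζB _) (norm_inner_le_norm _ _) (norm_nonneg _) hB)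
    have h5 : l2 (volume.restrict (Ioo (-δ) δ)) (fun _ => (1 : ℝ)) = √(2 * δ) := by
      rw [← Real.sqrt_sq (l2_nonneg _), l2_sq_eq_integral (memLp_const 1)]
      congr 1
      simp [Measure.real, hδ.le, two_mul]
    rw [h5] at h4
    refine h4.trans ?_
    gcongr
  have hI2 : |∫ x in Ω, fderiv ℝ ζ x η * w x| ≤ B * ‖η‖ * ‖ξ‖ * V * (√C * E) := by
    refine (abs_integral_le_of_bound hΩ.isBounded hcφ (B := B * ‖η‖ * ‖ξ‖) (by positivity)
      fun x => ?_).trans ?_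
    · rw [abs_mul, mul_assoc (B * ‖η‖), mul_comm ‖ξ‖]
      refine mul_le_mul ?_ (norm_inner_le_norm (𝕜 := ℝ) _ _) (abs_nonneg _) (by positivity)
      exact ((fderiv ℝ ζ x).le_opNorm η).trans (by gcongr; exact hζB' x)
    · gcongr
  have hI3 : |∫ x in Ω, ζ x * inner ℝ (sym (grad φ x)) (outer ξ η)| ≤
      B * (‖ξ‖ * ‖η‖) * V * E := by
    refine abs_integral_le_of_bound hΩ.isBounded (continuous_sym.comp hcg) (by positivity)
      fun x => ?_
    have h1 := abs_real_inner_le_norm (sym (grad φ x)) (outer ξ η)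
    rw [norm_outer] at h1
    rw [abs_mul, mul_assoc B, mul_comm (‖ξ‖ * ‖η‖)]
    exact mul_le_mul (hζB x) h1 (abs_nonneg _) hB
  have hw' := hwc.continuous
  have hcs := continuous_sym.comp hcg
  have i1 : IntegrableOn (fun x => ζ x * inner ℝ (fderiv ℝ φ x η) ξ) Ω :=
    (Continuous.integrable_of_hasCompactSupport (by fun_prop) hc.mul_right).integrableOn
  have i2 : IntegrableOn (fun x => fderiv ℝ ζ x η * w x) Ω :=
    (Continuous.integrable_of_hasCompactSupport (by fun_prop)
      ((hc.fderiv_apply (𝕜 := ℝ) η).mul_right)).integrableOn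
  have i3 : IntegrableOn (fun x => ζ x * inner ℝ (sym (grad φ x)) (outer ξ η)) Ω := by
    refine (Continuous.integrable_of_hasCompactSupport ?_ hc.mul_right).integrableOn
    exact hcζ.mul (hcs.inner continuous_const)
  have hsum : (∫ x in Ω, ζ x * curl φ x) * cross ξ η =
      2 * ((∫ x in Ω, fderiv ℝ ψ x η) - ∫ x in Ω, fderiv ℝ ζ x η * w x) -
        2 * ∫ x in Ω, ζ x * inner ℝ (sym (grad φ x)) (outer ξ η) := by
    have e1 : (∫ x in Ω, fderiv ℝ ψ x η) =
        (∫ x in Ω, ζ x * inner ℝ (fderiv ℝ φ x η) ξ) + ∫ x in Ω, fderiv ℝ ζ x η * w x := by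
      rw [← integral_add i1 i2]
      simp only [hdψ]
    rw [e1, add_sub_cancel_right, ← integral_const_mul, ← integral_const_mul,
      ← integral_sub (i1.const_mul 2) (i3.const_mul 2), ← integral_mul_const]
    congr 1
    funext x
    rw [mul_assoc, curl_mul_cross]
    ring
  have hmul : |∫ x in Ω, ζ x * curl φ x| * k ≤ C' * B * E := by
    rw [hk, ← abs_mul, hsum]
    refine (abs_sub _ _).trans ?_
    rw [abs_mul, abs_mul, abs_two]
    have h1 := abs_sub (∫ x in Ω, fderiv ℝ ψ x η) (∫ x in Ω, fderiv ℝ ζ x η * w x)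
    rw [hC']
    linarith
  rw [div_mul_eq_mul_div, div_mul_eq_mul_div, le_div_iff₀ hk0]
  exact hmul

end Chart

/-! ### From local to global rotation bounds -/

lemma exists_bound_smooth {f : Plane → ℝ} (hf : ContDiff ℝ ∞ f) (hc : HasCompactSupport f) :
    ∃ B : ℝ, 0 ≤ B ∧ (∀ x, |f x| ≤ B) ∧ ∀ x, ‖fderiv ℝ f x‖ ≤ B := by
  obtain ⟨B₁, h1⟩ := hc.exists_bound_of_continuous hf.continuous
  obtain ⟨B₂, h2⟩ := (hc.fderiv ℝ).exists_bound_of_continuous (hf.continuous_fderiv (by simp))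
  refine ⟨max B₁ B₂, le_max_of_le_left ((norm_nonneg _).trans (h1 0)),
    fun x => (h1 x).trans (le_max_left _ _), fun x => (h2 x).trans (le_max_right _ _)⟩

/-- Integrals of the rotation against smooth functions are controlled by the strain. -/
lemma exists_curl_bound (hΩ : IsLipschitzDomain Ω) (hctl : Controlled Ω Γ₀ Ω) :
    CurlControlled Ω Γ₀ univ := by
  have hloc : ∀ x ∈ closure Ω, ∃ U : Set Plane, IsOpen U ∧ x ∈ U ∧ Bornology.IsBounded U ∧
      CurlControlled Ω Γ₀ U := by
    intro x hx
    by_cases hxΩ : x ∈ Ω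
    · exact ⟨Ω, hΩ.isOpen, hxΩ, hΩ.isBounded, curlControlled_interior hΩ.isBounded hctl⟩
    · obtain ⟨δ, hδ, h⟩ := exists_curlControlled_of_mem_frontier hΩ
        (by rw [hΩ.isOpen.frontier_eq]; exact ⟨hx, hxΩ⟩) hctl
      exact ⟨_, Metric.isOpen_ball, Metric.mem_ball_self hδ, Metric.isBounded_ball, h⟩
  choose! U hUo hUx hUb hUc using hloc
  obtain ⟨t, ht, htc⟩ := hΩ.isBounded.isCompact_closure.elim_nhds_subcover U
    fun x hx => (hUo x hx).mem_nhds (hUx x hx)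
  -- Splitting `ζ` by a finite smooth partition of unity reduces to the local bounds. The product
  -- rule turns the bound `B` for `ζ` into `2 * Bf i * B` for each piece.
  obtain ⟨f, hf⟩ := SmoothPartitionOfUnity.exists_isSubordinate (modelWithCornersSelf ℝ Plane)
    (isClosed_closure (s := Ω)) (fun i : t => U i) (fun i => hUo i (ht i i.2)) (by
      intro x hx
      obtain ⟨i, hi, hxi⟩ := mem_iUnion₂.1 (htc hx)
      exact mem_iUnion.2 ⟨⟨i, hi⟩, hxi⟩)
  have hfs : ∀ i : t, ContDiff ℝ ∞ (f i) := fun i => (f i).contMDiff.contDiff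
  have hfc : ∀ i : t, HasCompactSupport (f i) := fun i =>
    Metric.isCompact_of_isClosed_isBounded (isClosed_tsupport _) ((hUb i (ht i i.2)).subset (hf i))
  choose Bf hBf0 hBf1 hBf2 using fun i : t => exists_bound_smooth (hfs i) (hfc i)
  choose C hC0 hC using fun i : t => hUc i (ht i i.2)
  refine ⟨∑ i : t, C i * (2 * Bf i), Finset.sum_nonneg fun i _ =>
    mul_nonneg (hC0 i) (mul_nonneg zero_le_two (hBf0 i)),
    fun ζ hζ hc _ B hB hζB hζB' φ hφ => ?_⟩
  have hsum : ∀ x ∈ Ω, ζ x * curl φ x = ∑ i : t, (f i x * ζ x) * curl φ x := by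
    intro x hx
    have h1 := f.sum_eq_one (subset_closure hx)
    rw [finsum_eq_sum_of_fintype] at h1
    rw [← Finset.sum_mul, ← Finset.sum_mul, h1, one_mul]
  rw [setIntegral_congr_fun hΩ.isOpen.measurableSet hsum, integral_finsetSum]
  · refine (Finset.abs_sum_le_sum_abs _ _).trans ?_
    rw [Finset.sum_mul, Finset.sum_mul]
    refine Finset.sum_le_sum fun i _ => ?_
    have h1 := hC i (fun x => f i x * ζ x) ((hfs i).mul hζ) (hc.mul_left)
      ((tsupport_mul_subset_left).trans (hf i)) (2 * Bf i * B)
      (mul_nonneg (mul_nonneg zero_le_two (hBf0 i)) hB) (fun x => ?_) (fun x => ?_) φ hφ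
    · rw [mul_assoc (C i)]; exact h1
    · rw [abs_mul]
      have := mul_le_mul (hBf1 i x) (hζB x) (abs_nonneg _) (hBf0 i)
      nlinarith [mul_nonneg (hBf0 i) hB]
    · rw [fderiv_fun_mul ((hfs i).differentiable (by simp) x) (hζ.differentiable (by simp) x)]
      refine (norm_add_le _ _).trans ?_
      rw [norm_smul, norm_smul]
      have h2 : ‖f i x‖ * ‖fderiv ℝ ζ x‖ ≤ Bf i * B :=
        mul_le_mul (hBf1 i x) (hζB' x) (norm_nonneg _) (hBf0 i)
      have h3 : ‖ζ x‖ * ‖fderiv ℝ (f i) x‖ ≤ B * Bf i :=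
        mul_le_mul (hζB x) (hBf2 i x) (norm_nonneg _) hB
      linarith
  · intro i _
    have h1 := continuous_curl hφ.1
    have h2 := hζ.continuous
    have h3 := (hfs i).continuous
    exact (Continuous.integrable_of_hasCompactSupport (by fun_prop)
      (hc.mul_left.mul_right)).integrableOn

/-- The matrix of the rotation by a right angle. -/
def rotMat : Mat2 := EuclideanSpace.single (0, 1) 1 - EuclideanSpace.single (1, 0) 1

lemma grad_eq_sym_add (φ : Plane → Plane) (x : Plane) :
    grad φ x = sym (grad φ x) + (curl φ x / 2) • rotMat := by
  ext ⟨i, j⟩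
  fin_cases i <;> fin_cases j <;> simp [rotMat, sym, curl] <;> ring

/-- The mollified gradient of test fields is controlled by the strain. -/
theorem exists_mollifiedGrad_bound (hΩ : IsLipschitzDomain Ω) (hctl : Controlled Ω Γ₀ Ω)
    {ρ : Plane → ℝ} (hρ : IsMollifier ρ) :
    ∃ C : ℝ, 0 ≤ C ∧ ∀ φ, IsTestField Γ₀ φ → ∀ x, ‖mollifiedGrad ρ Ω (grad φ) x‖ ≤
      C * l2 (volume.restrict Ω) (fun y => sym (grad φ y)) := by
  have : IsFiniteMeasure (volume.restrict Ω) := ⟨by simpa using hΩ.isBounded.measure_lt_top⟩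
  obtain ⟨C, hC0, hC⟩ := exists_curl_bound hΩ hctl
  obtain ⟨B, hB0, hB1, hB2⟩ := exists_bound_smooth hρ.contDiff hρ.hasCompactSupport
  set V := √((volume.restrict Ω).real univ)
  refine ⟨B * V + C * B / 2 * ‖rotMat‖, by positivity, fun φ hφ x => ?_⟩
  set E := l2 (volume.restrict Ω) (fun y => sym (grad φ y))
  -- The reflected translates of the kernel share the sup bounds of `ρ` and its derivative, so the
  -- constant does not depend on `x`.
  set ζ : Plane → ℝ := fun y => ρ (x - y) with hζdef
  have hζ : ContDiff ℝ ∞ ζ := hρ.contDiff.comp (contDiff_const.sub contDiff_id)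
  have hζc : HasCompactSupport ζ :=
    hρ.hasCompactSupport.comp_homeomorph (Homeomorph.subLeft x)
  have hζf : ∀ y, ‖fderiv ℝ ζ y‖ ≤ B := by
    intro y
    have h1 : fderiv ℝ ζ y = -fderiv ℝ ρ (x - y) := by
      have h2 := (hρ.contDiff.differentiable (by simp) (x - y)).hasFDerivAt.comp y
        ((hasFDerivAt_id y).const_sub x)
      rw [ContinuousLinearMap.comp_neg, ContinuousLinearMap.comp_id] at h2
      exact h2.fderiv
    rw [h1, norm_neg]
    exact hB2 _
  have hcg := continuous_grad hφ.1
  have hcs := continuous_sym.comp hcg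
  have hcc := continuous_curl hφ.1
  have hcζ := hζ.continuous
  have hm : MemLp (fun y => sym (grad φ y)) 2 (volume.restrict Ω) :=
    memLp_two_of_continuous hΩ.isBounded hcs
  have h1 := norm_setIntegral_smul_le_l2 (μ := volume.restrict Ω) (V := V)
    (Real.sq_sqrt measureReal_nonneg).ge (Real.sqrt_nonneg _) hB0 (ζ := ζ) (fun y => hB1 _) hm
  have h2 := hC ζ hζ hζc (subset_univ _) B hB0 (fun y => hB1 _) hζf φ hφ
  have h3 : mollifiedGrad ρ Ω (grad φ) x = (∫ y in Ω, ζ y • sym (grad φ y)) +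
      ((∫ y in Ω, ζ y * curl φ y) / 2) • rotMat := by
    have i1 : IntegrableOn (fun y => ζ y • sym (grad φ y)) Ω :=
      (Continuous.integrable_of_hasCompactSupport (hcζ.smul hcs) hζc.smul_right).integrableOn
    have i2 : IntegrableOn (fun y => ζ y * curl φ y) Ω :=
      (Continuous.integrable_of_hasCompactSupport (hcζ.mul hcc) hζc.mul_right).integrableOn
    rw [← integral_div, ← integral_smul_const, ← integral_add i1 ((i2.div_const 2).smul_const _)]
    unfold mollifiedGrad
    congr 1
    funext y
    conv_lhs => rw [grad_eq_sym_add φ y]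
    rw [smul_add, smul_smul, mul_div_assoc]
  rw [h3]
  refine (norm_add_le _ _).trans ?_
  rw [norm_smul, Real.norm_eq_abs, abs_div, abs_two]
  have h4 : |∫ y in Ω, ζ y * curl φ y| / 2 * ‖rotMat‖ ≤ C * B * E / 2 * ‖rotMat‖ := by gcongr
  linarith

end Mollify

/-! ### The exact right-hand side -/

lemma LoadBound.abs_load_le {Ω Γ₂ : Set Plane} {f τ : Plane → Plane} {M : ℝ≥0}
    (h : LoadBound Ω Γ₂ f τ M) {φ : Plane → Plane} (hφ : MemLp φ 2 (volume.restrict Ω))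
    (hφ' : MemLp φ 2 ((μH[1] : Measure Plane).restrict Γ₂)) :
    |load Ω Γ₂ f τ φ| ≤ M * l2 (volume.restrict Ω) φ +
      M * l2 ((μH[1] : Measure Plane).restrict Γ₂) φ := by
  have key : ∀ {ν : Measure Plane} {q : Plane → Plane}, MemLp q 2 ν → eLpNorm q 2 ν ≤ M →
      MemLp φ 2 ν → |∫ x, inner ℝ (q x) (φ x) ∂ν| ≤ M * l2 ν φ := by
    intro ν q hq hqM hφ
    have h1 := norm_integral_le_mul_l2 (μ := ν) (h := fun x => (inner ℝ (q x) (φ x) : ℝ))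
      zero_le_one hq hφ
      (Filter.Eventually.of_forall fun x => by rw [one_mul]; exact norm_inner_le_norm _ _)
    rw [one_mul] at h1
    refine h1.trans (mul_le_mul_of_nonneg_right ?_ (l2_nonneg _))
    exact ENNReal.toReal_mono ENNReal.coe_ne_top hqM
  exact (abs_add_le _ _).trans
    (add_le_add (key h.memLp_f h.norm_f hφ) (key h.memLp_τ h.norm_τ hφ'))

lemma IsTestField.sub {Γ₀ : Set Plane} {φ ψ : Plane → Plane} (hφ : IsTestField Γ₀ φ)
    (hψ : IsTestField Γ₀ ψ) : IsTestField Γ₀ (φ - ψ) :=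
  ⟨hφ.1.sub hψ.1, fun x hx => by simp [hφ.2 x hx, hψ.2 x hx]⟩

lemma grad_sub_apply {φ ψ : Plane → Plane} {x : Plane} (hφ : DifferentiableAt ℝ φ x)
    (hψ : DifferentiableAt ℝ ψ x) : grad (φ - ψ) x = grad φ x - grad ψ x := by
  ext p
  simp [grad, fderiv_sub hφ hψ]

/-- Instantiates the abstract estimate with smooth test fields. In the load constant, `C₁` is the
Korn–Poincaré constant for the volume force and `C₂` the trace constant for the traction. -/
theorem exists_lipschitz_rhs_exact {T R α ω₀ ω₁ : ℝ} (hT : 0 < T) (hα : 1 ≤ α) (hω₁ : ω₁ < 1)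
    {Ω Γ₀ Γ₁ Γ₂ : Set Plane} (hΩ : IsLipschitzDomain Ω) (hΓ : IsBoundaryPartition Ω Γ₀ Γ₁ Γ₂)
    {lam mu : Plane → ℝ} (hlame : IsLame Ω lam mu) {f τ : ℝ → Plane → Plane}
    {ρ : Plane → ℝ} (hρ : IsMollifier ρ) {g : ℝ → Plane → Mat2 → ℝ}
    (hg : IsDamageProcess T Ω R α ω₀ ω₁ g) (hgt : IsLipschitzInTime T Ω R g) (M : ℝ≥0) :
    ∃ L : ℝ≥0, ∀ t ∈ Ioo 0 T, LoadBound Ω Γ₂ (f t) (τ t) M →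
      ∀ᵐ x ∂(volume.restrict Ω), ∀ (v₁ v₂ : Plane → ℝ) (u₁ u₂ : Plane → Plane)
        (G₁ G₂ : Plane → Mat2),
        IsDamageState Ω ω₁ v₁ → IsDamageState Ω ω₁ v₂ →
        IsDisplacement Ω Γ₀ Γ₂ lam mu (f t) (τ t) v₁ u₁ G₁ →
        IsDisplacement Ω Γ₀ Γ₂ lam mu (f t) (τ t) v₂ u₂ G₂ →
        v₁ x ∈ Icc 0 ω₁ → v₂ x ∈ Icc 0 ω₁ →
        ‖mollifiedGrad ρ Ω G₁ x‖ ≤ R → ‖mollifiedGrad ρ Ω G₂ x‖ ≤ R →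
        |rhs α ρ Ω g t x v₁ G₁ - rhs α ρ Ω g t x v₂ G₂| ≤
          L * (|v₁ x - v₂ x| + supNorm Ω (fun y => v₁ y - v₂ y)) := by
  obtain ⟨U, hU, hΓU⟩ := hΓ.relOpen₀
  have hctl := controlled_domain hΩ hU hΓU hΓ.nonempty₀
  obtain ⟨C₂, hC₂⟩ := exists_trace hΩ hctl
  obtain ⟨C, hC0, hC⟩ := exists_mollifiedGrad_bound hΩ hctl hρ
  obtain ⟨C₁, hC₁⟩ := hctl
  have hΓ₂ : Γ₂ ⊆ frontier Ω := by
    obtain ⟨W, -, hW⟩ := hΓ.relOpen₂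
    rw [hW]; exact inter_subset_right
  have hdiff : ∀ φ, IsTestField Γ₀ φ → Differentiable ℝ φ := fun φ hφ =>
    hφ.1.differentiable (by simp)
  obtain ⟨L, hL⟩ := exists_lipschitz_rhs (𝒯 := {φ | IsTestField Γ₀ φ}) (A := M * √C₁ + M * √C₂)
    hT hα hω₁ hg hgt hρ hlame
    hΩ.isBounded.measure_lt_top.ne hC0
    (fun φ hφ => memLp_two_of_continuous hΩ.isBounded (continuous_grad hφ.1))
    (fun φ hφ ψ hψ => ⟨φ - ψ, hφ.sub hψ, Filter.Eventually.of_forall fun x =>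
      grad_sub_apply (hdiff φ hφ x) (hdiff ψ hψ x)⟩) hC (by positivity)
  have happ : ∀ {u : Plane → Plane} {G : Plane → Mat2}, MemV Ω Γ₀ u G → ∀ δ > 0,
      ∃ φ ∈ {φ | IsTestField Γ₀ φ}, l2 (volume.restrict Ω) (fun x => grad φ x - G x) ≤ δ := by
    intro u G h δ hδ
    obtain ⟨φ, hφ, -, h2⟩ := h.approx ⟨δ, hδ.le⟩ hδ
    exact ⟨φ, hφ, ENNReal.toReal_mono ENNReal.coe_ne_top h2⟩
  refine ⟨L, fun t ht hload => ?_⟩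
  filter_upwards [hL t ht] with x hx v₁ v₂ u₁ u₂ G₁ G₂ hv₁ hv₂ hu₁ hu₂ hx₁ hx₂ hm₁ hm₂
  refine hx v₁ v₂ v₁ v₂ G₁ G₂ (load Ω Γ₂ (f t) (τ t)) _ hu₁.memV.memLp_grad hu₂.memV.memLp_grad
    hv₁.aemeasurable hv₂.aemeasurable hv₁.mem_Icc hv₂.mem_Icc (supNorm_nonneg _ _)
    (hv₁.abs_sub_le_supNorm hv₂) (fun φ hφ => ?_) hu₁.weak_eq hu₂.weak_eq (happ hu₁.memV)
    (happ hu₂.memV) hx₁ hx₂ hm₁ hm₂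
  obtain ⟨-, h1⟩ := l2_le_of_lintegral_le hΩ.isBounded hφ (hC₁ φ hφ)
  obtain ⟨h2, h3⟩ := l2_le_of_lintegral_le hΩ.isBounded hφ
    ((lintegral_mono_set hΓ₂).trans (hC₂ φ hφ))
  refine (hload.abs_load_le (memLp_two_of_continuous hΩ.isBounded hφ.1.continuous)
    ⟨hφ.1.continuous.aestronglyMeasurable, h2.lt_top⟩).trans ?_
  rw [add_mul, mul_assoc, mul_assoc]
  gcongr

/-! ### Triangulations -/

section Triangles

variable {t : Finset Plane}

/-- The affine basis given by the vertices of a triangle. -/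
def triangleBasis (ht : AffineIndependent ℝ ((↑) : t → Plane)) (hc : t.card = 3) :
    AffineBasis t ℝ Plane where
  toFun := (↑)
  ind' := ht
  tot' := by
    rw [ht.affineSpan_eq_top_iff_card_eq_finrank_add_one]
    simp [hc]

lemma range_triangleBasis (ht : AffineIndependent ℝ ((↑) : t → Plane)) (hc : t.card = 3) :
    range (triangleBasis ht hc) = (t : Set Plane) := Subtype.range_coe

lemma interior_triangle_nonempty (ht : AffineIndependent ℝ ((↑) : t → Plane)) (hc : t.card = 3) :
    (interior (convexHull ℝ (t : Set Plane))).Nonempty := by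
  rw [interior_convexHull_nonempty_iff_affineSpan_eq_top, ← range_triangleBasis ht hc]
  exact (triangleBasis ht hc).tot

/-- A point of a triangle which is not in its interior lies on an edge. -/
lemma mem_edge_of_notMem_interior (ht : AffineIndependent ℝ ((↑) : t → Plane)) (hc : t.card = 3)
    {x : Plane} (hx : x ∈ convexHull ℝ (t : Set Plane))
    (hxi : x ∉ interior (convexHull ℝ (t : Set Plane))) :
    ∃ a ∈ t, ∃ b ∈ t, x ∈ segment ℝ a b := by
  classical
  set β := triangleBasis ht hc
  have hr : range β = (t : Set Plane) := range_triangleBasis ht hc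
  rw [← hr, β.interior_convexHull] at hxi
  rw [← hr, β.convexHull_eq_nonneg_coord] at hx
  simp only [mem_ofPred_eq, not_forall, not_lt] at hxi hx
  obtain ⟨i, hi⟩ := hxi
  have hi0 : β.coord i x = 0 := le_antisymm hi (hx i)
  have hcard : (Finset.univ.erase i).card = 2 := by
    rw [Finset.card_erase_of_mem (Finset.mem_univ i)]
    simp [hc]
  obtain ⟨j, k, hjk, he⟩ := Finset.card_eq_two.1 hcard
  have h1 : β.coord j x + β.coord k x = 1 := by
    have := β.sum_coord_apply_eq_one x
    rwa [← Finset.add_sum_erase _ _ (Finset.mem_univ i), hi0, zero_add, he,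
      Finset.sum_pair hjk] at this
  have h2 : β.coord j x • (j : Plane) + β.coord k x • (k : Plane) = x := by
    have := β.linear_combination_coord_eq_self x
    rwa [← Finset.add_sum_erase _ _ (Finset.mem_univ i), hi0, zero_smul, zero_add, he,
      Finset.sum_pair hjk] at this
  exact ⟨j, j.2, k, k.2, ⟨_, _, hx j, hx k, h1, h2⟩⟩

end Triangles

/-- The triangles of a simplicial complex. -/
def triangles (K : Geometry.SimplicialComplex ℝ Plane) : Set (Finset Plane) :=
  {t | t ∈ K.faces ∧ t.card = 3}

namespace IsTriangulation

variable {K : Geometry.SimplicialComplex ℝ Plane}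

lemma finite_triangles (hK : IsTriangulation K) : (triangles K).Finite :=
  hK.finite.subset fun _ h => h.1

lemma exists_triangle (hK : IsTriangulation K) {x : Plane} (hx : x ∈ K.space) :
    ∃ t ∈ triangles K, x ∈ convexHull ℝ (t : Set Plane) := by
  obtain ⟨s, hs, hxs⟩ := Geometry.SimplicialComplex.mem_space_iff.1 hx
  obtain ⟨t, ht, hst, hc⟩ := hK.pure s hs
  exact ⟨t, ⟨ht, hc⟩, convexHull_mono (by exact_mod_cast hst) hxs⟩

lemma isCompact_space (hK : IsTriangulation K) : IsCompact K.space :=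
  hK.finite.isCompact_biUnion fun s _ => s.finite_toSet.isCompact_convexHull ℝ

lemma interior_triangle_subset {t : Finset Plane} (ht : t ∈ triangles K) :
    interior (convexHull ℝ (t : Set Plane)) ⊆ interior K.space :=
  interior_mono (K.convexHull_subset_space ht.1)

/-- Every point lies in a nondegenerate triangle, a convex set with interior points. This lets
identities on the open domain pass to its boundary by continuity. -/
lemma space_subset_closure (hK : IsTriangulation K) : K.space ⊆ closure (interior K.space) := by
  intro x hx
  obtain ⟨t, ht, hxt⟩ := hK.exists_triangle hx
  have h1 := (convex_convexHull ℝ (t : Set Plane)).closure_interior_eq_closure_of_nonempty_interior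
    (interior_triangle_nonempty (K.indep ht.1) ht.2)
  refine closure_mono (interior_triangle_subset ht) ?_
  rw [h1]
  exact subset_closure hxt

lemma frontier_subset_space (hK : IsTriangulation K) : frontier (interior K.space) ⊆ K.space :=
  frontier_subset_closure.trans
    (closure_minimal interior_subset hK.isCompact_space.isClosed)

lemma measure_ne_top (hK : IsTriangulation K) : volume (interior K.space) ≠ ⊤ :=
  ((measure_mono interior_subset).trans_lt hK.isCompact_space.measure_lt_top).ne

/-- Almost every point lies in the interior of a triangle. -/
lemma ae_mem_interior (hK : IsTriangulation K) : ∀ᵐ x ∂(volume.restrict (interior K.space)),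
    ∃ t ∈ triangles K, x ∈ interior (convexHull ℝ (t : Set Plane)) := by
  have h0 : volume (⋃ t ∈ triangles K, frontier (convexHull ℝ (t : Set Plane))) = 0 :=
    (measure_biUnion_null_iff hK.finite_triangles.countable).2 fun t _ =>
      (convex_convexHull ℝ (t : Set Plane)).addHaar_frontier volume
  filter_upwards [ae_restrict_mem isOpen_interior.measurableSet,
    ae_restrict_of_ae (measure_eq_zero_iff_ae_notMem.1 h0)] with x hx hx0
  obtain ⟨t, ht, hxt⟩ := hK.exists_triangle (interior_subset hx)
  refine ⟨t, ht, ?_⟩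
  by_contra hn
  exact hx0 (mem_biUnion ht ⟨subset_closure hxt, hn⟩)

/-- The boundary of the triangulated domain has finite length. -/
lemma hausdorffMeasure_frontier_lt_top (hK : IsTriangulation K) :
    (μH[1] : Measure Plane) (frontier (interior K.space)) < ⊤ := by
  -- A boundary point cannot be interior to a triangle, so it lies on one of finitely many edges.
  -- Finite length makes bounded fields square integrable on the loaded part.
  have hsub : frontier (interior K.space) ⊆
      ⋃ t ∈ triangles K, ⋃ a ∈ t, ⋃ b ∈ t, segment ℝ a b := by
    intro x hx
    obtain ⟨t, ht, hxt⟩ := hK.exists_triangle (hK.frontier_subset_space hx)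
    have hxi : x ∉ interior (convexHull ℝ (t : Set Plane)) := by
      intro h
      rw [isOpen_interior.frontier_eq] at hx
      exact hx.2 (interior_triangle_subset ht h)
    obtain ⟨a, ha, b, hb, hab⟩ := mem_edge_of_notMem_interior (K.indep ht.1) ht.2 hxt hxi
    simp only [mem_iUnion]
    exact ⟨t, ht, a, ha, b, hb, hab⟩
  refine (measure_mono hsub).trans_lt ?_
  refine measure_biUnion_lt_top hK.finite_triangles fun t _ => ?_
  refine measure_biUnion_lt_top t.finite_toSet fun a _ => ?_
  refine measure_biUnion_lt_top t.finite_toSet fun b _ => ?_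
  rw [hausdorffMeasure_segment]
  exact edist_lt_top a b

end IsTriangulation

/-! ### Finite element fields -/

namespace MemVh

variable {K : Geometry.SimplicialComplex ℝ Plane} {Γ₀ : Set Plane} {φ ψ : Plane → Plane}

lemma add (hφ : MemVh K Γ₀ φ) (hψ : MemVh K Γ₀ ψ) : MemVh K Γ₀ (φ + ψ) where
  continuousOn := hφ.continuousOn.add hψ.continuousOn
  affine s hs := by
    obtain ⟨A, hA⟩ := hφ.affine s hs
    obtain ⟨B, hB⟩ := hψ.affine s hs
    exact ⟨A + B, fun x hx => by simp [hA hx, hB hx]⟩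
  vanish x hx := by simp [hφ.vanish x hx, hψ.vanish x hx]

lemma smul (c : ℝ) (hφ : MemVh K Γ₀ φ) : MemVh K Γ₀ (c • φ) where
  continuousOn := hφ.continuousOn.const_smul c
  affine s hs := by
    obtain ⟨A, hA⟩ := hφ.affine s hs
    exact ⟨c • A, fun x hx => by simp [hA hx]⟩
  vanish x hx := by simp [hφ.vanish x hx]

/-- On a triangle a finite element field is affine. -/
lemma exists_linear (hφ : MemVh K Γ₀ φ) {t : Finset Plane} (ht : t ∈ triangles K) :
    ∃ L : Plane →L[ℝ] Plane,
      (∀ x ∈ convexHull ℝ (t : Set Plane), ∀ y ∈ convexHull ℝ (t : Set Plane),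
        φ x - φ y = L (x - y)) ∧
      ∀ x ∈ interior (convexHull ℝ (t : Set Plane)), HasFDerivAt φ L x := by
  obtain ⟨A, hA⟩ := hφ.affine t ht.1
  set L : Plane →L[ℝ] Plane := LinearMap.toContinuousLinearMap A.linear with hL
  have h1 : ∀ x ∈ convexHull ℝ (t : Set Plane), ∀ y ∈ convexHull ℝ (t : Set Plane),
      φ x - φ y = L (x - y) := fun x hx y hy => by
    rw [hA hx, hA hy]
    exact (A.linearMap_vsub x y).symm
  refine ⟨L, h1, fun x hx => ?_⟩
  have h2 : HasFDerivAt (fun z => L (z - x) + φ x) L x := by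
    have hs : HasFDerivAt (fun z : Plane => z - x) (ContinuousLinearMap.id ℝ Plane) x :=
      (hasFDerivAt_id x).sub_const x
    have := HasFDerivAt.comp (f := fun z : Plane => z - x) (g := L) x L.hasFDerivAt hs
    simpa using this.add_const (φ x)
  refine h2.congr_of_eventuallyEq ?_
  filter_upwards [isOpen_interior.mem_nhds hx] with z hz
  rw [← h1 z (interior_subset hz) x (interior_subset hx), sub_add_cancel]

lemma differentiableAt (hφ : MemVh K Γ₀ φ) {t : Finset Plane} (ht : t ∈ triangles K) {x : Plane}
    (hx : x ∈ interior (convexHull ℝ (t : Set Plane))) : DifferentiableAt ℝ φ x := by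
  obtain ⟨L, -, h⟩ := hφ.exists_linear ht
  exact (h x hx).differentiableAt

lemma grad_eq (hφ : MemVh K Γ₀ φ) {t : Finset Plane} (ht : t ∈ triangles K) {x y : Plane}
    (hx : x ∈ interior (convexHull ℝ (t : Set Plane)))
    (hy : y ∈ interior (convexHull ℝ (t : Set Plane))) : grad φ x = grad φ y := by
  obtain ⟨L, -, h⟩ := hφ.exists_linear ht
  simp only [grad, (h x hx).fderiv, (h y hy).fderiv]

end MemVh

/-- A point in the interior of a triangle. -/
def interiorPoint (K : Geometry.SimplicialComplex ℝ Plane) (t : triangles K) : Plane :=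
  (interior_triangle_nonempty (K.indep t.2.1) t.2.2).some

lemma interiorPoint_mem (K : Geometry.SimplicialComplex ℝ Plane) (t : triangles K) :
    interiorPoint K t ∈ interior (convexHull ℝ (t.1 : Set Plane)) :=
  (interior_triangle_nonempty (K.indep t.2.1) t.2.2).some_mem

/-! ### Rigidity of strain-free fields -/

section Rigidity

variable {K : Geometry.SimplicialComplex ℝ Plane} {Γ₀ : Set Plane} {φ : Plane → Plane}

/-- The rotation by a right angle. -/
def rotL : Plane →L[ℝ] Plane :=
  LinearMap.toContinuousLinearMap
    { toFun := fun z => !₂[-z 1, z 0]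
      map_add' := fun x y => by ext i; fin_cases i <;> simp; ring
      map_smul' := fun c x => by ext i; fin_cases i <;> simp }

lemma rotL_apply (z : Plane) : rotL z = !₂[-z 1, z 0] := rfl

/-- The image is connected, so two distinct values would bring in a whole infinite interval. -/
lemma eq_of_finite_image_of_continuousOn {h : ℝ → ℝ} (hc : ContinuousOn h (Icc 0 1))
    (hf : (h '' Icc 0 1).Finite) {a b : ℝ} (ha : a ∈ Icc (0 : ℝ) 1) (hb : b ∈ Icc (0 : ℝ) 1) :
    h a = h b := by
  have hp : IsPreconnected (h '' Icc 0 1) := isPreconnected_Icc.image h hc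
  by_contra hne
  rcases lt_or_gt_of_ne hne with hlt | hlt
  · exact (Icc_infinite hlt) (hf.subset (hp.Icc_subset ⟨a, ha, rfl⟩ ⟨b, hb, rfl⟩))
  · exact (Icc_infinite hlt) (hf.subset (hp.Icc_subset ⟨b, hb, rfl⟩ ⟨a, ha, rfl⟩))

/-- Along the segment the tangential component has zero derivative on each triangle, hence one value
per triangle. Being continuous with finitely many values it is constant; how the segment crosses the
triangles is irrelevant. -/
lemma inner_sub_eq_zero_of_segment (hK : IsTriangulation K) (hφ : MemVh K Γ₀ φ)
    (h0 : ∀ t : triangles K, sym (grad φ (interiorPoint K t)) = 0) {x y : Plane}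
    (hxy : segment ℝ x y ⊆ K.space) : inner ℝ (φ y - φ x) (y - x) = 0 := by
  have htri : ∀ t ∈ triangles K, ∀ a ∈ convexHull ℝ (t : Set Plane),
      ∀ b ∈ convexHull ℝ (t : Set Plane), ∀ c : ℝ, a - b = c • (y - x) →
      inner ℝ (φ a) (y - x) = inner ℝ (φ b) (y - x) := by
    intro t ht a ha b hb c hab
    obtain ⟨L, hL, hd⟩ := hφ.exists_linear ht
    have h1 := inner_fderiv_add φ (interiorPoint K ⟨t, ht⟩) (y - x) (y - x)
    rw [h0, inner_zero_left, mul_zero, (hd _ (interiorPoint_mem K ⟨t, ht⟩)).fderiv] at h1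
    have h2 : inner ℝ (L (y - x)) (y - x) = 0 := by linarith
    rw [← sub_eq_zero, ← inner_sub_left, hL a ha b hb, hab, map_smul, real_inner_smul_left, h2,
      mul_zero]
  set h : ℝ → ℝ := fun s => inner ℝ (φ (x + s • (y - x))) (y - x) with hdef
  have hmaps : MapsTo (fun s : ℝ => x + s • (y - x)) (Icc 0 1) K.space := fun s hs =>
    hxy (by rw [segment_eq_image']; exact ⟨s, hs, rfl⟩)
  have hc : ContinuousOn h (Icc 0 1) := by
    have h1 : ContinuousOn (fun s : ℝ => φ (x + s • (y - x))) (Icc 0 1) :=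
      hφ.continuousOn.comp (by fun_prop) hmaps
    exact h1.inner continuousOn_const
  have hfin : (h '' Icc 0 1).Finite := by
    have hsub : h '' Icc 0 1 ⊆ ⋃ t ∈ triangles K,
        h '' {s | x + s • (y - x) ∈ convexHull ℝ (t : Set Plane)} := by
      rintro _ ⟨s, hs, rfl⟩
      obtain ⟨t, ht, hst⟩ := hK.exists_triangle (hmaps hs)
      exact mem_biUnion ht ⟨s, hst, rfl⟩
    refine (hK.finite_triangles.biUnion fun t ht => Subsingleton.finite ?_).subset hsub
    rintro _ ⟨s, hs, rfl⟩ _ ⟨s', hs', rfl⟩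
    exact htri t ht _ hs _ hs' (s - s') (by rw [sub_smul]; abel)
  have h1 := eq_of_finite_image_of_continuousOn hc hfin (a := 1) (b := 0) (by simp) (by simp)
  simp only [hdef, one_smul, zero_smul, add_zero, add_sub_cancel] at h1
  rw [inner_sub_left, h1, sub_self]

/-- The centre and two points in the coordinate directions form a frame. The orthogonality relations
within the frame and between the frame and `x` are linear equations that leave only one free
parameter, the angular velocity `κ`. -/
lemma exists_rotation_of_ball {q : Plane} {r : ℝ} (hr : 0 < r)
    (h : ∀ x ∈ Metric.ball q r, ∀ y ∈ Metric.ball q r, inner ℝ (φ y - φ x) (y - x) = 0) :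
    ∃ κ : ℝ, ∀ x ∈ Metric.ball q r, φ x = φ q + κ • rotL (x - q) := by
  set η := r / 2 with hη
  have hη0 : 0 < η := by positivity
  set e₀ : Plane := EuclideanSpace.single 0 η
  set e₁ : Plane := EuclideanSpace.single 1 η
  have hball : ∀ e : Plane, ‖e‖ = η → q + e ∈ Metric.ball q r := fun e he => by
    rw [Metric.mem_ball, dist_eq_norm, add_sub_cancel_left, he]; linarith
  have m₀ : q + e₀ ∈ Metric.ball q r := hball _ (by
    rw [PiLp.norm_single, Real.norm_of_nonneg hη0.le])
  have m₁ : q + e₁ ∈ Metric.ball q r := hball _ (by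
    rw [PiLp.norm_single, Real.norm_of_nonneg hη0.le])
  have mq : q ∈ Metric.ball q r := Metric.mem_ball_self hr
  refine ⟨(φ (q + e₀) 1 - φ q 1) / η, fun x hx => ?_⟩
  have a₀ := h q mq _ m₀
  have a₁ := h q mq _ m₁
  have a₂ := h _ m₀ _ m₁
  have b := h q mq x hx
  have b₀ := h _ m₀ x hx
  have b₁ := h _ m₁ x hx
  simp only [inner_plane, PiLp.sub_apply] at a₀ a₁ a₂ b b₀ b₁
  have p₀ : (q + e₀) 0 = q 0 + η := by simp [e₀]
  have p₁ : (q + e₀) 1 = q 1 := by simp [e₀]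
  have p₂ : (q + e₁) 0 = q 0 := by simp [e₁]
  have p₃ : (q + e₁) 1 = q 1 + η := by simp [e₁]
  rw [p₀, p₁] at a₀ b₀
  rw [p₂, p₃] at a₁ b₁
  rw [p₀, p₁, p₂, p₃] at a₂
  have c₀ : φ (q + e₀) 0 - φ q 0 = 0 := by
    refine (mul_eq_zero.1 (?_ : (φ (q + e₀) 0 - φ q 0) * η = 0)).resolve_right hη0.ne'
    linear_combination a₀
  have c₁ : φ (q + e₁) 1 - φ q 1 = 0 := by
    refine (mul_eq_zero.1 (?_ : (φ (q + e₁) 1 - φ q 1) * η = 0)).resolve_right hη0.ne'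
    linear_combination a₁
  have d₀ : η * (φ x 0 - φ q 0) = -(φ (q + e₀) 1 - φ q 1) * (x 1 - q 1) := by
    linear_combination b - b₀ - c₀ * (x 0 - q 0 - η)
  have d₂ : φ (q + e₁) 0 - φ q 0 = -(φ (q + e₀) 1 - φ q 1) := by
    refine mul_right_cancel₀ hη0.ne' ?_
    linear_combination -a₂ + c₀ * η + c₁ * η
  have d₁ : η * (φ x 1 - φ q 1) = (φ (q + e₀) 1 - φ q 1) * (x 0 - q 0) := by
    linear_combination b - b₁ - c₁ * (x 1 - q 1 - η) - d₂ * (x 0 - q 0)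
  ext i
  rw [rotL_apply]
  fin_cases i
  · simp
    field_simp
    linarith
  · simp
    field_simp
    linarith

/-- A finite element field with zero strain which vanishes at two points is zero. -/
theorem eq_zero_of_strain_eq_zero (hK : IsTriangulation K) (hφ : MemVh K Γ₀ φ)
    (hΓ : Γ₀ ⊆ frontier (interior K.space)) (hΓ2 : Γ₀.Nontrivial)
    (h0 : ∀ t : triangles K, sym (grad φ (interiorPoint K t)) = 0) :
    ∀ x ∈ K.space, φ x = 0 := by
  have hloc : ∀ q ∈ interior K.space, ∃ κ : ℝ, ∀ᶠ x in 𝓝 q, φ x = φ q + κ • rotL (x - q) := by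
    intro q hq
    obtain ⟨r, hr, hrK⟩ := Metric.isOpen_iff.1 isOpen_interior q hq
    obtain ⟨κ, hκ⟩ := exists_rotation_of_ball (φ := φ) hr fun x hx y hy =>
      inner_sub_eq_zero_of_segment hK hφ h0
        (((convex_ball q r).segment_subset hx hy).trans (hrK.trans interior_subset))
    exact ⟨κ, Filter.eventually_of_mem (Metric.ball_mem_nhds q hr) hκ⟩
  have hder : ∀ (q : Plane) (κ : ℝ), (∀ᶠ x in 𝓝 q, φ x = φ q + κ • rotL (x - q)) →
      ∀ᶠ x in 𝓝 q, HasFDerivAt φ (κ • rotL) x := by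
    intro q κ h
    filter_upwards [h.eventually_nhds] with x hx
    have h2 : HasFDerivAt (fun z => φ q + κ • rotL (z - q)) (κ • rotL) x := by
      have hs : HasFDerivAt (fun z : Plane => z - q) (ContinuousLinearMap.id ℝ Plane) x :=
        (hasFDerivAt_id x).sub_const q
      have := HasFDerivAt.comp (f := fun z : Plane => z - q) (g := κ • rotL) x
        (κ • rotL).hasFDerivAt hs
      simpa using this.const_add (φ q)
    exact h2.congr_of_eventuallyEq hx
  have hop := isOpen_interior (s := K.space)
  have hpre := hK.isConnected.isPreconnected
  -- The angular velocity is locally constant; as a zero derivative of `fderiv ℝ φ` this becomes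
  -- constancy on the connected domain.
  have hD : ∀ q ∈ interior K.space, HasFDerivAt (𝕜 := ℝ) (fderiv ℝ φ) 0 q := by
    intro q hq
    obtain ⟨κ, hκ⟩ := hloc q hq
    refine (hasFDerivAt_const (κ • rotL) q).congr_of_eventuallyEq ?_
    filter_upwards [hder q κ hκ] with x hx
    exact hx.fderiv
  obtain ⟨q₀, hq₀⟩ := hK.isConnected.nonempty
  obtain ⟨κ, hκ⟩ := hloc q₀ hq₀
  have hconst : ∀ q ∈ interior K.space, fderiv ℝ φ q = κ • rotL := by
    intro q hq
    rw [hop.is_const_of_fderiv_eq_zero (𝕜 := ℝ) hpre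
      (fun x hx => (hD x hx).differentiableAt.differentiableWithinAt)
      (fun x hx => (hD x hx).fderiv) hq hq₀]
    exact (hder q₀ κ hκ).self_of_nhds.fderiv
  have hdφ : DifferentiableOn ℝ φ (interior K.space) := fun q hq => by
    obtain ⟨κ', hκ'⟩ := hloc q hq
    exact (hder q κ' hκ').self_of_nhds.differentiableAt.differentiableWithinAt
  obtain ⟨a, ha⟩ := hop.exists_eq_add_of_fderiv_eq (𝕜 := ℝ) hpre hdφ
    (g := fun x => (κ • rotL) x) (κ • rotL).differentiable.differentiableOn
    (fun q hq => by rw [hconst q hq]; exact ((κ • rotL).fderiv).symm)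
  have hall : EqOn φ (fun x => (κ • rotL) x + a) K.space :=
    EqOn.of_subset_closure ha hφ.continuousOn
      ((κ • rotL).continuous.add continuous_const).continuousOn interior_subset
      hK.space_subset_closure
  obtain ⟨x, hx, y, hy, hxy⟩ := hΓ2
  have hx0 := hall (hK.frontier_subset_space (hΓ hx))
  have hy0 := hall (hK.frontier_subset_space (hΓ hy))
  rw [hφ.vanish x hx] at hx0
  rw [hφ.vanish y hy] at hy0
  -- At two distinct clamped points the rigid motion vanishes. A rotation by a right angle has no
  -- kernel, so `κ = 0`, and then the translation vanishes too.
  have hrot : κ • rotL (x - y) = 0 := by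
    have h1 : (κ • rotL) x + a = (κ • rotL) y + a := hx0.symm.trans hy0
    have h2 := add_right_cancel h1
    rw [map_sub, smul_sub, sub_eq_zero]
    exact h2
  have hκ0 : κ = 0 := by
    rcases smul_eq_zero.1 hrot with h | h
    · exact h
    · refine absurd ?_ hxy
      have e0 := congrArg (fun z : Plane => z 0) h
      have e1 := congrArg (fun z : Plane => z 1) h
      simp [rotL_apply] at e0 e1
      ext i
      fin_cases i
      · simp; linarith
      · simp; linarith
  intro z hz
  have ha0 : a = 0 := by simpa [hκ0] using hx0.symm
  rw [hall hz]
  simp [hκ0, ha0]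

end Rigidity

/-! ### Estimates for finite element fields -/

/-- On a finite-dimensional range, a linear map controls every linear map with larger kernel. -/
lemma exists_norm_le_mul_of_ker_le {W E F : Type*} [AddCommGroup W] [Module ℝ W]
    [NormedAddCommGroup E] [NormedSpace ℝ E] [FiniteDimensional ℝ E] [NormedAddCommGroup F]
    [NormedSpace ℝ F] (S : W →ₗ[ℝ] E) (Q : W →ₗ[ℝ] F) (h : ∀ w, S w = 0 → Q w = 0) :
    ∃ C : ℝ, 0 ≤ C ∧ ∀ w, ‖Q w‖ ≤ C * ‖S w‖ := by
  obtain ⟨L, hL⟩ := LinearMap.exists_extend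
    (((LinearMap.ker S).liftQ Q fun w hw => h w hw).comp S.quotKerEquivRange.symm.toLinearMap)
  have hLS : ∀ w, L (S w) = Q w := fun w => by
    have h1 := LinearMap.congr_fun hL ⟨S w, LinearMap.mem_range_self S w⟩
    have h2 : S.quotKerEquivRange.symm ⟨S w, LinearMap.mem_range_self S w⟩ =
        (LinearMap.ker S).mkQ w := by
      rw [LinearEquiv.symm_apply_eq]
      rfl
    refine h1.trans ?_
    rw [LinearMap.comp_apply, LinearEquiv.coe_coe, h2]
    exact Submodule.liftQ_apply _ _ _
  refine ⟨‖LinearMap.toContinuousLinearMap L‖, norm_nonneg _, fun w => ?_⟩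
  rw [← hLS w]
  exact (LinearMap.toContinuousLinearMap L).le_opNorm (S w)

lemma measurable_grad (φ : Plane → Plane) : Measurable (grad φ) := by
  refine (PiLp.continuous_toLp 2 _).measurable.comp (measurable_pi_lambda _ fun p => ?_)
  exact (EuclideanSpace.proj (𝕜 := ℝ) p.1).continuous.measurable.comp
    (measurable_fderiv_apply_const ℝ φ _)

section Discrete

variable {K : Geometry.SimplicialComplex ℝ Plane} {Γ₀ : Set Plane} {φ ψ : Plane → Plane}

/-- The finite element space as a subspace of the space of all vector fields. -/
def femSpace (K : Geometry.SimplicialComplex ℝ Plane) (Γ₀ : Set Plane) :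
    Submodule ℝ (Plane → Plane) where
  carrier := {φ | MemVh K Γ₀ φ}
  add_mem' h₁ h₂ := h₁.add h₂
  zero_mem' := ⟨continuousOn_const, fun _ _ => ⟨0, fun _ _ => rfl⟩, fun _ _ => rfl⟩
  smul_mem' c _ h := h.smul c

/-- The gradients of a finite element field on the triangles. -/
def femGrad (K : Geometry.SimplicialComplex ℝ Plane) (Γ₀ : Set Plane) :
    femSpace K Γ₀ →ₗ[ℝ] triangles K → Mat2 where
  toFun φ t := grad φ (interiorPoint K t)
  map_add' φ ψ := by
    funext t
    ext p
    simp [grad, fderiv_add (φ.2.differentiableAt t.2 (interiorPoint_mem K t))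
      (ψ.2.differentiableAt t.2 (interiorPoint_mem K t))]
  map_smul' c φ := by
    funext t
    ext p
    simp [grad, fderiv_const_smul (φ.2.differentiableAt t.2 (interiorPoint_mem K t))]

/-- The strains of a finite element field on the triangles. -/
def femStrain (K : Geometry.SimplicialComplex ℝ Plane) (Γ₀ : Set Plane) :
    femSpace K Γ₀ →ₗ[ℝ] triangles K → Mat2 :=
  (LinearMap.pi fun t => symL.toLinearMap.comp (LinearMap.proj t)).comp (femGrad K Γ₀)

lemma femStrain_apply (φ : femSpace K Γ₀) (t : triangles K) :
    femStrain K Γ₀ φ t = sym (grad φ (interiorPoint K t)) := rfl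

/-- A finite element field as a continuous function on the triangulated domain. -/
def femRestrict (K : Geometry.SimplicialComplex ℝ Plane) (Γ₀ : Set Plane) :
    femSpace K Γ₀ →ₗ[ℝ] C(K.space, Plane) where
  toFun φ := ⟨fun x => φ.1 x, φ.2.continuousOn.domRestrict⟩
  map_add' _ _ := rfl
  map_smul' _ _ := rfl

lemma grad_eq_zero_of_forall_eq_zero (h : ∀ x ∈ K.space, φ x = 0) {x : Plane}
    (hx : x ∈ interior K.space) : grad φ x = 0 := by
  have h1 : φ =ᶠ[𝓝 x] fun _ => 0 :=
    Filter.eventually_of_mem (mem_interior_iff_mem_nhds.1 hx) fun y hy => h y hy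
  ext p
  simp [grad, h1.fderiv_eq]

lemma MemVh.ae_grad_eq (hK : IsTriangulation K) (hφ : MemVh K Γ₀ φ) :
    ∀ᵐ x ∂(volume.restrict (interior K.space)),
      ∃ t : triangles K, grad φ x = grad φ (interiorPoint K t) := by
  filter_upwards [hK.ae_mem_interior] with x hx
  obtain ⟨t, ht, hxt⟩ := hx
  exact ⟨⟨t, ht⟩, hφ.grad_eq ht hxt (interiorPoint_mem K ⟨t, ht⟩)⟩

lemma MemVh.memLp_grad (hK : IsTriangulation K) (hφ : MemVh K Γ₀ φ) :
    MemLp (grad φ) 2 (volume.restrict (interior K.space)) := by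
  have : Fintype (triangles K) := hK.finite_triangles.fintype
  have : IsFiniteMeasure (volume.restrict (interior K.space)) :=
    ⟨by simpa using hK.measure_ne_top.lt_top⟩
  refine MemLp.of_bound (measurable_grad φ).aestronglyMeasurable ‖femGrad K Γ₀ ⟨φ, hφ⟩‖ ?_
  filter_upwards [hφ.ae_grad_eq hK] with x ⟨t, ht⟩
  rw [ht]
  exact norm_le_pi_norm (femGrad K Γ₀ ⟨φ, hφ⟩) t

/-- The strain is constant inside a triangle, so its `L²` norm there is its norm times the root of
the area. -/
lemma MemVh.norm_sym_grad_le (hK : IsTriangulation K) (hφ : MemVh K Γ₀ φ) (t : triangles K) :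
    √(volume.real (interior (convexHull ℝ (t.1 : Set Plane)))) *
      ‖sym (grad φ (interiorPoint K t))‖ ≤
        l2 (volume.restrict (interior K.space)) (fun x => sym (grad φ x)) := by
  have hm := memLp_sym (hφ.memLp_grad hK)
  refine le_of_sq_le_sq ?_ (l2_nonneg _)
  rw [mul_pow, Real.sq_sqrt measureReal_nonneg, l2_sq_eq_integral hm]
  calc _ = ∫ _ in interior (convexHull ℝ (t.1 : Set Plane)),
        ‖sym (grad φ (interiorPoint K t))‖ ^ 2 := by simp
    _ = ∫ x in interior (convexHull ℝ (t.1 : Set Plane)), ‖sym (grad φ x)‖ ^ 2 :=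
        setIntegral_congr_fun isOpen_interior.measurableSet fun x hx => by
          simp only [hφ.grad_eq t.2 hx (interiorPoint_mem K t)]
    _ ≤ _ := setIntegral_mono_set (hm.integrable_norm_pow two_ne_zero)
        (Filter.Eventually.of_forall fun x => by positivity)
        (IsTriangulation.interior_triangle_subset t.2).eventuallyLE

/-- The discrete Korn inequality in the maximum norm. -/
theorem exists_fem_bound (hK : IsTriangulation K) (hΓ : Γ₀ ⊆ frontier (interior K.space))
    (hΓ2 : Γ₀.Nontrivial) :
    ∃ C : ℝ, 0 ≤ C ∧ ∀ φ, MemVh K Γ₀ φ →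
      (∀ x ∈ K.space, ‖φ x‖ ≤
        C * l2 (volume.restrict (interior K.space)) (fun y => sym (grad φ y))) ∧
      ∀ᵐ x ∂(volume.restrict (interior K.space)), ‖grad φ x‖ ≤
        C * l2 (volume.restrict (interior K.space)) (fun y => sym (grad φ y)) := by
  have : Fintype (triangles K) := hK.finite_triangles.fintype
  have : CompactSpace K.space := isCompact_iff_compactSpace.1 hK.isCompact_space
  have hker : ∀ w : femSpace K Γ₀, femStrain K Γ₀ w = 0 → ∀ x ∈ K.space, w.1 x = 0 :=
    fun w hw => eq_zero_of_strain_eq_zero hK w.2 hΓ hΓ2 fun t => congrFun hw t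
  -- By rigidity, values and gradients factor through the triangle strains. Members of `femSpace`
  -- are arbitrary off `K.space` and `Γ₀`, so finite dimension is used for the target of
  -- `femStrain`, not for the space itself.
  obtain ⟨C₁, hC₁, h₁⟩ := exists_norm_le_mul_of_ker_le (femStrain K Γ₀) (femRestrict K Γ₀)
    fun w hw => by
      ext1 x
      exact hker w hw x x.2
  obtain ⟨C₂, hC₂, h₂⟩ := exists_norm_le_mul_of_ker_le (femStrain K Γ₀) (femGrad K Γ₀)
    fun w hw => by
      funext t
      exact grad_eq_zero_of_forall_eq_zero (hker w hw)
        (IsTriangulation.interior_triangle_subset t.2 (interiorPoint_mem K t))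
  set m : triangles K → ℝ := fun t =>
    √(volume.real (interior (convexHull ℝ (t.1 : Set Plane))))
  have hm : ∀ t, 0 < m t := fun t => by
    have hne := interior_triangle_nonempty (K.indep t.2.1) t.2.2
    refine Real.sqrt_pos.2 (ENNReal.toReal_pos
      (isOpen_interior.measure_pos volume hne).ne' ?_)
    exact ((measure_mono (IsTriangulation.interior_triangle_subset t.2)).trans_lt
      hK.measure_ne_top.lt_top).ne
  have hC₃ : 0 ≤ ∑ t, (m t)⁻¹ := Finset.sum_nonneg fun t _ => (inv_pos.2 (hm t)).le
  have h₃ : ∀ w : femSpace K Γ₀, ‖femStrain K Γ₀ w‖ ≤ (∑ t, (m t)⁻¹) *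
      l2 (volume.restrict (interior K.space)) (fun y => sym (grad w y)) := by
    intro w
    refine (pi_norm_le_iff_of_nonneg (mul_nonneg hC₃ (l2_nonneg _))).2 fun t => ?_
    rw [femStrain_apply]
    have h := MemVh.norm_sym_grad_le hK w.2 t
    rw [← le_inv_mul_iff₀ (hm t)] at h
    exact h.trans (mul_le_mul_of_nonneg_right (Finset.single_le_sum (f := fun t => (m t)⁻¹)
      (fun t _ => (inv_pos.2 (hm t)).le) (Finset.mem_univ t)) (l2_nonneg _))
  refine ⟨(C₁ + C₂) * ∑ t, (m t)⁻¹, by positivity, fun φ hφ => ?_⟩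
  have hl := l2_nonneg (μ := volume.restrict (interior K.space)) (fun y => sym (grad φ y))
  have h₄ : (C₁ + C₂) * ‖femStrain K Γ₀ ⟨φ, hφ⟩‖ ≤ (C₁ + C₂) * (∑ t, (m t)⁻¹) *
      l2 (volume.restrict (interior K.space)) (fun y => sym (grad φ y)) := by
    rw [mul_assoc]
    exact mul_le_mul_of_nonneg_left (h₃ ⟨φ, hφ⟩) (by positivity)
  have hn := norm_nonneg (femStrain K Γ₀ ⟨φ, hφ⟩)
  refine ⟨fun x hx => ?_, ?_⟩
  · refine (((femRestrict K Γ₀ ⟨φ, hφ⟩).norm_coe_le_norm ⟨x, hx⟩).trans (h₁ _)).trans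
      (le_trans ?_ h₄)
    exact mul_le_mul_of_nonneg_right (by linarith) hn
  · filter_upwards [hφ.ae_grad_eq hK] with x ⟨t, ht⟩
    rw [ht]
    refine ((norm_le_pi_norm (femGrad K Γ₀ ⟨φ, hφ⟩) t).trans (h₂ _)).trans (le_trans ?_ h₄)
    exact mul_le_mul_of_nonneg_right (by linarith) hn

end Discrete

/-! ### The approximate right-hand side -/

/-- A bounded function on a finite measure space is square integrable. -/
lemma l2_le_of_ae_bound {X E : Type*} [MeasurableSpace X] {μ : Measure X} [IsFiniteMeasure μ]
    [NormedAddCommGroup E] {F : X → E} {B : ℝ} (hB : 0 ≤ B) (h : ∀ᵐ x ∂μ, ‖F x‖ ≤ B) :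
    l2 μ F ≤ √(μ.real univ) * B := by
  have h1 : l2 μ (fun _ : X => (1 : ℝ)) = √(μ.real univ) := by
    rw [eq_comm, Real.sqrt_eq_iff_eq_sq measureReal_nonneg (l2_nonneg _),
      l2_sq_eq_integral (memLp_const 1)]
    simp
  rw [← h1, mul_comm]
  exact l2_le_mul hB (memLp_const 1) (by simpa using h)

/-- The maximum norm bounds of `exists_fem_bound` give every `L²` bound required, since the domain
has finite area and the loaded boundary finite length. -/
theorem exists_lipschitz_rhs_discrete {T R α ω₀ ω₁ : ℝ} (hT : 0 < T) (hα : 1 ≤ α)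
    (hω₁0 : 0 ≤ ω₁) (hω₁ : ω₁ < 1) {Ω : Set Plane} (hΩ : IsOpen Ω)
    {K : Geometry.SimplicialComplex ℝ Plane} (hK : IsTriangulation K) {Γ₀ Γ₂ : Set Plane}
    (hΓ₀ : Γ₀ ⊆ frontier (interior K.space)) (hΓ₀2 : Γ₀.Nontrivial)
    (hΓ₂ : Γ₂ ⊆ frontier (interior K.space)) (hΓ₂m : MeasurableSet Γ₂)
    {lam mu : Plane → ℝ} (hlame : IsLame (interior K.space) lam mu) {f τ : ℝ → Plane → Plane}
    {ρ : Plane → ℝ} (hρ : IsMollifier ρ) {g : ℝ → Plane → Mat2 → ℝ}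
    (hg : IsDamageProcess T Ω R α ω₀ ω₁ g) (hgt : IsLipschitzInTime T Ω R g) (M : ℝ≥0) :
    ∃ L : ℝ≥0, ∀ t ∈ Ioo 0 T, LoadBound (interior K.space) Γ₂ (f t) (τ t) M →
      ∀ᵐ x ∂(volume.restrict Ω), ∀ (v₁ v₂ : Plane → ℝ) (u₁ u₂ : Plane → Plane),
        IsDamageState Ω ω₁ v₁ → IsDamageState Ω ω₁ v₂ →
        IsDiscreteDisplacement K Γ₀ Γ₂ lam mu (f t) (τ t) (Ω.indicator v₁) u₁ →
        IsDiscreteDisplacement K Γ₀ Γ₂ lam mu (f t) (τ t) (Ω.indicator v₂) u₂ →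
        v₁ x ∈ Icc 0 ω₁ → v₂ x ∈ Icc 0 ω₁ →
        ‖mollifiedGrad ρ (interior K.space) (grad u₁) x‖ ≤ R →
        ‖mollifiedGrad ρ (interior K.space) (grad u₂) x‖ ≤ R →
        |rhs α ρ (interior K.space) g t x v₁ (grad u₁) -
            rhs α ρ (interior K.space) g t x v₂ (grad u₂)| ≤
          L * (|v₁ x - v₂ x| + supNorm Ω (fun y => v₁ y - v₂ y)) := by
  set Ω' := interior K.space with hΩ'
  set ν := (μH[1] : Measure Plane).restrict Γ₂ with hν
  have hfin : IsFiniteMeasure (volume.restrict Ω') := ⟨by simpa using hK.measure_ne_top.lt_top⟩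
  have hfinν : IsFiniteMeasure ν :=
    ⟨by simpa [hν] using (measure_mono hΓ₂).trans_lt hK.hausdorffMeasure_frontier_lt_top⟩
  have hΓ₂K : Γ₂ ⊆ K.space := hΓ₂.trans hK.frontier_subset_space
  obtain ⟨C, hC0, hC⟩ := exists_fem_bound hK hΓ₀ hΓ₀2
  obtain ⟨B, hB0, hB⟩ := hρ.exists_bound
  have hm : ∀ φ ∈ {φ | MemVh K Γ₀ φ}, MemLp (grad φ) 2 (volume.restrict Ω') :=
    fun φ hφ => hφ.memLp_grad hK
  set V := √((volume.restrict Ω').real univ)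
  obtain ⟨L, hL⟩ := exists_lipschitz_rhs (𝒯 := {φ | MemVh K Γ₀ φ}) (Ω' := Ω')
    -- `V` is the root of the area. `B * V` comes from Cauchy–Schwarz with the kernel bound, and
    -- each `V * C` or `√(ν.real univ) * C` from passing from a sup bound to an `L²` norm.
    (C := B * V * (V * C)) (A := M * (V * C) + M * (√(ν.real univ) * C)) hT hα hω₁ hg hgt hρ hlame
    hK.measure_ne_top (by positivity) hm
    (fun φ hφ ψ hψ => by
      refine ⟨φ + (-1 : ℝ) • ψ, hφ.add (hψ.smul _), ?_⟩
      filter_upwards [hK.ae_mem_interior] with x ⟨t, ht, hx⟩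
      rw [neg_one_smul, ← sub_eq_add_neg]
      exact grad_sub_apply (hφ.differentiableAt ht hx) (hψ.differentiableAt ht hx))
    (fun φ hφ x => by
      refine (norm_setIntegral_smul_le_l2 (Real.sq_sqrt measureReal_nonneg).ge
        (Real.sqrt_nonneg _) hB0 (ζ := fun y => ρ (x - y)) (fun y => hB _) (hm φ hφ)).trans ?_
      rw [mul_assoc (B * V), mul_assoc V]
      exact mul_le_mul_of_nonneg_left
        (l2_le_of_ae_bound (mul_nonneg hC0 (l2_nonneg _)) (hC φ hφ).2) (by positivity))
    (by positivity)
  -- A discrete displacement is itself a test field, so the approximation is exact.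
  have happ : ∀ u ∈ {φ | MemVh K Γ₀ φ}, ∀ δ > 0, ∃ φ ∈ {φ | MemVh K Γ₀ φ},
      l2 (volume.restrict Ω') (fun x => grad φ x - grad u x) ≤ δ :=
    fun u hu δ hδ => ⟨u, hu, by simpa [l2] using hδ.le⟩
  have hind : ∀ {p : Plane → Prop}, (∀ᵐ x ∂(volume.restrict Ω), p x) →
      ∀ᵐ x ∂(volume.restrict Ω'), x ∈ Ω → p x := fun h =>
    ae_restrict_of_ae ((ae_restrict_iff' hΩ.measurableSet).1 h)
  -- Part of the triangulated domain may lie outside `Ω`; there the extension is 0, which is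
  -- admissible because `0 ≤ ω₁`.
  have hmem : ∀ v, IsDamageState Ω ω₁ v →
      ∀ᵐ x ∂(volume.restrict Ω'), Ω.indicator v x ∈ Icc 0 ω₁ := fun v hv => by
    filter_upwards [hind hv.mem_Icc] with x hx
    by_cases hxΩ : x ∈ Ω
    · simpa [hxΩ] using hx hxΩ
    · simpa [hxΩ] using hω₁0
  have hmeas : ∀ v, IsDamageState Ω ω₁ v →
      AEMeasurable (Ω.indicator v) (volume.restrict Ω') := fun v hv =>
    ((aemeasurable_indicator_iff hΩ.measurableSet).2 hv.aemeasurable).restrict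
  refine ⟨L, fun t ht hload => ?_⟩
  filter_upwards [hL t ht] with x hx v₁ v₂ u₁ u₂ hv₁ hv₂ hu₁ hu₂ hx₁ hx₂ hm₁ hm₂
  refine hx v₁ v₂ (Ω.indicator v₁) (Ω.indicator v₂) (grad u₁) (grad u₂)
    (load Ω' Γ₂ (f t) (τ t)) _ (hm _ hu₁.memVh) (hm _ hu₂.memVh) (hmeas _ hv₁) (hmeas _ hv₂)
    (hmem _ hv₁) (hmem _ hv₂) (supNorm_nonneg _ _) ?_ (fun φ hφ => ?_) hu₁.discrete_eq
    hu₂.discrete_eq (happ _ hu₁.memVh) (happ _ hu₂.memVh) hx₁ hx₂ hm₁ hm₂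
  · filter_upwards [hind (hv₁.abs_sub_le_supNorm hv₂)] with y hy
    by_cases hyΩ : y ∈ Ω
    · simpa [hyΩ] using hy hyΩ
    · simpa [hyΩ] using supNorm_nonneg _ _
  · have hE : 0 ≤ C * l2 (volume.restrict Ω') (fun y => sym (grad φ y)) :=
      mul_nonneg hC0 (l2_nonneg _)
    have b1 : ∀ᵐ y ∂(volume.restrict Ω'), ‖φ y‖ ≤
        C * l2 (volume.restrict Ω') (fun y => sym (grad φ y)) := by
      filter_upwards [ae_restrict_mem isOpen_interior.measurableSet] with y hy
      exact (hC φ hφ).1 y (interior_subset hy)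
    have b2 : ∀ᵐ y ∂ν, ‖φ y‖ ≤ C * l2 (volume.restrict Ω') (fun y => sym (grad φ y)) := by
      filter_upwards [ae_restrict_mem hΓ₂m] with y hy
      exact (hC φ hφ).1 y (hΓ₂K hy)
    have m1 : MemLp φ 2 (volume.restrict Ω') := MemLp.of_bound
      ((hφ.continuousOn.mono interior_subset).aestronglyMeasurable
        isOpen_interior.measurableSet) _ b1
    have m2 : MemLp φ 2 ν := MemLp.of_bound
      ((hφ.continuousOn.mono hΓ₂K).aestronglyMeasurable hΓ₂m) _ b2
    refine (hload.abs_load_le m1 m2).trans ?_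
    have c1 := mul_le_mul_of_nonneg_left (l2_le_of_ae_bound hE b1) M.2
    have c2 := mul_le_mul_of_nonneg_left (l2_le_of_ae_bound hE b2) M.2
    refine (add_le_add c1 c2).trans (le_of_eq ?_)
    simp only [NNReal.val_eq_coe]
    ring

end Damage

end

theorem mainTheorem6
    (T α ω₀ ω₁ R : ℝ) (hT : 0 < T) (hα : 1 ≤ α) (hω₀ : 0 ≤ ω₀) (hω : ω₀ ≤ ω₁) (hω₁ : ω₁ < 1)
    (hR : 0 < R)
    (Ω Γ₀ Γ₁ Γ₂ : Set Damage.Plane) (hΩ : Damage.IsLipschitzDomain Ω)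
    (hΓ : Damage.IsBoundaryPartition Ω Γ₀ Γ₁ Γ₂)
    (lam mu : Damage.Plane → ℝ) (hlame : Damage.IsLame Ω lam mu)
    (f τ : ℝ → Damage.Plane → Damage.Plane)
    (ρ : Damage.Plane → ℝ) (hρ : Damage.IsMollifier ρ)
    (g : ℝ → Damage.Plane → Damage.Mat2 → ℝ)
    (hg : Damage.IsDamageProcess T Ω R α ω₀ ω₁ g) (hgt : Damage.IsLipschitzInTime T Ω R g)
    (K : Geometry.SimplicialComplex ℝ Damage.Plane) (hK : Damage.IsTriangulation K)
    (Γ₀h Γ₂h : Set Damage.Plane) (hΓ₀h : Γ₀h ⊆ frontier (interior K.space))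
    (hΓ₀h_nontrivial : Γ₀h.Nontrivial)
    (hΓ₂h : Γ₂h ⊆ frontier (interior K.space)) (hΓ₂h_meas : MeasurableSet Γ₂h)
    (lamh muh : Damage.Plane → ℝ) (hlameh : Damage.IsLame (interior K.space) lamh muh)
    (τh : ℝ → Damage.Plane → Damage.Plane) :
    -- the exact right-hand side
    (∀ M : ℝ≥0, ∃ L : ℝ≥0, ∀ t ∈ Ioo 0 T, Damage.LoadBound Ω Γ₂ (f t) (τ t) M →
      ∀ᵐ x ∂(volume.restrict Ω), ∀ (v₁ v₂ : Damage.Plane → ℝ)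
        (u₁ u₂ : Damage.Plane → Damage.Plane) (G₁ G₂ : Damage.Plane → Damage.Mat2),
        Damage.IsDamageState Ω ω₁ v₁ → Damage.IsDamageState Ω ω₁ v₂ →
        Damage.IsDisplacement Ω Γ₀ Γ₂ lam mu (f t) (τ t) v₁ u₁ G₁ →
        Damage.IsDisplacement Ω Γ₀ Γ₂ lam mu (f t) (τ t) v₂ u₂ G₂ →
        v₁ x ∈ Icc 0 ω₁ → v₂ x ∈ Icc 0 ω₁ →
        ‖Damage.mollifiedGrad ρ Ω G₁ x‖ ≤ R → ‖Damage.mollifiedGrad ρ Ω G₂ x‖ ≤ R →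
        |Damage.rhs α ρ Ω g t x v₁ G₁ - Damage.rhs α ρ Ω g t x v₂ G₂| ≤
          L * (|v₁ x - v₂ x| + Damage.supNorm Ω (fun y => v₁ y - v₂ y))) ∧
    -- the approximate right-hand side
    (∀ M : ℝ≥0, ∃ L : ℝ≥0, ∀ t ∈ Ioo 0 T,
      Damage.LoadBound (interior K.space) Γ₂h (f t) (τh t) M →
      ∀ᵐ x ∂(volume.restrict Ω), ∀ (v₁ v₂ : Damage.Plane → ℝ)
        (u₁ u₂ : Damage.Plane → Damage.Plane),
        Damage.IsDamageState Ω ω₁ v₁ → Damage.IsDamageState Ω ω₁ v₂ →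
        Damage.IsDiscreteDisplacement K Γ₀h Γ₂h lamh muh (f t) (τh t) (Ω.indicator v₁) u₁ →
        Damage.IsDiscreteDisplacement K Γ₀h Γ₂h lamh muh (f t) (τh t) (Ω.indicator v₂) u₂ →
        v₁ x ∈ Icc 0 ω₁ → v₂ x ∈ Icc 0 ω₁ →
        ‖Damage.mollifiedGrad ρ (interior K.space) (Damage.grad u₁) x‖ ≤ R →
        ‖Damage.mollifiedGrad ρ (interior K.space) (Damage.grad u₂) x‖ ≤ R →
        |Damage.rhs α ρ (interior K.space) g t x v₁ (Damage.grad u₁) -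
            Damage.rhs α ρ (interior K.space) g t x v₂ (Damage.grad u₂)| ≤
          L * (|v₁ x - v₂ x| + Damage.supNorm Ω (fun y => v₁ y - v₂ y))) :=
  ⟨fun M => Damage.exists_lipschitz_rhs_exact hT hα hω₁ hΩ hΓ hlame hρ hg hgt M,
    fun M => Damage.exists_lipschitz_rhs_discrete hT hα (hω₀.trans hω) hω₁ hΩ.isOpen hK hΓ₀h
      hΓ₀h_nontrivial hΓ₂h hΓ₂h_meas hlameh hρ hg hgt M⟩
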